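/- Let $\Bbbk$ be an algebraically closed field of characteristic $0$ and let $\mathbb N=\{1,2,\dots\}$. For $X\subset\mathbb P^{n}$ write $\widehat X$ for its affine cone, and let $\sigma_s(X)$ be the Zariski closure of the union of the linear spans of $s$ points of $X$; it is *nondefective* if $\dim\sigma_s(X)=\min\{s(\dim X+1)-1,\,n\}$. Varieties are irreducible. *Finite calculus.* Fix $\ell,K_0\in\mathbb N$, put $t_0=\ell K_0+1$ and $K(t)=\min\{\lceil t/\ell\rceil-1,K_0\}$. Let $\nabla f(t)=f(t)-f(t-\ell)$. A function is $\ell$-*quasipolynomial* of degree $d$ if on each residue class modulo $\ell$ it is a polynomial of degree $d$, all these polynomials having the same leading coefficient. Let $N$ and $m$ be $\ell$-quasipolynomial functions with values in the nonnegative integers, of degree $K_0$ and $1$ respectively, and let $X(t)\subset\mathbb P^{N(t)-1}$ $(t\in\mathbb N)$ be projective varieties with $\dim X(t)=m(t)-1$. *Brambilla–Ottaviani lattice.* Subspaces $U_1,\dots,U_i$ of a vector space of dimension $N(t)$ generate an $(N,\ell)$-*lattice* if the lattice they generate under $+$ and $\cap$ is distributive and $\dim\bigcap_{j\in I}U_j=N(t-|I|\ell)$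 for all $I\subset\{1,\dots,i\}$. Suppose that for each $t>\ell$ we are given linear subspaces $P_1(t),\dots,P_{K(t)}(t)\subset\mathbb P^{N(t)-1}$, and for each $t>t_0$ a further linear subspace $P'(t)\subset\mathbb P^{N(t)-1}$ with $\dim\widehat P'(t)=N(t_0)$; write $P_I(t)=\bigcap_{j\in I}P_j(t)$, with $P_\emptyset(t)=\mathbb P^{N(t)-1}$. Suppose that they form a *Brambilla–Ottaviani lattice*: (a) for $t>\ell$, $\widehat P_1(t),\dots,\widehat P_{K(t)}(t)$ generate an $(N,\ell)$-lattice; (b) for $t>\ell$ and nonempty $I\subset\{1,\dots,K(t)\}$, $X(t)\cap P_I(t)\cong X(t-|I|\ell)$; (c) for $t>t_0$, $\widehat P'(t)\cap\widehat P_1(t),\dots,\widehat P'(t)\cap\widehat P_{K_0}(t)$ generate an $(N,\ell)$-lattice in $\widehat P'(t)$ (with $t_0$ in the role of $t$), and $\widehat P'(t),\widehat P_1(t),\dots,\widehat P_{K_0}(t)$ generate a distributive lattice; (d) for $t>t_0$ and $I\subset\{1,\dots,K_0\}$, $X(t)\cap P'(t)\cap P_I(t)\cong X(t_0-|I|\ell)$.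 Here, for $Q=P_I(t)$, resp. $Q=P'(t)\cap P_I(t)$, and $u=t-|I|\ell$, resp. $u=t_0-|I|\ell$, the notation $X(t)\cap Q\cong X(u)$ means: some linear isomorphism $\widehat Q\to\Bbbk^{N(u)}$ carries $X(t)\cap Q$ onto $X(u)$ and carries the planes $P_j(t)\cap Q$, $j\notin I$, to planes $P_{\sigma(j)}(u)$ for some injection $\sigma:\{1,\dots,K(t)\}\setminus I\to\{1,\dots,K(u)\}$; moreover a generic point $p$ of $X(t)\cap Q$ is a smooth point of $X(t)$, with $T_p\widehat X(t)\cap\widehat Q=T_p(\widehat{X(t)\cap Q})$. *The statements $\mathbb A_{i,s}(t)$.* Let $s:\mathbb N\to\mathbb Z$, $1\le t\le t_0$ and $0\le i\le K(t)$. For every $I\subset\{1,\dots,K(t)\}$ choose $\nabla^{K(t)-|I|}s(t-|I|\ell)$ generic points on $X(t)\cap P_I(t)$, let $Z(t)$ be the collection of all these points, and set $$A_i(t)=\sum_{j=1}^i\widehat P_j(t)+\sum_{p\in Z(t)}T_p\widehat X(t),$$ $$a_i(t)=N(t)-\nabla^iN(t)+i\,\nabla m(t)\,\nabla^{i-1}s(t-\ell)+m(t)\,\nabla^is(t),$$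 where the third summand of $a_i(t)$ is $0$ if $i=0$. The statement $\mathbb A_{i,s}(t)$ is *true* if these numbers of points are all nonnegative and $\dim A_i(t)=\min\{a_i(t),N(t)\}$ (for generic choices of the points); it is *subabundant* if $a_i(t)\le N(t)$ and *superabundant* if $a_i(t)\ge N(t)$. **Corollary.** Suppose that $s_2(t)=\lceil N(t)/m(t)\rceil$ is $\ell$-quasipolynomial. Then so is $s_1(t)=s_2(t)-1$. If moreover, for all $1\le t\le t_0$, $\mathbb A_{K(t),s_1}(t)$ is true and subabundant and $\mathbb A_{K(t),s_2}(t)$ is true and superabundant, then $\sigma_s(X(t))$ is nondefective for all $s,t\in\mathbb N$. -/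

import Mathlib

open scoped LinearAlgebra.Projectivization

noncomputable section

namespace BOLattice

/-! ### Finite calculus.  Throughout, `ℕ` is indexed from `1`: values at `0` are never used. -/

/-- The iterated backward difference `∇ⁱ f` with step size `ℓ`.  It is only ever evaluated at
`t > i * ℓ`, where no subtraction is truncated. -/
def bdiff (ℓ : ℕ) : ℕ → (ℕ → ℤ) → ℕ → ℤ
  | 0, f, t => f t
  | i + 1, f, t => bdiff ℓ i f t - bdiff ℓ i f (t - ℓ)

/-- `f` is quasipolynomial of quasiperiod `ℓ`, degree `d`, with common leading coefficient `a`: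
on each residue class modulo `ℓ` it is a polynomial function of degree `d` with leading
coefficient `a`. -/
def IsQuasipolynomialWith (ℓ d : ℕ) (a : ℚ) (f : ℕ → ℤ) : Prop :=
  ∃ p : ℕ → Polynomial ℚ,
    (∀ r < ℓ, (p r).natDegree = d ∧ (p r).leadingCoeff = a) ∧
    ∀ t : ℕ, 1 ≤ t → (f t : ℚ) = (p (t % ℓ)).eval (t : ℚ)

/-- `f` is `ℓ`-quasipolynomial of degree `d`. -/
def IsQuasipolynomialOfDegree (ℓ d : ℕ) (f : ℕ → ℤ) : Prop :=
  ∃ a : ℚ, IsQuasipolynomialWith ℓ d a f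

/-- `f` is `ℓ`-quasipolynomial (of some degree). -/
def IsQuasipolynomial (ℓ : ℕ) (f : ℕ → ℤ) : Prop :=
  ∃ d : ℕ, IsQuasipolynomialOfDegree ℓ d f

/-! ### Projective varieties and their secant varieties -/

section Varieties

variable {k : Type*} [Field k] {n : ℕ}

/-- The affine cone over a set of points of `ℙⁿ⁻¹ = ℙ(kⁿ)` (it contains the origin). -/
def affineCone (X : Set (ℙ k (Fin n → k))) : Set (Fin n → k) :=
  {v | ∀ h : v ≠ 0, Projectivization.mk k v h ∈ X}

/-- The ideal of polynomials vanishing on the affine cone over `X`. -/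
def coneIdeal (X : Set (ℙ k (Fin n → k))) : Ideal (MvPolynomial (Fin n) k) :=
  MvPolynomial.vanishingIdeal k (affineCone X)

/-- The Zariski closure of a set of points of projective space. -/
def zariskiClosure (X : Set (ℙ k (Fin n → k))) : Set (ℙ k (Fin n → k)) :=
  {p | ∀ f ∈ coneIdeal X, MvPolynomial.eval p.rep f = 0}

/-- An (irreducible) projective variety: a nonempty, Zariski closed, irreducible set. -/
def IsProjectiveVariety (X : Set (ℙ k (Fin n → k))) : Prop :=
  X.Nonempty ∧ zariskiClosure X = X ∧ (coneIdeal X).IsPrime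

/-- The dimension of (the Zariski closure of) a set of points of projective space: the Krull
dimension of the homogeneous coordinate ring, minus one.  The Krull dimension of a nonzero finitely
generated algebra is a natural number, so no default value is involved. -/
def projDim (X : Set (ℙ k (Fin n → k))) : ℤ :=
  (((ringKrullDim (MvPolynomial (Fin n) k ⧸ coneIdeal X)).unbotD 0).toNat : ℤ) - 1

/-- The `s`th secant variety: the Zariski closure of the union of the linear spans of `s` points
of `X`. -/
def secantVariety (s : ℕ) (X : Set (ℙ k (Fin n → k))) : Set (ℙ k (Fin n → k)) :=
  zariskiClosure {q | ∃ p : Fin s → ℙ k (Fin n → k),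
    (∀ i, p i ∈ X) ∧ q.submodule ≤ ⨆ i, (p i).submodule}

/-- The expected dimension of the `s`th secant variety of `X ⊆ ℙⁿ⁻¹`. -/
def secantExpDim (s : ℕ) (X : Set (ℙ k (Fin n → k))) : ℤ :=
  min ((s : ℤ) * (projDim X + 1) - 1) ((n : ℤ) - 1)

/-- The `s`th secant variety of `X` is nondefective. -/
def IsNondefective (s : ℕ) (X : Set (ℙ k (Fin n → k))) : Prop :=
  projDim (secantVariety s X) = secantExpDim s X

/-- The tangent space `T_v X̂` at the point `v` of the affine cone `X̂` over `X`, as a linear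
subspace of the ambient vector space. -/
def coneTangent (X : Set (ℙ k (Fin n → k))) (v : Fin n → k) : Submodule k (Fin n → k) where
  carrier := {w | ∀ f ∈ coneIdeal X, ∑ i, MvPolynomial.eval v (MvPolynomial.pderiv i f) * w i = 0}
  add_mem' := by
    intro a b ha hb f hf
    have h1 := ha f hf
    have h2 := hb f hf
    simp only [Pi.add_apply, mul_add, Finset.sum_add_distrib, h1, h2, add_zero]
  zero_mem' := by
    intro f _
    simp
  smul_mem' := by
    intro c a ha f hf
    have h1 := ha f hf
    simp only [Pi.smul_apply, smul_eq_mul, mul_left_comm _ c, ← Finset.mul_sum, h1, mul_zero]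

/-- The intersection `X ∩ ℙ(Q)` with the linear subspace of projective space defined by the
vector subspace `Q`. -/
def planeSection (X : Set (ℙ k (Fin n → k))) (Q : Submodule k (Fin n → k)) :
    Set (ℙ k (Fin n → k)) :=
  {p | p ∈ X ∧ p.submodule ≤ Q}

/-- The property `R` holds for generic `(vᵢ)ᵢ ∈ ∏ᵢ Sᵢ`: it holds on the nonempty set of all
tuples in the product at which some given polynomial does not vanish. -/
def HoldsGenerically {ι : Type*} (S : ι → Set (Fin n → k)) (R : (ι → Fin n → k) → Prop) : Prop :=
  ∃ F : MvPolynomial (ι × Fin n) k,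
    (∃ v : ι → Fin n → k, (∀ i, v i ∈ S i) ∧ MvPolynomial.eval (fun q => v q.1 q.2) F ≠ 0) ∧
    ∀ v : ι → Fin n → k, (∀ i, v i ∈ S i) → MvPolynomial.eval (fun q => v q.1 q.2) F ≠ 0 → R v

/-- A generic point of `X ∩ ℙ(Q)` is a smooth point of `X`, and there the tangent space of
`X ∩ ℙ(Q)` is the intersection of that of `X` with `Q` (all on the level of affine cones): the
scheme-theoretic intersection is generically reduced, and not contained in the singular locus
of `X`. -/
def IsCleanSection (X : Set (ℙ k (Fin n → k))) (Q : Submodule k (Fin n → k)) : Prop :=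
  HoldsGenerically (fun _ : Unit => affineCone (planeSection X Q)) fun v =>
    (Module.finrank k (coneTangent X (v ())) : ℤ) = projDim X + 1 ∧
    coneTangent (planeSection X Q) (v ()) = coneTangent X (v ()) ⊓ Q

/-- The linear isomorphism `φ : Q ≃ kⁿ'` carries `X ∩ ℙ(Q)` onto `Y ⊆ ℙ(kⁿ')`. -/
def CarriesSection {n' : ℕ} (X : Set (ℙ k (Fin n → k))) (Q : Submodule k (Fin n → k))
    (Y : Set (ℙ k (Fin n' → k))) (φ : Q ≃ₗ[k] (Fin n' → k)) : Prop :=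
  ∀ v : Q, (v : Fin n → k) ∈ affineCone X ↔ φ v ∈ affineCone Y

/-- The linear isomorphism `φ : Q ≃ kⁿ'` carries the subspaces `U j ∩ Q`, `j ∈ J`, to distinctly
labelled members of the family `U'`. -/
def CarriesPlanes {n' i i' : ℕ} (J : Finset (Fin i)) (U : Fin i → Submodule k (Fin n → k))
    (Q : Submodule k (Fin n → k)) (U' : Fin i' → Submodule k (Fin n' → k))
    (φ : Q ≃ₗ[k] (Fin n' → k)) : Prop :=
  ∃ σ : {j : Fin i // j ∈ J} → Fin i', Function.Injective σ ∧
    ∀ j, ((U j.1).comap Q.subtype).map (φ : Q →ₗ[k] (Fin n' → k)) = U' (σ j)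

end Varieties

/-! ### Brambilla–Ottaviani lattices -/

section Lattices

/-- The lattice of subspaces generated by the members of `S` is distributive. -/
def GeneratesDistributive {k V : Type*} [Field k] [AddCommGroup V] [Module k V]
    (S : Set (Submodule k V)) : Prop :=
  ∀ A ∈ latticeClosure S, ∀ B ∈ latticeClosure S, ∀ C ∈ latticeClosure S,
    A ⊓ (B ⊔ C) = (A ⊓ B) ⊔ (A ⊓ C)

/-- The subspaces `U₁, …, Uᵢ` of the vector space `W` generate an `(N, ℓ)`-lattice in `W`, where
`dim W = N t`. -/
def IsNLattice {k V : Type*} [Field k] [AddCommGroup V] [Module k V] (ℓ : ℕ) (N : ℕ → ℕ)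
    (t : ℕ) (W : Submodule k V) {i : ℕ} (U : Fin i → Submodule k V) : Prop :=
  (∀ j, U j ≤ W) ∧ GeneratesDistributive (Set.range U) ∧
    ∀ I : Finset (Fin i), Module.finrank k ↥(W ⊓ ⨅ j ∈ I, U j) = N (t - I.card * ℓ)

/-- `K(t) = min {⌈t/ℓ⌉ - 1, K₀}`. -/
def kay (ℓ K₀ t : ℕ) : ℕ := min (t ⌈/⌉ ℓ - 1) K₀

/-- `t₀ = ℓ K₀ + 1`. -/
def tzero (ℓ K₀ : ℕ) : ℕ := ℓ * K₀ + 1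

variable {k : Type*} [Field k]

/-- `{X(t)}` is an `(N, m)`-family: `X(t)` is a projective variety in `ℙ^{N(t)-1}` of dimension
`m(t) - 1`. -/
def IsFamily (N m : ℕ → ℕ) (X : (t : ℕ) → Set (ℙ k (Fin (N t) → k))) : Prop :=
  ∀ t : ℕ, 1 ≤ t → IsProjectiveVariety (X t) ∧ projDim (X t) = (m t : ℤ) - 1

/-- The planes `P₁(t), …, P_{K(t)}(t)` and, for `t > t₀`, the plane `P'(t)`, all given by their
underlying vector spaces, form a Brambilla–Ottaviani lattice for the family `{X(t)}`.  The
isomorphisms `X(t) ∩ ⋂_{j ∈ I} P_j(t) ≅ X(t - |I| ℓ)` are linear isomorphisms of the planes that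
identify the induced configuration (variety and planes) with the one at the smaller parameter, and
the intersections with `X(t)` are understood with their scheme structure, generically. -/
structure IsBOLattice (ℓ K₀ : ℕ) (N : ℕ → ℕ) (X : (t : ℕ) → Set (ℙ k (Fin (N t) → k)))
    (P : (t : ℕ) → Fin (kay ℓ K₀ t) → Submodule k (Fin (N t) → k))
    (P' : (t : ℕ) → Submodule k (Fin (N t) → k)) : Prop where
  /-- For `t > ℓ`, the planes generate an `(N, ℓ)`-lattice. -/
  lattice : ∀ t : ℕ, ℓ < t → IsNLattice ℓ N t ⊤ (P t)
  /-- The intersections of `X(t)` with intersections of the planes are clean. -/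
  clean : ∀ t : ℕ, ℓ < t → ∀ I : Finset (Fin (kay ℓ K₀ t)), I.Nonempty →
    IsCleanSection (X t) (⨅ j ∈ I, P t j)
  /-- `X(t) ∩ ⋂_{j ∈ I} P_j(t) ≅ X(t - |I| ℓ)` for nonempty `I`. -/
  iso : ∀ t : ℕ, ℓ < t → ∀ I : Finset (Fin (kay ℓ K₀ t)), I.Nonempty →
    ∃ φ : ↥(⨅ j ∈ I, P t j) ≃ₗ[k] (Fin (N (t - I.card * ℓ)) → k),
      CarriesSection (X t) (⨅ j ∈ I, P t j) (X (t - I.card * ℓ)) φ ∧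
      CarriesPlanes Iᶜ (P t) (⨅ j ∈ I, P t j) (P (t - I.card * ℓ)) φ
  /-- For `t > t₀`, the traces `P'(t) ∩ P_j(t)` generate an `(N, ℓ)`-lattice in `P'(t)`, and
  `P'(t)` together with the `P_j(t)` generates a distributive lattice. -/
  lattice' : ∀ t : ℕ, tzero ℓ K₀ < t →
    IsNLattice ℓ N (tzero ℓ K₀) (P' t) (fun j => P' t ⊓ P t j) ∧
    GeneratesDistributive (insert (P' t) (Set.range (P t)))
  /-- The intersections of `X(t)` with `P'(t) ∩ ⋂_{j ∈ I} P_j(t)` are clean. -/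
  clean' : ∀ t : ℕ, tzero ℓ K₀ < t → ∀ I : Finset (Fin (kay ℓ K₀ t)),
    IsCleanSection (X t) (P' t ⊓ ⨅ j ∈ I, P t j)
  /-- `X(t) ∩ P'(t) ∩ ⋂_{j ∈ I} P_j(t) ≅ X(t₀ - |I| ℓ)` for all `I`. -/
  iso' : ∀ t : ℕ, tzero ℓ K₀ < t → ∀ I : Finset (Fin (kay ℓ K₀ t)),
    ∃ φ : ↥(P' t ⊓ ⨅ j ∈ I, P t j) ≃ₗ[k] (Fin (N (tzero ℓ K₀ - I.card * ℓ)) → k),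
      CarriesSection (X t) (P' t ⊓ ⨅ j ∈ I, P t j) (X (tzero ℓ K₀ - I.card * ℓ)) φ ∧
      CarriesPlanes Iᶜ (P t) (P' t ⊓ ⨅ j ∈ I, P t j) (P (tzero ℓ K₀ - I.card * ℓ)) φ

/-! ### The statements `𝔸_{i,s}(t)`, for `1 ≤ t ≤ t₀` -/

/-- The number `∇^{K(t)-|I|} s(t - |I| ℓ)` of points placed on `X(t) ∩ ⋂_{j ∈ I} P_j(t)`. -/
def pointCount (ℓ K₀ : ℕ) (s : ℕ → ℤ) (t : ℕ) (I : Finset (Fin (kay ℓ K₀ t))) : ℤ :=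
  bdiff ℓ (kay ℓ K₀ t - I.card) s (t - I.card * ℓ)

/-- Labels of the points of the configuration `Z(t)`. -/
abbrev PointIndex (ℓ K₀ : ℕ) (s : ℕ → ℤ) (t : ℕ) : Type :=
  Σ I : Finset (Fin (kay ℓ K₀ t)), Fin (pointCount ℓ K₀ s t I).toNat

/-- The vector space `A_i(t)`, sum of `P̂₁(t), …, P̂_i(t)` and of the tangent spaces to the cone
over `X(t)` at the points `z` of the configuration. -/
def bigA {ℓ K₀ : ℕ} {N : ℕ → ℕ} (X : (t : ℕ) → Set (ℙ k (Fin (N t) → k)))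
    (P : (t : ℕ) → Fin (kay ℓ K₀ t) → Submodule k (Fin (N t) → k))
    (i t : ℕ) {ι : Type*} (z : ι → Fin (N t) → k) : Submodule k (Fin (N t) → k) :=
  (⨆ j : {j : Fin (kay ℓ K₀ t) // j.val < i}, P t j.1) ⊔ ⨆ x, coneTangent (X t) (z x)

/-- `a_i(t) = N(t) - ∇ⁱN(t) + i ∇m(t) ∇^{i-1}s(t-ℓ) + m(t) ∇ⁱs(t)`
(the third summand is `0` for `i = 0`). -/
def smallA (ℓ : ℕ) (N m : ℕ → ℕ) (s : ℕ → ℤ) (i t : ℕ) : ℤ :=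
  (N t : ℤ) - bdiff ℓ i (fun u => (N u : ℤ)) t
    + (i : ℤ) * bdiff ℓ 1 (fun u => (m u : ℤ)) t * bdiff ℓ (i - 1) s (t - ℓ)
    + (m t : ℤ) * bdiff ℓ i s t

/-- The statement `𝔸_{i,s}(t)` is true: the numbers of points to be placed are nonnegative and,
for generic points as prescribed, `A_i(t)` has the expected dimension `min {a_i(t), N(t)}`. -/
def StatementTrue {ℓ K₀ : ℕ} {N : ℕ → ℕ} (m : ℕ → ℕ) (X : (t : ℕ) → Set (ℙ k (Fin (N t) → k)))
    (P : (t : ℕ) → Fin (kay ℓ K₀ t) → Submodule k (Fin (N t) → k))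
    (s : ℕ → ℤ) (i t : ℕ) : Prop :=
  (∀ I : Finset (Fin (kay ℓ K₀ t)), 0 ≤ pointCount ℓ K₀ s t I) ∧
  HoldsGenerically
    (fun x : PointIndex ℓ K₀ s t => affineCone (planeSection (X t) (⨅ j ∈ x.1, P t j)))
    fun z => (Module.finrank k (bigA X P i t z) : ℤ) = min (smallA ℓ N m s i t) (N t : ℤ)

/-- `𝔸_{i,s}(t)` is subabundant. -/
def Subabundant (ℓ : ℕ) (N m : ℕ → ℕ) (s : ℕ → ℤ) (i t : ℕ) : Prop :=
  smallA ℓ N m s i t ≤ (N t : ℤ)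

/-- `𝔸_{i,s}(t)` is superabundant. -/
def Superabundant (ℓ : ℕ) (N m : ℕ → ℕ) (s : ℕ → ℤ) (i t : ℕ) : Prop :=
  (N t : ℤ) ≤ smallA ℓ N m s i t

end Lattices

end BOLattice

end

noncomputable section

namespace BOLattice

open scoped TensorProduct
open KaehlerDifferential

/-! ### Krull dimension and differentials of affine domains. -/

section Dimension

/-! By Terracini's lemma (`isNondefective_of_finrank`), σ_s(X(t)) is nondefective once some s smooth
points of the cone have tangent spaces spanning at least min{s m(t), N(t)} dimensions. The rank of a
sum of tangent spaces is lower semicontinuous at smooth points (`IsIrreducibleOfDim.exists_nhd`).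
Points may therefore be specialised onto the planes P_I, and only lower bounds b on dimensions have
to be carried along (`HasSpanningPoints`).

Put ∇^{K-|I|}s(t-|I|ℓ) points on each P_I. Since ∇^d s(u) = ∇^{d+1}s(u) + ∇^d s(u-ℓ), these numbers
recombine to s(t) as the labels are forgotten one at a time (`ConfigurationSpans.erase_label`). Let
A_J be the sum of the P_j, j ∈ J, and of all the tangent spaces. For i ∉ J, dim A_J = dim(A_J + P_i)
+ dim(A_J ∩ P_i) - N(t-ℓ), and A_J ∩ P_i contains a copy of the analogous space for X(t-ℓ). So A_J
at t is controlled by A_{J∪i} at t and A_J at t-ℓ (`ConfigurationSpans.of_insert_plane`), and the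
numbers a_i satisfy the same recursion (`smallA_pred`). Induction on t leaves only the case where J
contains all planes.

For t ≤ t₀ that case is the hypothesis. For t > t₀ one works modulo ∑P_j, whose codimension ∇^{K₀}N
is constant, so that P'(t) maps onto the quotient (`IsBOLattice.iSup_sup_eq_top`). At a generic
point on two or more planes the tangent space lies in ∑P_j (`IsBOLattice.generic_tangent_le`). There
are no points off the planes, because ∇^{K₀}s = 0. The number ∇^{K₀-1}s of points on exactly one
plane is constant; these points are moved into P'(t), where the configuration is the one at t₀
(`ConfigurationSpans.of_tzero`). Constancy holds because 0 ≤ s₂m ≤ N + m forces s₂ to have degree at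
most K₀-1 (`exists_bdiff_eq_of_ceil`).

With s₁ and b = a_i, the s₁(t) tangent spaces come out independent, which settles s ≤ s₁(t). With s₂
and b = N they fill the ambient space, which settles s ≥ s₂(t). -/

theorem ringKrullDim_le_of_isIntegral_of_injective {R S : Type*} [CommRing R] [CommRing S]
    [Algebra R S] [Algebra.IsIntegral R S] :
    ringKrullDim S ≤ ringKrullDim R := by
  refine Order.krullDim_le_of_strictMono (PrimeSpectrum.comap (algebraMap R S)) ?_
  intro p q hpq
  exact Ideal.IsIntegral.comap_lt_comap hpq

/-- Lying over lifts the bottom prime of a chain, and going up lifts the rest. -/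
theorem ringKrullDim_eq_of_isIntegral_of_injective {R S : Type*} [CommRing R] [CommRing S]
    [IsDomain S] [Algebra R S] [Algebra.IsIntegral R S] (h : Function.Injective (algebraMap R S)) :
    ringKrullDim S = ringKrullDim R := by
  refine le_antisymm ringKrullDim_le_of_isIntegral_of_injective ?_
  refine iSup_le fun l => ?_
  obtain ⟨P, hP, hPl⟩ := Ideal.exists_ideal_over_prime_of_isIntegral_of_isDomain
    (S := S) (RelSeries.head l).asIdeal (by
      rw [(RingHom.injective_iff_ker_eq_bot _).1 h]; exact bot_le)
  have : P.LiesOver (RelSeries.head l).asIdeal := ⟨hPl.symm⟩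
  obtain ⟨L, hL, -, -⟩ := Ideal.exists_ltSeries_of_hasGoingUp l P
  exact hL ▸ le_iSup (fun q : LTSeries (PrimeSpectrum S) => ((q.length : ℕ∞) : WithBot ℕ∞)) L

/-- Noether normalization, recording the Krull dimension and the transcendence degree. -/
theorem exists_noether_normalization (k A : Type*) [Field k] [CommRing A] [IsDomain A]
    [Algebra k A] [Algebra.FiniteType k A] :
    ∃ (d : ℕ) (g : MvPolynomial (Fin d) k →ₐ[k] A), Function.Injective g ∧ g.IsIntegral ∧
      ringKrullDim A = d ∧ Algebra.trdeg k A = d := by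
  obtain ⟨d, g, hg, hi⟩ := exists_integral_inj_algHom_of_fg k A
  refine ⟨d, g, hg, hi, ?_, ?_⟩
  · let _ := g.toRingHom.toAlgebra
    have : Algebra.IsIntegral (MvPolynomial (Fin d) k) A := ⟨hi⟩
    rw [ringKrullDim_eq_of_isIntegral_of_injective (R := MvPolynomial (Fin d) k) hg]
    simp [ringKrullDim_eq_zero_of_field]
  · have hx : AlgebraicIndependent k (fun i => g (MvPolynomial.X i)) := by
      rw [algebraicIndependent_iff_injective_aeval]
      convert hg
      ext i
      simp
    let _ := g.toRingHom.toAlgebra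
    have : Algebra.IsIntegral (MvPolynomial (Fin d) k) A := ⟨hi⟩
    have hr : (Algebra.adjoin k (Set.range fun i => g (MvPolynomial.X i))) = g.range := by
      rw [Algebra.adjoin_range_eq_range_aeval]
      congr 1
      ext i
      simp
    have hb : IsTranscendenceBasis k (fun i => g (MvPolynomial.X i)) := by
      rw [hx.isTranscendenceBasis_iff_isAlgebraic]
      rw [hr]
      refine ⟨fun a => ?_⟩
      have := (hi a)
      obtain ⟨p, hp, hpa⟩ := this
      refine IsIntegral.isAlgebraic ⟨p.map g.rangeRestrict.toRingHom, hp.map _, ?_⟩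
      rw [Polynomial.eval₂_map]
      exact hpa
    have := hb.lift_cardinalMk_eq_trdeg
    simpa using this.symm

variable (k : Type*) [Field k] [CharZero k]

/-- For a Noether normalization P ⊆ A, both A → L and P → Frac P → L are formally étale:
localizations, followed in the second case by an algebraic extension that is separable in
characteristic 0. Hence L ⊗ Ω_A ≅ Ω_L ≅ L ⊗ Ω_P, and the last has basis dX₁, …, dX_d. -/
theorem finrank_tensor_kaehlerDifferential (A L : Type*) [CommRing A] [IsDomain A]
    [Algebra k A] [Algebra.FiniteType k A] [Field L] [Algebra k L] [Algebra A L]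
    [IsScalarTower k A L] [IsFractionRing A L] (d : ℕ) (hd : ringKrullDim A = d) :
    Module.finrank L (L ⊗[A] Ω[A⁄k]) = d ∧ Module.Finite L (L ⊗[A] Ω[A⁄k]) := by
  obtain ⟨d', g, hg, hi, hd', -⟩ := exists_noether_normalization k A
  obtain rfl : d = d' := by exact_mod_cast hd.symm.trans hd'
  set P := MvPolynomial (Fin d) k
  let _ : Algebra P A := g.toRingHom.toAlgebra
  have : IsScalarTower k P A := IsScalarTower.of_algHom g
  have : Algebra.IsIntegral P A := ⟨hi⟩
  let _ : Algebra P L := ((algebraMap A L).comp (algebraMap P A)).toAlgebra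
  have : IsScalarTower P A L := IsScalarTower.of_algebraMap_eq fun _ => rfl
  have : IsScalarTower k P L := IsScalarTower.of_algebraMap_eq fun x => by
    rw [IsScalarTower.algebraMap_apply P A L, ← IsScalarTower.algebraMap_apply k P A,
      ← IsScalarTower.algebraMap_apply k A L]
  have hPL : Function.Injective (algebraMap P L) :=
    (IsFractionRing.injective A L).comp hg
  have : FaithfulSMul P L := (faithfulSMul_iff_algebraMap_injective P L).2 hPL
  have : FaithfulSMul P A := (faithfulSMul_iff_algebraMap_injective P A).2 hg
  let _ : Algebra (FractionRing P) L := FractionRing.liftAlgebra P L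
  have : Algebra.IsAlgebraic P A := inferInstance
  have : Algebra.IsAlgebraic (FractionRing P) L := by
    have : Algebra.IsAlgebraic P L := (IsFractionRing.isAlgebraic_iff' P A L).1 inferInstance
    exact (IsFractionRing.comap_isAlgebraic_iff (A := P) (K := FractionRing P)).1 this
  have : CharZero (FractionRing P) := charZero_of_injective_algebraMap
    (algebraMap k (FractionRing P)).injective
  have : Algebra.FormallyEtale (FractionRing P) L := Algebra.FormallyEtale.of_isSeparable _ _
  have : Algebra.FormallyEtale P (FractionRing P) :=
    Algebra.FormallyEtale.of_isLocalization (nonZeroDivisors P)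
  have : Algebra.FormallyEtale P L := Algebra.FormallyEtale.comp P (FractionRing P) L
  have : Algebra.FormallyEtale A L :=
    Algebra.FormallyEtale.of_isLocalization (nonZeroDivisors A)
  let e : L ⊗[A] Ω[A⁄k] ≃ₗ[L] L ⊗[P] Ω[P⁄k] :=
    (tensorKaehlerEquivOfFormallyEtale k A L).trans
      (tensorKaehlerEquivOfFormallyEtale k P L).symm
  let b := (mvPolynomialBasis k (Fin d)).baseChange L
  constructor
  · rw [e.finrank_eq, Module.finrank_eq_card_basis b, Fintype.card_fin]
  · have := Module.Finite.of_basis b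
    exact Module.Finite.equiv e.symm

end Dimension

/-! ### The Jacobian criterion over the function field. -/

section Jacobian

variable {k : Type*} [Field k] {κ : Type} [Fintype κ] {A : Type*} [CommRing A] [Algebra k A]

theorem derivation_sum_apply {R A M ι : Type*} [CommSemiring R] [CommSemiring A] [Algebra R A]
    [AddCommMonoid M] [Module R M] [Module A M] (s : Finset ι) (D : ι → Derivation R A M) (a : A) :
    (∑ i ∈ s, D i) a = ∑ i ∈ s, D i a := by
  have := map_sum (Derivation.coeFnAddMonoidHom (R := R) (A := A) (M := M)) D s
  exact (congrFun this a).trans (Finset.sum_apply _ _ _)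

theorem derivation_eq_sum_pderiv {M : Type*} [AddCommGroup M] [Module k M]
    [Module (MvPolynomial κ k) M] [IsScalarTower k (MvPolynomial κ k) M]
    (D : Derivation k (MvPolynomial κ k) M) (f : MvPolynomial κ k) :
    D f = ∑ i, MvPolynomial.pderiv i f • D (MvPolynomial.X i) := by
  classical
  have : D = ∑ i, (LinearMap.toSpanSingleton (MvPolynomial κ k) M
      (D (MvPolynomial.X i))).compDer (MvPolynomial.pderiv i) := by
    apply MvPolynomial.derivation_ext
    intro j
    rw [derivation_sum_apply, Finset.sum_eq_single j]
    · simp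
    · intro b _ hb
      simp [MvPolynomial.pderiv_X_of_ne hb.symm]
    · simp
  conv_lhs => rw [this]
  rw [derivation_sum_apply]
  simp

/-- The kernel of the Jacobian matrix of `I` over an extension `L` of `k[x] / I`. -/
def jacobianKernel (π : MvPolynomial κ k →ₐ[k] A) (L : Type*) [CommRing L]
    [Algebra A L] : Submodule L (κ → L) where
  carrier := {w | ∀ f, π f = 0 → ∑ i, algebraMap A L
    (π (MvPolynomial.pderiv i f)) * w i = 0}
  add_mem' := by
    intro a b ha hb f hf
    simp only [Pi.add_apply, mul_add, Finset.sum_add_distrib, ha f hf, hb f hf, add_zero]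
  zero_mem' := by
    intro f _
    simp
  smul_mem' := by
    intro c a ha f hf
    simp only [Pi.smul_apply, smul_eq_mul, mul_left_comm _ c, ← Finset.mul_sum, ha f hf, mul_zero]

/-- The derivation of the polynomial ring sending X_i to w_i kills ker π precisely by the Jacobian
equations, so it descends to A. -/
theorem exists_derivation_of_mem_jacobianKernel {π : MvPolynomial κ k →ₐ[k] A}
    (hπ : Function.Surjective π) (L : Type*)
    [CommRing L] [Algebra k L] [Algebra A L] [IsScalarTower k A L] {w : κ → L} (hw : w ∈ jacobianKernel π L) :
    ∃ D : Derivation k A L,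
      ∀ i, D (π (MvPolynomial.X i)) = w i := by
  let _ : Module (MvPolynomial κ k) L := Module.compHom L (π : MvPolynomial κ k →+* A)
  have hsmul : ∀ (f : MvPolynomial κ k) (x : L),
      f • x = algebraMap A L (π f) * x := fun f x =>
    Algebra.smul_def (π f) x
  have : IsScalarTower k (MvPolynomial κ k) L := ⟨fun a f x => by
    rw [hsmul, hsmul, map_smul π a f, Algebra.smul_def, map_mul,
      ← IsScalarTower.algebraMap_apply, Algebra.smul_def, mul_assoc]⟩
  let δ : Derivation k (MvPolynomial κ k) L := MvPolynomial.mkDerivation k w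
  have hδ : ∀ f, δ f = ∑ i, algebraMap A L
      (π (MvPolynomial.pderiv i f)) * w i := fun f => by
    rw [derivation_eq_sum_pderiv δ f]
    simp [δ, hsmul]
  have hker : ∀ f, π f = 0 → δ f = 0 := fun f hf => by rw [hδ]; exact hw f hf
  have hπ' : Function.Surjective π.toLinearMap := hπ
  have hker' : LinearMap.ker π.toLinearMap ≤ LinearMap.ker δ.toLinearMap :=
    fun f hf => hker f hf
  let l : A →ₗ[k] L := (Submodule.liftQ _ δ.toLinearMap hker').comp
    (π.toLinearMap.quotKerEquivOfSurjective hπ').symm.toLinearMap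
  have hl : ∀ f, l (π f) = δ f := fun f => by
    have : (π.toLinearMap.quotKerEquivOfSurjective hπ').symm (π f) = Submodule.Quotient.mk f := by
      rw [LinearEquiv.symm_apply_eq]; rfl
    exact congrArg (Submodule.liftQ _ δ.toLinearMap hker') this
  refine ⟨Derivation.mk' l ?_, ?_⟩
  · intro a b
    obtain ⟨a, rfl⟩ := hπ a
    obtain ⟨b, rfl⟩ := hπ b
    rw [← map_mul, hl, hl, hl, δ.leibniz]
    rfl
  · intro i
    change l _ = _
    rw [hl]
    simp [δ]

/-- Vectors in the Jacobian kernel are derivations A → L, that is, functionals on L ⊗ Ω_A, via their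
values on the dx_i. -/
theorem finrank_jacobianKernel [CharZero k] [IsDomain A] {π : MvPolynomial κ k →ₐ[k] A}
    (hπ : Function.Surjective π) (L : Type*) [Field L] [Algebra A L] [IsFractionRing A L] (d : ℕ)
    (hd : ringKrullDim A = d) :
    Module.finrank L (jacobianKernel π L) = d := by
  have : Algebra.FiniteType k A := Algebra.FiniteType.of_surjective π hπ
  let _ : Algebra k L := ((algebraMap A L).comp (algebraMap k A)).toAlgebra
  have : IsScalarTower k A L := IsScalarTower.of_algebraMap_eq fun _ => rfl
  obtain ⟨h1, h2⟩ := finrank_tensor_kaehlerDifferential k A L d hd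
  let x : κ → A := fun i => π (MvPolynomial.X i)
  let Φ : ((L ⊗[A] Ω[A⁄k]) →ₗ[L] L) →ₗ[L] (κ → L) :=
    { toFun := fun f i => f (1 ⊗ₜ D k A (x i))
      map_add' := fun f g => rfl
      map_smul' := fun c f => rfl }
  have hD : ∀ f : MvPolynomial κ k, D k A (π f) =
      ∑ i, π (MvPolynomial.pderiv i f) • D k A (x i) := by
    intro f
    let _ : Algebra (MvPolynomial κ k) A := π.toRingHom.toAlgebra
    have : IsScalarTower k (MvPolynomial κ k) A := IsScalarTower.of_algHom π
    have h := derivation_eq_sum_pderiv ((D k A).compAlgebraMap (MvPolynomial κ k)) f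
    refine h.trans (Finset.sum_congr rfl fun i _ => ?_)
    exact (algebraMap_smul A (MvPolynomial.pderiv i f) _).symm
  have hinj : Function.Injective Φ := by
    rw [injective_iff_map_eq_zero]
    intro f hf
    apply TensorProduct.AlgebraTensorModule.ext
    intro l ω
    have hω : ω ∈ Submodule.span A (Set.range (D k A)) := by
      rw [KaehlerDifferential.span_range_derivation]; trivial
    have hl : ∀ ω : Ω[A⁄k], f (l ⊗ₜ ω) = l * f (1 ⊗ₜ ω) := fun ω => by
      rw [← smul_eq_mul, ← map_smul, TensorProduct.smul_tmul', smul_eq_mul, mul_one]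
    rw [hl, LinearMap.zero_apply]
    suffices f (1 ⊗ₜ ω) = 0 by rw [this, mul_zero]
    have hs : ∀ (a : A) (ω : Ω[A⁄k]), f (1 ⊗ₜ (a • ω)) = algebraMap A L a * f (1 ⊗ₜ ω) :=
      fun a ω => by
      rw [TensorProduct.tmul_smul, ← smul_eq_mul, ← map_smul, algebraMap_smul]
    induction hω using Submodule.span_induction with
    | mem y hy =>
      obtain ⟨a, rfl⟩ := hy
      obtain ⟨a, rfl⟩ := hπ a
      rw [hD, TensorProduct.tmul_sum, map_sum]
      refine Finset.sum_eq_zero fun i _ => ?_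
      rw [hs]
      have : f (1 ⊗ₜ D k A (x i)) = 0 := congrFun hf i
      rw [this, mul_zero]
    | zero => rw [TensorProduct.tmul_zero, map_zero]
    | add a b _ _ ha hb => rw [TensorProduct.tmul_add, map_add, ha, hb, add_zero]
    | smul a ω _ h => rw [hs, h, mul_zero]
  have hrange : LinearMap.range Φ = jacobianKernel π L := by
    apply le_antisymm
    · rintro _ ⟨f, rfl⟩ g hg
      have h0 : D k A (π g) = 0 := by
        rw [hg, map_zero]
      rw [hD] at h0
      have h3 : f (1 ⊗ₜ (∑ i, π (MvPolynomial.pderiv i g) • D k A (x i))) = 0 := by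
        rw [h0, TensorProduct.tmul_zero, map_zero]
      rw [TensorProduct.tmul_sum, map_sum] at h3
      rw [← h3]
      refine Finset.sum_congr rfl fun i _ => ?_
      rw [TensorProduct.tmul_smul, ← algebraMap_smul L, map_smul, smul_eq_mul]
      rfl
    · intro w hw
      obtain ⟨E, hE⟩ := exists_derivation_of_mem_jacobianKernel hπ L hw
      refine ⟨E.liftKaehlerDifferential.liftBaseChange L, ?_⟩
      ext i
      change LinearMap.liftBaseChange L _ (1 ⊗ₜ _) = _
      rw [LinearMap.liftBaseChange_tmul, one_smul, Derivation.liftKaehlerDifferential_comp_D]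
      exact hE i
  rw [← hrange, LinearMap.finrank_range_of_inj hinj, Module.finrank_linearMap_self, h1]

end Jacobian

end BOLattice

end

noncomputable section

namespace BOLattice

open Matrix

/-! ### Ranks certified by minors. -/

section LinearAlgebra

variable {F : Type*} [Field F] {κ : Type*} [Fintype κ]

theorem exists_det_submatrix_ne_zero {r : ℕ} {G : Matrix (Fin r) κ F}
    (h : LinearIndependent F G.row) : ∃ c : Fin r → κ, (G.submatrix id c).det ≠ 0 := by
  classical
  have hr : G.rank = r := by rw [h.rank_matrix, Fintype.card_fin]
  rw [G.rank_eq_finrank_span_cols] at hr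
  obtain ⟨f, hf, -, hli⟩ := Submodule.exists_fun_fin_finrank_span_eq F (Set.range G.col)
  choose c hc using hf
  let e : Fin r ≃ Fin (Module.finrank F (Submodule.span F (Set.range G.col))) := finCongr hr.symm
  refine ⟨c ∘ e, ?_⟩
  have h1 : LinearIndependent F (G.submatrix id (c ∘ e)).col := by
    have : (G.submatrix id (c ∘ e)).col = f ∘ e := by
      ext b a
      simp [← hc]
    rw [this]
    exact hli.comp e e.injective
  rw [Matrix.linearIndependent_cols_iff_isUnit, Matrix.isUnit_iff_isUnit_det] at h1
  exact h1.ne_zero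

theorem add_finrank_ker_mulVecLin {r : ℕ} {G : Matrix (Fin r) κ F} {c : Fin r → κ}
    (h : (G.submatrix id c).det ≠ 0) :
    r + Module.finrank F (LinearMap.ker G.mulVecLin) = Fintype.card κ := by
  classical
  have hs : Function.Surjective G.mulVec := by
    rw [Matrix.mulVec_surjective_iff_exists_right_inverse]
    refine ⟨(1 : Matrix κ κ F).submatrix id c * (G.submatrix id c)⁻¹, ?_⟩
    rw [← Matrix.mul_assoc]
    have : G * (1 : Matrix κ κ F).submatrix id c = G.submatrix id c := by
      ext a b
      simp [Matrix.mul_apply, Matrix.one_apply]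
    rw [this, Matrix.mul_nonsing_inv _ (isUnit_iff_ne_zero.2 h)]
  have h1 := LinearMap.finrank_range_add_finrank_ker G.mulVecLin
  rw [LinearMap.range_eq_top.2 (by exact hs), finrank_top] at h1
  simpa using h1

/-- The annihilator of a set of vectors under the dot product. -/
def dotAnnihilator (s : Set (κ → F)) : Submodule F (κ → F) where
  carrier := {w | ∀ g ∈ s, ∑ i, g i * w i = 0}
  add_mem' := by
    intro a b ha hb f hf
    simp only [Pi.add_apply, mul_add, Finset.sum_add_distrib, ha f hf, hb f hf, add_zero]
  zero_mem' := by
    intro f _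
    simp
  smul_mem' := by
    intro c a ha f hf
    simp only [Pi.smul_apply, smul_eq_mul, mul_left_comm _ c, ← Finset.mul_sum, ha f hf, mul_zero]

/-- The annihilator depends only on the span, of which s contains a basis. Recording its size by a
nonzero minor turns rank conditions into nonvanishing of polynomials; this is applied both at points
and over the function field. -/
theorem exists_det_ne_zero_of_dotAnnihilator (s : Set (κ → F)) :
    ∃ (r : ℕ) (g : Fin r → κ → F) (c : Fin r → κ), (∀ a, g a ∈ s) ∧
      (Matrix.of fun a b => g a (c b)).det ≠ 0 ∧
      r + Module.finrank F (dotAnnihilator s) = Fintype.card κ := by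
  obtain ⟨g, hg, hspan, hli⟩ := Submodule.exists_fun_fin_finrank_span_eq F s
  obtain ⟨c, hc⟩ := exists_det_submatrix_ne_zero (G := Matrix.of g) hli
  refine ⟨_, g, c, hg, hc, ?_⟩
  have : dotAnnihilator s = LinearMap.ker (Matrix.of g).mulVecLin := by
    ext w
    have hw : ∀ v : κ → F, (∑ i, v i * w i = 0) ↔
        v ∈ LinearMap.ker (Fintype.linearCombination F w) := fun v => by
      simp [Fintype.linearCombination_apply]
    constructor
    · intro h
      ext a
      exact h _ (hg a)
    · intro h v hv
      rw [hw]
      have h1 : Submodule.span F (Set.range g) ≤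
          LinearMap.ker (Fintype.linearCombination F w) := by
        rw [Submodule.span_le]
        rintro _ ⟨a, rfl⟩
        exact (hw _).1 (congrFun h a)
      exact h1 (hspan.ge (Submodule.subset_span hv))
  rw [this]
  exact add_finrank_ker_mulVecLin hc

end LinearAlgebra

/-! ### Tangent spaces, smooth points and tangent vector fields. -/

section Tangent

variable {k : Type*} [Field k] {κ : Type} [Fintype κ]

/-- The gradient of a polynomial at a point. -/
def gradient (f : MvPolynomial κ k) (z : κ → k) : κ → k :=
  fun i => MvPolynomial.eval z (MvPolynomial.pderiv i f)

/-- The Zariski tangent space at `z` to the subscheme of affine space defined by `I`. -/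
def tangentSpace (I : Ideal (MvPolynomial κ k)) (z : κ → k) : Submodule k (κ → k) :=
  dotAnnihilator ((fun f => gradient f z) '' I)

theorem mem_tangentSpace {I : Ideal (MvPolynomial κ k)} {z w : κ → k} :
    w ∈ tangentSpace I z ↔ ∀ f ∈ I, ∑ i, gradient f z i * w i = 0 := by
  constructor
  · intro h f hf
    exact h _ ⟨f, hf, rfl⟩
  · rintro h _ ⟨f, hf, rfl⟩
    exact h f hf

theorem tangentSpace_le_ker {I : Ideal (MvPolynomial κ k)} {r : ℕ}
    {f : Fin r → MvPolynomial κ k} (hf : ∀ a, f a ∈ I) (z : κ → k) :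
    tangentSpace I z ≤ LinearMap.ker (Matrix.of fun a => gradient (f a) z).mulVecLin := by
  intro w hw
  ext a
  exact mem_tangentSpace.1 hw _ (hf a)

/-- The minor of the Jacobian matrix of `f` with columns `c`. -/
def jacobianMinor {r : ℕ} (f : Fin r → MvPolynomial κ k) (c : Fin r → κ) : MvPolynomial κ k :=
  (Matrix.of fun a b => MvPolynomial.pderiv (c b) (f a)).det

theorem eval_jacobianMinor {r : ℕ} (f : Fin r → MvPolynomial κ k) (c : Fin r → κ) (z : κ → k) :
    MvPolynomial.eval z (jacobianMinor f c) =
      (Matrix.of fun a b => gradient (f a) z (c b)).det := by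
  rw [jacobianMinor, RingHom.map_det]
  rfl

theorem finrank_tangentSpace_add_le {I : Ideal (MvPolynomial κ k)} {r : ℕ}
    {f : Fin r → MvPolynomial κ k} (hf : ∀ a, f a ∈ I) {c : Fin r → κ} {z : κ → k}
    (hz : MvPolynomial.eval z (jacobianMinor f c) ≠ 0) :
    r + Module.finrank k (LinearMap.ker (Matrix.of fun a => gradient (f a) z).mulVecLin) =
      Fintype.card κ ∧
    r + Module.finrank k (tangentSpace I z) ≤ Fintype.card κ := by
  rw [eval_jacobianMinor] at hz
  have h := add_finrank_ker_mulVecLin (G := Matrix.of fun a => gradient (f a) z) (c := c) hz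
  exact ⟨h, h ▸ Nat.add_le_add_left (Submodule.finrank_mono (tangentSpace_le_ker hf z)) r⟩

theorem exists_jacobianMinor_ne_zero (I : Ideal (MvPolynomial κ k)) (z : κ → k) :
    ∃ (r : ℕ) (f : Fin r → MvPolynomial κ k) (c : Fin r → κ), (∀ a, f a ∈ I) ∧
      MvPolynomial.eval z (jacobianMinor f c) ≠ 0 ∧
      r + Module.finrank k (tangentSpace I z) = Fintype.card κ := by
  obtain ⟨r, g, c, hg, hc, hr⟩ :=
    exists_det_ne_zero_of_dotAnnihilator ((fun f => gradient f z) '' (I : Set (MvPolynomial κ k)))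
  choose f hf hfg using hg
  refine ⟨r, f, c, hf, ?_, hr⟩
  rw [eval_jacobianMinor]
  simp only [← hfg] at hc
  exact hc

/-- Data of an irreducible subset `S` of affine space whose closure has dimension `d`. -/
structure IsIrreducibleOfDim (S : Set (κ → k)) (d : ℕ) : Prop where
  prime : (MvPolynomial.vanishingIdeal k S).IsPrime
  dim : ringKrullDim (MvPolynomial κ k ⧸ MvPolynomial.vanishingIdeal k S) = d

variable {S : Set (κ → k)} {d : ℕ}

theorem eval_eq_zero_of_mem_vanishingIdeal {f : MvPolynomial κ k}
    (hf : f ∈ MvPolynomial.vanishingIdeal k S) {z : κ → k} (hz : z ∈ S) :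
    MvPolynomial.eval z f = 0 := by
  simpa [MvPolynomial.aeval_eq_eval] using hf z hz

theorem mem_vanishingIdeal_of_eval {f : MvPolynomial κ k}
    (hf : ∀ z ∈ S, MvPolynomial.eval z f = 0) : f ∈ MvPolynomial.vanishingIdeal k S := by
  intro z hz
  simpa [MvPolynomial.aeval_eq_eval] using hf z hz

variable [CharZero k]

/-- Over the function field the Jacobian matrix has corank d. A minor certifying this is nonzero
there, so it does not vanish identically on S. -/
theorem IsIrreducibleOfDim.exists_jacobianMinor (hS : IsIrreducibleOfDim S d) :
    ∃ (r : ℕ) (f : Fin r → MvPolynomial κ k) (c : Fin r → κ),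
      (∀ a, f a ∈ MvPolynomial.vanishingIdeal k S) ∧
      jacobianMinor f c ∉ MvPolynomial.vanishingIdeal k S ∧ r + d = Fintype.card κ := by
  set I := MvPolynomial.vanishingIdeal k S
  have := hS.prime
  let π : MvPolynomial κ k →ₐ[k] (MvPolynomial κ k ⧸ I) := Ideal.Quotient.mkₐ k I
  let L := FractionRing (MvPolynomial κ k ⧸ I)
  have hd := finrank_jacobianKernel (π := π) (Ideal.Quotient.mkₐ_surjective k I) L d hS.dim
  let ρ : MvPolynomial κ k →+* L := (algebraMap _ L).comp π.toRingHom
  let γ : MvPolynomial κ k → κ → L := fun f i => ρ (MvPolynomial.pderiv i f)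
  obtain ⟨r, g, c, hg, hc, hr⟩ :=
    exists_det_ne_zero_of_dotAnnihilator (γ '' (I : Set (MvPolynomial κ k)))
  choose f hf hfg using hg
  refine ⟨r, f, c, hf, ?_, ?_⟩
  · intro hmem
    apply hc
    have h1 : ρ (jacobianMinor f c) = 0 := by
      have : π (jacobianMinor f c) = 0 := Ideal.Quotient.eq_zero_iff_mem.2 hmem
      change algebraMap _ L (π (jacobianMinor f c)) = 0
      rw [this, map_zero]
    rw [← h1, jacobianMinor, RingHom.map_det]
    congr 1
    ext a b
    simp [← hfg, γ]
  · suffices h : dotAnnihilator (γ '' (I : Set (MvPolynomial κ k))) = jacobianKernel π L by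
      rw [← hd, ← hr, h]
    ext w
    constructor
    · intro h f hf
      exact h _ ⟨f, Ideal.Quotient.eq_zero_iff_mem.1 hf, rfl⟩
    · rintro h _ ⟨f, hf, rfl⟩
      exact h f (Ideal.Quotient.eq_zero_iff_mem.2 hf)

/-- A Jacobian minor nonzero at z is nonzero in the function field, so the rank at z is at most the
generic rank. -/
theorem IsIrreducibleOfDim.le_finrank_tangentSpace (hS : IsIrreducibleOfDim S d) {z : κ → k}
    (hz : z ∈ S) : d ≤ Module.finrank k (tangentSpace (MvPolynomial.vanishingIdeal k S) z) := by
  set I := MvPolynomial.vanishingIdeal k S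
  have := hS.prime
  obtain ⟨r, f, c, hf, hc, hr⟩ := exists_jacobianMinor_ne_zero I z
  let π : MvPolynomial κ k →ₐ[k] (MvPolynomial κ k ⧸ I) := Ideal.Quotient.mkₐ k I
  let L := FractionRing (MvPolynomial κ k ⧸ I)
  have hd := finrank_jacobianKernel (π := π) (Ideal.Quotient.mkₐ_surjective k I) L d hS.dim
  let ρ : MvPolynomial κ k →+* L := (algebraMap _ L).comp π.toRingHom
  let G : Matrix (Fin r) κ L := Matrix.of fun a i => ρ (MvPolynomial.pderiv i (f a))
  have hne : (G.submatrix id c).det ≠ 0 := by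
    have h1 : (G.submatrix id c).det = ρ (jacobianMinor f c) := by
      rw [jacobianMinor, RingHom.map_det]
      rfl
    rw [h1]
    intro h0
    have h2 : π (jacobianMinor f c) = 0 :=
      IsFractionRing.injective (MvPolynomial κ k ⧸ I) L (h0.trans (map_zero _).symm)
    exact hc (eval_eq_zero_of_mem_vanishingIdeal (Ideal.Quotient.eq_zero_iff_mem.1 h2) hz)
  have h3 := add_finrank_ker_mulVecLin hne
  have h4 : jacobianKernel π L ≤ LinearMap.ker G.mulVecLin := by
    intro w hw
    ext a
    exact hw (f a) (Ideal.Quotient.eq_zero_iff_mem.2 (hf a))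
  have h5 := Submodule.finrank_mono h4
  omega

/-- A generic point is smooth. -/
theorem IsIrreducibleOfDim.exists_smooth (hS : IsIrreducibleOfDim S d) :
    ∃ δ : MvPolynomial κ k, δ ∉ MvPolynomial.vanishingIdeal k S ∧
      ∀ z ∈ S, MvPolynomial.eval z δ ≠ 0 →
        Module.finrank k (tangentSpace (MvPolynomial.vanishingIdeal k S) z) = d := by
  obtain ⟨r, f, c, hf, hc, hr⟩ := hS.exists_jacobianMinor
  refine ⟨_, hc, fun z hz hδ => le_antisymm ?_ (hS.le_finrank_tangentSpace hz)⟩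
  have := (finrank_tangentSpace_add_le hf hδ).2
  omega

/-- Smoothness is an open condition. -/
theorem IsIrreducibleOfDim.exists_smooth_nhd (hS : IsIrreducibleOfDim S d) {z₀ : κ → k}
    (hz₀ : Module.finrank k (tangentSpace (MvPolynomial.vanishingIdeal k S) z₀) = d) :
    ∃ δ : MvPolynomial κ k, MvPolynomial.eval z₀ δ ≠ 0 ∧
      ∀ z ∈ S, MvPolynomial.eval z δ ≠ 0 →
        Module.finrank k (tangentSpace (MvPolynomial.vanishingIdeal k S) z) = d := by
  obtain ⟨r, f, c, hf, hc, hr⟩ :=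
    exists_jacobianMinor_ne_zero (MvPolynomial.vanishingIdeal k S) z₀
  refine ⟨_, hc, fun z hz hδ => le_antisymm ?_ (hS.le_finrank_tangentSpace hz)⟩
  have := (finrank_tangentSpace_add_le hf hδ).2
  omega

/-- A tangent vector at a smooth point extends to a polynomial vector field tangent to `S`. -/
theorem IsIrreducibleOfDim.exists_vectorField (hS : IsIrreducibleOfDim S d) {z₀ : κ → k}
    (h₀ : z₀ ∈ S)
    (hz₀ : Module.finrank k (tangentSpace (MvPolynomial.vanishingIdeal k S) z₀) = d)
    {w : κ → k} (hw : w ∈ tangentSpace (MvPolynomial.vanishingIdeal k S) z₀) :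
    ∃ τ : κ → MvPolynomial κ k,
      (∀ z ∈ S, (fun i => MvPolynomial.eval z (τ i)) ∈
        tangentSpace (MvPolynomial.vanishingIdeal k S) z) ∧
      ∀ i, MvPolynomial.eval z₀ (τ i) = w i := by
  classical
  have hprime := hS.prime
  obtain ⟨r, f, c, hf, hc, hr⟩ :=
    exists_jacobianMinor_ne_zero (MvPolynomial.vanishingIdeal k S) z₀
  set M : Matrix (Fin r) (Fin r) (MvPolynomial κ k) :=
    Matrix.of fun a b => MvPolynomial.pderiv (c b) (f a) with hM
  set J : Matrix (Fin r) κ (MvPolynomial κ k) :=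
    Matrix.of fun a i => MvPolynomial.pderiv i (f a) with hJ
  let W : κ → MvPolynomial κ k := fun i => MvPolynomial.C (w i)
  let B : Matrix κ (Fin r) (MvPolynomial κ k) := (1 : Matrix κ κ _).submatrix id c
  have hJB : J * B = M := by
    ext a b
    simp [B, Matrix.mul_apply, Matrix.one_apply, hJ, hM]
  -- Cramer's rule with the denominator det M cleared: a projection of the constant field w onto ker
  -- J. At z₀ the correction term vanishes, since w is tangent there.
  let τ₀ : κ → MvPolynomial κ k := M.det • W - B *ᵥ (M.adjugate *ᵥ (J *ᵥ W))
  have hJτ : J *ᵥ τ₀ = 0 := by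
    rw [Matrix.mulVec_sub, Matrix.mulVec_smul, Matrix.mulVec_mulVec, hJB, Matrix.mulVec_mulVec,
      Matrix.mul_adjugate, Matrix.smul_mulVec, Matrix.one_mulVec, sub_self]
  have hev : ∀ z, (fun i => MvPolynomial.eval z (τ₀ i)) ∈
      LinearMap.ker (Matrix.of fun a => gradient (f a) z).mulVecLin := by
    intro z
    ext a
    have := congrArg (MvPolynomial.eval z) (congrFun hJτ a)
    simpa [Matrix.mulVec, dotProduct, hJ, gradient] using this
  have htan : ∀ z ∈ S, (fun i => MvPolynomial.eval z (τ₀ i)) ∈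
        tangentSpace (MvPolynomial.vanishingIdeal k S) z := by
    intro z hz
    rw [mem_tangentSpace]
    intro g hg
    -- Where the minor is nonzero, ker J is the tangent space by dimension count. Irreducibility of
    -- S extends tangency across the zeros of the minor.
    have hmem : jacobianMinor f c * (∑ i, MvPolynomial.pderiv i g * τ₀ i) ∈
        MvPolynomial.vanishingIdeal k S := by
      apply mem_vanishingIdeal_of_eval
      intro y hy
      rw [map_mul, mul_eq_zero, or_iff_not_imp_left]
      intro hδ
      have h1 := finrank_tangentSpace_add_le hf hδ
      have h2 := hS.le_finrank_tangentSpace hy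
      have h3 : tangentSpace (MvPolynomial.vanishingIdeal k S) y =
          LinearMap.ker (Matrix.of fun a => gradient (f a) y).mulVecLin :=
        Submodule.eq_of_le_of_finrank_le (tangentSpace_le_ker hf y) (by omega)
      have h4 := mem_tangentSpace.1 (h3 ▸ hev y) g hg
      simpa [gradient] using h4
    rcases hprime.mem_or_mem hmem with h | h
    · exact absurd (eval_eq_zero_of_mem_vanishingIdeal h h₀) hc
    · simpa [gradient] using eval_eq_zero_of_mem_vanishingIdeal h hz
  have hδ : MvPolynomial.eval z₀ M.det ≠ 0 := hc
  refine ⟨fun i => MvPolynomial.C (MvPolynomial.eval z₀ M.det)⁻¹ * τ₀ i, ?_, ?_⟩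
  · intro z hz
    have := Submodule.smul_mem _ (MvPolynomial.eval z₀ M.det)⁻¹ (htan z hz)
    convert this using 1
    ext i
    simp
  · intro i
    have hJw : ∀ a, MvPolynomial.eval z₀ ((J *ᵥ W) a) = 0 := by
      intro a
      have := mem_tangentSpace.1 hw (f a) (hf a)
      simpa [Matrix.mulVec, dotProduct, hJ, gradient, W] using this
    have h2 : MvPolynomial.eval z₀ ((B *ᵥ (M.adjugate *ᵥ (J *ᵥ W))) i) = 0 := by
      rw [Matrix.mulVec_mulVec, Matrix.mulVec, dotProduct, map_sum]
      exact Finset.sum_eq_zero fun a _ => by rw [map_mul, hJw, mul_zero]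
    have h3 : MvPolynomial.eval z₀ (τ₀ i) = MvPolynomial.eval z₀ M.det * w i := by
      change MvPolynomial.eval z₀ (M.det * W i - _) = _
      rw [map_sub, h2, sub_zero, map_mul]
      simp [W]
    rw [map_mul, h3, MvPolynomial.eval_C, inv_mul_cancel_left₀ hδ]

end Tangent

end BOLattice

end

noncomputable section

namespace BOLattice

/-! ### Polynomial functions, irreducible sets and generic properties. -/

section PolynomialFunctions

variable (k : Type*) [Field k]

/-- The algebra of polynomial functions on a vector space. -/
def polyFun (V : Type*) [AddCommGroup V] [Module k V] : Subalgebra k (V → k) :=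
  Algebra.adjoin k (Set.range fun φ : Module.Dual k V => (φ : V → k))

/-- A map between vector spaces all of whose coordinates are polynomial functions. -/
def IsPolyMap {V W : Type*} [AddCommGroup V] [Module k V] [AddCommGroup W] [Module k W]
    (g : V → W) : Prop :=
  ∀ φ : Module.Dual k W, (fun v => φ (g v)) ∈ polyFun k V

variable {k} {V W : Type*} [AddCommGroup V] [Module k V] [AddCommGroup W] [Module k W]

theorem dual_mem_polyFun (φ : Module.Dual k V) : (fun v => φ v) ∈ polyFun k V :=
  Algebra.subset_adjoin ⟨φ, rfl⟩

theorem const_mem_polyFun (c : k) : (fun _ : V => c) ∈ polyFun k V :=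
  (polyFun k V).algebraMap_mem c

theorem comp_mem_polyFun {f : W → k} (hf : f ∈ polyFun k W) {g : V → W} (hg : IsPolyMap k g) :
    (fun v => f (g v)) ∈ polyFun k V := by
  induction hf using Algebra.adjoin_induction with
  | mem f hf =>
    obtain ⟨φ, rfl⟩ := hf
    exact hg φ
  | algebraMap r => exact const_mem_polyFun r
  | add f g _ _ hf hg => exact (polyFun k V).add_mem hf hg
  | mul f g _ _ hf hg => exact (polyFun k V).mul_mem hf hg

theorem isPolyMap_linear (φ : V →ₗ[k] W) : IsPolyMap k φ := fun ψ =>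
  dual_mem_polyFun (ψ.comp φ)

theorem isPolyMap_const (w : W) : IsPolyMap k (fun _ : V => w) := fun φ => const_mem_polyFun (φ w)

theorem IsPolyMap.add {f g : V → W} (hf : IsPolyMap k f) (hg : IsPolyMap k g) :
    IsPolyMap k (fun v => f v + g v) := fun φ => by
  simp only [map_add]
  exact (polyFun k V).add_mem (hf φ) (hg φ)

theorem isPolyMap_update {ι : Type*} [DecidableEq ι] {E : ι → Type*} [∀ i, AddCommGroup (E i)]
    [∀ i, Module k (E i)] (u : ∀ i, E i) (a : ι) :
    IsPolyMap k (fun x : E a => Function.update u a x) := by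
  have : (fun x : E a => Function.update u a x) =
      fun x => LinearMap.single k E a x + Function.update u a 0 := by
    funext x i
    by_cases h : i = a
    · subst h; simp
    · simp [h]
  rw [this]
  exact (isPolyMap_linear _).add (isPolyMap_const _)

theorem isPolyMap_pi {κ : Type*} [Fintype κ] {g : V → κ → k}
    (hg : ∀ i, (fun v => g v i) ∈ polyFun k V) : IsPolyMap k g := fun φ => by
  classical
  have : (fun v => φ (g v)) = ∑ i, (φ (Pi.single i 1)) • fun v => g v i := by
    funext v
    rw [Finset.sum_apply]
    conv_lhs => rw [pi_eq_sum_univ' (g v)]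
    simp [mul_comm]
  rw [this]
  exact (polyFun k V).sum_mem fun i _ => (polyFun k V).smul_mem (hg i) _

theorem det_mem_polyFun {r : ℕ} {M : V → Matrix (Fin r) (Fin r) k}
    (hM : ∀ a b, (fun v => M v a b) ∈ polyFun k V) : (fun v => (M v).det) ∈ polyFun k V := by
  have : (fun v => (M v).det) = ∑ σ : Equiv.Perm (Fin r),
      ((Equiv.Perm.sign σ : ℤ) : k) • ∏ i, fun v => M v (σ i) i := by
    funext v
    rw [Matrix.det_apply', Finset.sum_apply]
    simp
  rw [this]
  exact (polyFun k V).sum_mem fun σ _ => (polyFun k V).smul_mem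
    ((polyFun k V).prod_mem fun i _ => hM _ _) _

theorem eval_mem_polyFun {κ : Type*} (F : MvPolynomial κ k) :
    (fun v : κ → k => MvPolynomial.eval v F) ∈ polyFun k (κ → k) := by
  induction F using MvPolynomial.induction_on with
  | C a => simpa using const_mem_polyFun a
  | add p q hp hq => simp only [map_add]; exact (polyFun k (κ → k)).add_mem hp hq
  | mul_X p i hp =>
    simp only [map_mul, MvPolynomial.eval_X]
    exact (polyFun k (κ → k)).mul_mem hp
      (dual_mem_polyFun (LinearMap.proj (R := k) (φ := fun _ : κ => k) i))

theorem exists_eval_of_mem_polyFun {κ : Type*} [Fintype κ] {f : (κ → k) → k}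
    (hf : f ∈ polyFun k (κ → k)) : ∃ F : MvPolynomial κ k, ∀ v, f v = MvPolynomial.eval v F := by
  classical
  induction hf using Algebra.adjoin_induction with
  | mem f hf =>
    obtain ⟨φ, rfl⟩ := hf
    refine ⟨∑ i, MvPolynomial.C (φ (Pi.single i 1)) * MvPolynomial.X i, fun v => ?_⟩
    rw [map_sum]
    conv_lhs => rw [pi_eq_sum_univ' v]
    simp [mul_comm]
  | algebraMap r => exact ⟨MvPolynomial.C r, fun v => by simp⟩
  | add f g _ _ hf hg =>
    obtain ⟨F, hF⟩ := hf
    obtain ⟨G, hG⟩ := hg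
    exact ⟨F + G, fun v => by simp [hF, hG]⟩
  | mul f g _ _ hf hg =>
    obtain ⟨F, hF⟩ := hf
    obtain ⟨G, hG⟩ := hg
    exact ⟨F * G, fun v => by simp [hF, hG]⟩

/-- Currying, as a linear equivalence. -/
def curryEquiv (k : Type*) [Field k] (ι κ : Type*) : (ι × κ → k) ≃ₗ[k] (ι → κ → k) :=
  LinearEquiv.curry k k ι κ

/-- A nonempty set any two nonempty Zariski open subsets of which meet. -/
def IsIrr (S : Set V) : Prop :=
  S.Nonempty ∧ ∀ f ∈ polyFun k V, ∀ g ∈ polyFun k V, (∃ u ∈ S, f u ≠ 0) → (∃ u ∈ S, g u ≠ 0) →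
    ∃ u ∈ S, f u ≠ 0 ∧ g u ≠ 0

/-- The property `R` holds on a nonempty relatively Zariski open subset of `S`. -/
def Generic (k : Type*) [Field k] {V : Type*} [AddCommGroup V] [Module k V] (S : Set V)
    (R : V → Prop) : Prop :=
  ∃ f ∈ polyFun k V, (∃ v ∈ S, f v ≠ 0) ∧ ∀ v ∈ S, f v ≠ 0 → R v

theorem Generic.exists {S : Set V} {R : V → Prop} (h : Generic k S R) : ∃ v ∈ S, R v := by
  obtain ⟨f, -, ⟨v, hv, hfv⟩, h⟩ := h
  exact ⟨v, hv, h v hv hfv⟩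

theorem Generic.mono {S : Set V} {R R' : V → Prop} (h : Generic k S R)
    (hR : ∀ v ∈ S, R v → R' v) : Generic k S R' := by
  obtain ⟨f, hf, hv, h⟩ := h
  exact ⟨f, hf, hv, fun v hv hfv => hR v hv (h v hv hfv)⟩

theorem Generic.and {S : Set V} (hS : IsIrr (k := k) S) {R R' : V → Prop} (h : Generic k S R)
    (h' : Generic k S R') : Generic k S fun v => R v ∧ R' v := by
  obtain ⟨f, hf, hv, h⟩ := h
  obtain ⟨g, hg, hw, h'⟩ := h'
  obtain ⟨u, hu, h1, h2⟩ := hS.2 f hf g hg hv hw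
  refine ⟨f * g, (polyFun k V).mul_mem hf hg, ⟨u, hu, mul_ne_zero h1 h2⟩, fun v hv hfg => ?_⟩
  exact ⟨h v hv (left_ne_zero_of_mul hfg), h' v hv (right_ne_zero_of_mul hfg)⟩

theorem Generic.of_forall {S : Set V} (hS : S.Nonempty) {R : V → Prop} (h : ∀ v ∈ S, R v) :
    Generic k S R := by
  obtain ⟨v, hv⟩ := hS
  exact ⟨1, (polyFun k V).one_mem, ⟨v, hv, one_ne_zero⟩, fun v hv _ => h v hv⟩

theorem Generic.forall_fintype {S : Set V} (hS : IsIrr (k := k) S) {ι : Type*} [Finite ι]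
    {R : ι → V → Prop} (h : ∀ i, Generic k S (R i)) : Generic k S fun v => ∀ i, R i v := by
  classical
  cases nonempty_fintype ι
  suffices H : ∀ s : Finset ι, Generic k S fun v => ∀ i ∈ s, R i v from
    (H Finset.univ).mono fun v _ hv i => hv i (Finset.mem_univ i)
  intro s
  induction s using Finset.induction_on with
  | empty => exact Generic.of_forall hS.1 (by simp)
  | insert a s _ ih =>
    refine ((h a).and hS ih).mono fun v _ hv i hi => ?_
    rcases Finset.mem_insert.1 hi with rfl | hi
    · exact hv.1
    · exact hv.2 i hi

theorem Generic.comap {S : Set V} {S' : Set W} {g : V → W} (hg : IsPolyMap k g)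
    (hsurj : ∀ w ∈ S', ∃ v ∈ S, g v = w) (hmap : ∀ v ∈ S, g v ∈ S') {R : W → Prop}
    (h : Generic k S' R) : Generic k S fun v => R (g v) := by
  obtain ⟨f, hf, ⟨w, hw, hfw⟩, h⟩ := h
  obtain ⟨v, hv, rfl⟩ := hsurj w hw
  exact ⟨_, comp_mem_polyFun hf hg, ⟨v, hv, hfw⟩, fun v hv hfv => h _ (hmap v hv) hfv⟩

theorem IsIrr.image {S : Set V} (hS : IsIrr (k := k) S) {g : V → W} (hg : IsPolyMap k g) :
    IsIrr (k := k) (g '' S) := by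
  refine ⟨hS.1.image g, ?_⟩
  rintro f hf f' hf' ⟨_, ⟨u, hu, rfl⟩, hfu⟩ ⟨_, ⟨v, hv, rfl⟩, hfv⟩
  obtain ⟨x, hx, h1, h2⟩ := hS.2 _ (comp_mem_polyFun hf hg) _ (comp_mem_polyFun hf' hg)
    ⟨u, hu, hfu⟩ ⟨v, hv, hfv⟩
  exact ⟨_, ⟨x, hx, rfl⟩, h1, h2⟩

/-- Given tuples at which f and g respectively do not vanish, replace one coordinate of both by a
common value; irreducibility of that factor keeps both functions nonzero. After all coordinates the
tuples agree. -/
theorem IsIrr.pi {ι : Type*} [Finite ι] {E : ι → Type*} [∀ i, AddCommGroup (E i)]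
    [∀ i, Module k (E i)] {S : ∀ i, Set (E i)} (hS : ∀ i, IsIrr (k := k) (S i)) :
    IsIrr (k := k) (Set.univ.pi S) := by
  classical
  cases nonempty_fintype ι
  refine ⟨Set.univ_pi_nonempty_iff.2 fun i => (hS i).1, fun f hf g hg => ?_⟩
  rintro ⟨u, hu, hfu⟩ ⟨w, hw, hgw⟩
  suffices H : ∀ (s : Finset ι) (u w : ∀ i, E i), u ∈ Set.univ.pi S → w ∈ Set.univ.pi S →
      (∀ i ∉ s, u i = w i) → f u ≠ 0 → g w ≠ 0 →
      ∃ v ∈ Set.univ.pi S, f v ≠ 0 ∧ g v ≠ 0 from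
    H Finset.univ u w hu hw (by simp) hfu hgw
  intro s
  induction s using Finset.induction_on with
  | empty =>
    intro u w hu _ huw hfu hgw
    obtain rfl : u = w := funext fun i => huw i (by simp)
    exact ⟨u, hu, hfu, hgw⟩
  | insert a s ha ih =>
    intro u w hu hw huw hfu hgw
    obtain ⟨x, hx, h1, h2⟩ := (hS a).2 _ (comp_mem_polyFun hf (isPolyMap_update u a))
      _ (comp_mem_polyFun hg (isPolyMap_update w a))
      ⟨u a, hu a trivial, by simpa using hfu⟩ ⟨w a, hw a trivial, by simpa using hgw⟩
    have hmem : ∀ u : ∀ i, E i, u ∈ Set.univ.pi S → Function.update u a x ∈ Set.univ.pi S := by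
      intro u hu i _
      by_cases h : i = a
      · subst h; simpa using hx
      · simpa [h] using hu i trivial
    refine ih _ _ (hmem u hu) (hmem w hw) (fun i hi => ?_) h1 h2
    by_cases h : i = a
    · subst h; simp
    · simpa [h] using huw i (by simp [h, hi])

theorem Generic.eval {ι : Type*} {S : ι → Set V} (hS : ∀ i, (S i).Nonempty)
    {i : ι} {R : V → Prop} (h : Generic k (S i) R) :
    Generic k (Set.univ.pi S) fun v => R (v i) := by
  classical
  choose z hz using hS
  refine h.comap (S := Set.univ.pi S) (g := fun v : ι → V => v i)
    (isPolyMap_linear (LinearMap.proj (φ := fun _ : ι => V) i)) (fun w hw => ?_)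
    fun v hv => hv i trivial
  refine ⟨Function.update z i w, fun j _ => ?_, by simp⟩
  by_cases h : j = i
  · subst h; simpa using hw
  · simpa [h] using hz j

/-- Passes between polynomials in the coordinates and the coordinate-free notion, which pulls back
along polynomial maps and restricts to products. -/
theorem holdsGenerically_iff {n : ℕ} {ι : Type*} [Finite ι] {S : ι → Set (Fin n → k)}
    {R : (ι → Fin n → k) → Prop} :
    HoldsGenerically S R ↔ Generic k (Set.univ.pi S) R := by
  cases nonempty_fintype ι
  constructor
  · rintro ⟨F, ⟨v, hv, hF⟩, h⟩
    have hmem : (fun v : ι → Fin n → k => MvPolynomial.eval (fun q : ι × Fin n => v q.1 q.2) F) ∈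
        polyFun k (ι → Fin n → k) :=
      comp_mem_polyFun (g := fun (v : ι → Fin n → k) (q : ι × Fin n) => v q.1 q.2)
        (eval_mem_polyFun F) (isPolyMap_linear (curryEquiv k ι (Fin n)).symm.toLinearMap)
    exact ⟨_, hmem, ⟨v, fun i _ => hv i, hF⟩, fun v hv hF => h v (fun i => hv i trivial) hF⟩
  · rintro ⟨f, hf, ⟨v, hv, hfv⟩, h⟩
    obtain ⟨F, hF⟩ := exists_eval_of_mem_polyFun (comp_mem_polyFun
      (g := fun (v : ι × Fin n → k) i j => v (i, j)) hf
      (isPolyMap_linear (curryEquiv k ι (Fin n)).toLinearMap))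
    have hF' : ∀ v : ι → Fin n → k, MvPolynomial.eval (fun q => v q.1 q.2) F = f v :=
      fun v => (hF fun q => v q.1 q.2).symm
    refine ⟨F, ⟨v, fun i => hv i trivial, by rwa [hF']⟩, fun v hv hFv => ?_⟩
    exact h v (fun i _ => hv i) (by rwa [← hF'])

theorem isIrr_iff_isPrime_vanishingIdeal {κ : Type} [Fintype κ] {S : Set (κ → k)} :
    IsIrr (k := k) S ↔ (MvPolynomial.vanishingIdeal k S).IsPrime := by
  have key : ∀ F : MvPolynomial κ k, F ∉ MvPolynomial.vanishingIdeal k S ↔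
      ∃ u ∈ S, MvPolynomial.eval u F ≠ 0 := by
    intro F
    rw [MvPolynomial.mem_vanishingIdeal_iff]
    push Not
    simp [MvPolynomial.aeval_eq_eval]
  constructor
  · rintro ⟨⟨u, hu⟩, h⟩
    refine ⟨fun htop => ?_, fun {F G} hFG => ?_⟩
    · have : (1 : MvPolynomial κ k) ∈ MvPolynomial.vanishingIdeal k S := htop ▸ trivial
      exact (key 1).2 ⟨u, hu, by simp⟩ this
    · by_contra! hne
      obtain ⟨u, hu, h1, h2⟩ := h _ (eval_mem_polyFun F) _ (eval_mem_polyFun G)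
        ((key F).1 hne.1) ((key G).1 hne.2)
      exact (key (F * G)).2 ⟨u, hu, by simp [h1, h2]⟩ hFG
  · intro hp
    refine ⟨?_, fun f hf g hg => ?_⟩
    · have := (key 1).1 fun h => hp.ne_top ((Ideal.eq_top_iff_one _).2 h)
      exact ⟨_, this.choose_spec.1⟩
    · obtain ⟨F, hF⟩ := exists_eval_of_mem_polyFun hf
      obtain ⟨G, hG⟩ := exists_eval_of_mem_polyFun hg
      simp only [hF, hG]
      rw [← key, ← key]
      intro h1 h2
      obtain ⟨u, hu, h3⟩ := (key (F * G)).1 fun h => (hp.mem_or_mem h).elim h1 h2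
      rw [map_mul] at h3
      exact ⟨u, hu, left_ne_zero_of_mul h3, right_ne_zero_of_mul h3⟩

end PolynomialFunctions

/-! ### Lower semicontinuity of sums of tangent spaces. -/

section Semicontinuity

variable {k : Type*} [Field k] {κ : Type} [Fintype κ]

theorem linearIndependent_row_of_det_submatrix_ne_zero {κ : Type*} {r : ℕ}
    {G : Matrix (Fin r) κ k} {c : Fin r → κ} (h : (G.submatrix id c).det ≠ 0) :
    LinearIndependent k G.row := by
  have h1 : LinearIndependent k (G.submatrix id c).row := by
    rw [Matrix.linearIndependent_rows_iff_isUnit, Matrix.isUnit_iff_isUnit_det]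
    exact isUnit_iff_ne_zero.2 h
  exact LinearIndependent.of_comp (LinearMap.funLeft k k c) h1

variable [CharZero k] {S : Set (κ → k)} {d : ℕ}

/-- A vector of the sum at smooth points moves polynomially with the points: write it as a sum of
tangent vectors and extend each to a tangent vector field. -/
theorem IsIrreducibleOfDim.exists_section (hS : IsIrreducibleOfDim S d) {ι : Type*}
    (B : Submodule k (κ → k)) {z₀ : ι → κ → k} (h₀ : ∀ x, z₀ x ∈ S)
    (hz₀ : ∀ x, Module.finrank k (tangentSpace (MvPolynomial.vanishingIdeal k S) (z₀ x)) = d)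
    {w : κ → k} (hw : w ∈ B ⊔ ⨆ x, tangentSpace (MvPolynomial.vanishingIdeal k S) (z₀ x)) :
    ∃ g : (ι → κ → k) → κ → k, IsPolyMap k g ∧ g z₀ = w ∧ ∀ z, (∀ x, z x ∈ S) →
      g z ∈ B ⊔ ⨆ x, tangentSpace (MvPolynomial.vanishingIdeal k S) (z x) := by
  obtain ⟨b, hb, u, hu, rfl⟩ := Submodule.mem_sup.1 hw
  suffices h : ∃ g : (ι → κ → k) → κ → k, IsPolyMap k g ∧ g z₀ = u ∧ ∀ z, (∀ x, z x ∈ S) →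
      g z ∈ ⨆ x, tangentSpace (MvPolynomial.vanishingIdeal k S) (z x) by
    obtain ⟨g, hg, rfl, h⟩ := h
    exact ⟨fun z => b + g z, (isPolyMap_const b).add hg, rfl,
      fun z hz => Submodule.add_mem_sup hb (h z hz)⟩
  induction hu using Submodule.iSup_induction' with
  | mem x u hu =>
    obtain ⟨τ, hτ, hτ₀⟩ := hS.exists_vectorField (h₀ x) (hz₀ x) hu
    refine ⟨fun z i => MvPolynomial.eval (z x) (τ i), ?_, funext hτ₀, fun z hz => ?_⟩
    · refine isPolyMap_pi fun i => ?_
      exact comp_mem_polyFun (g := fun z : ι → κ → k => z x) (eval_mem_polyFun (τ i))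
        (isPolyMap_linear (LinearMap.proj (R := k) (φ := fun _ : ι => κ → k) x))
    · exact Submodule.mem_iSup_of_mem x (hτ _ (hz x))
  | zero => exact ⟨fun _ => 0, isPolyMap_const 0, rfl, fun z _ => Submodule.zero_mem _⟩
  | add u v _ _ hu hv =>
    obtain ⟨g, hg, rfl, h⟩ := hu (Submodule.add_mem_sup hb ‹_›)
    obtain ⟨g', hg', rfl, h'⟩ := hv (Submodule.add_mem_sup hb ‹_›)
    exact ⟨_, hg.add hg', rfl, fun z hz => Submodule.add_mem _ (h z hz) (h' z hz)⟩

/-- Lower semicontinuity of the dimension of a sum of tangent spaces at smooth points. -/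
theorem IsIrreducibleOfDim.exists_nhd (hS : IsIrreducibleOfDim S d) {ι : Type*} [Finite ι]
    (B : Submodule k (κ → k)) {z₀ : ι → κ → k} (h₀ : ∀ x, z₀ x ∈ S)
    (hz₀ : ∀ x, Module.finrank k (tangentSpace (MvPolynomial.vanishingIdeal k S) (z₀ x)) = d) :
    ∃ f ∈ polyFun k (ι → κ → k), f z₀ ≠ 0 ∧ ∀ z, (∀ x, z x ∈ S) → f z ≠ 0 →
      (∀ x, Module.finrank k (tangentSpace (MvPolynomial.vanishingIdeal k S) (z x)) = d) ∧
      Module.finrank k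
        ↥(B ⊔ ⨆ x, tangentSpace (MvPolynomial.vanishingIdeal k S) (z₀ x)) ≤
      Module.finrank k
        ↥(B ⊔ ⨆ x, tangentSpace (MvPolynomial.vanishingIdeal k S) (z x)) := by
  classical
  cases nonempty_fintype ι
  set W := fun z : ι → κ → k => B ⊔ ⨆ x, tangentSpace (MvPolynomial.vanishingIdeal k S) (z x)
  choose δ hδ₀ hδ using fun x => hS.exists_smooth_nhd (hz₀ x)
  let b := Module.finBasis k (W z₀)
  choose g hg hgz hgW using fun a => hS.exists_section B h₀ hz₀ (b a).2
  have hli : LinearIndependent k (Matrix.of fun a => (b a : κ → k)).row :=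
    b.linearIndependent.map' (W z₀).subtype (Submodule.ker_subtype _)
  obtain ⟨c, hc⟩ := exists_det_submatrix_ne_zero hli
  -- While `D` is nonzero, the moving sections of a basis at z₀ stay independent; the product of the
  -- δ's keeps every point smooth.
  let D : (ι → κ → k) → k := fun z => ((Matrix.of fun a => g a z).submatrix id c).det
  have hD : D ∈ polyFun k (ι → κ → k) :=
    det_mem_polyFun fun i j => hg i (LinearMap.proj (c j))
  have hE : (∏ x, fun z : ι → κ → k => MvPolynomial.eval (z x) (δ x)) ∈
      polyFun k (ι → κ → k) := by
    refine (polyFun k _).prod_mem fun x _ => ?_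
    exact comp_mem_polyFun (g := fun z : ι → κ → k => z x) (eval_mem_polyFun (δ x))
      (isPolyMap_linear (LinearMap.proj (R := k) (φ := fun _ : ι => κ → k) x))
  have hE' : ∀ z, (∏ x, fun z : ι → κ → k => MvPolynomial.eval (z x) (δ x)) z ≠ 0 ↔
      ∀ x, MvPolynomial.eval (z x) (δ x) ≠ 0 := fun z => by
    rw [Finset.prod_apply, Finset.prod_ne_zero_iff]; simp
  refine ⟨_, (polyFun k _).mul_mem hD hE, mul_ne_zero ?_ ((hE' _).2 hδ₀), fun z hz hf => ?_⟩
  · change ((Matrix.of fun a => g a z₀).submatrix id c).det ≠ 0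
    simpa only [hgz] using hc
  · refine ⟨fun x => hδ x _ (hz x) ((hE' z).1 (right_ne_zero_of_mul hf) x), ?_⟩
    have h1 : LinearIndependent k fun a => g a z :=
      linearIndependent_row_of_det_submatrix_ne_zero (G := Matrix.of fun a => g a z)
        (left_ne_zero_of_mul hf)
    have h2 : LinearIndependent k fun a => (⟨g a z, hgW a z hz⟩ : W z) :=
      LinearIndependent.of_comp (W z).subtype h1
    simpa using h2.fintype_card_le_finrank

end Semicontinuity

/-! ### Affine cones and Zariski closure. -/

section Cones

variable {k : Type*} [Field k] {n : ℕ}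

theorem coneTangent_eq (X : Set (ℙ k (Fin n → k))) (v : Fin n → k) :
    coneTangent X v = tangentSpace (MvPolynomial.vanishingIdeal k (affineCone X)) v := by
  ext w
  rw [mem_tangentSpace]
  rfl

theorem zero_mem_affineCone (X : Set (ℙ k (Fin n → k))) : 0 ∈ affineCone X :=
  fun h => absurd rfl h

theorem mem_affineCone_of_ne_zero {X : Set (ℙ k (Fin n → k))} {v : Fin n → k} (h : v ≠ 0) :
    v ∈ affineCone X ↔ Projectivization.mk k v h ∈ X := ⟨fun hv => hv h, fun hv _ => hv⟩

theorem smul_mem_affineCone {X : Set (ℙ k (Fin n → k))} {v : Fin n → k} (hv : v ∈ affineCone X)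
    (c : k) : c • v ∈ affineCone X := by
  intro h
  have hv0 : v ≠ 0 := right_ne_zero_of_smul h
  have : Projectivization.mk k (c • v) h = Projectivization.mk k v hv0 := by
    rw [Projectivization.mk_eq_mk_iff']
    exact ⟨c, rfl⟩
  rw [this]
  exact hv hv0

theorem affineCone_planeSection (X : Set (ℙ k (Fin n → k))) (Q : Submodule k (Fin n → k)) :
    affineCone (planeSection X Q) = affineCone X ∩ Q := by
  ext v
  by_cases h : v = 0
  · subst h
    simp [zero_mem_affineCone]
  · rw [mem_affineCone_of_ne_zero h, Set.mem_inter_iff, mem_affineCone_of_ne_zero h, planeSection]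
    simp [Projectivization.submodule_mk]

theorem exists_projDim [CharZero k] {X : Set (ℙ k (Fin n → k))} (hX : (coneIdeal X).IsPrime) :
    ∃ d : ℕ, IsIrreducibleOfDim (affineCone X) d ∧ projDim X = d - 1 := by
  obtain ⟨d, -, -, -, hd, -⟩ := exists_noether_normalization k (MvPolynomial (Fin n) k ⧸ coneIdeal X)
  refine ⟨d, ⟨hX, hd⟩, ?_⟩
  rw [projDim, hd]
  rfl

theorem IsProjectiveVariety.isIrreducibleOfDim [CharZero k] {X : Set (ℙ k (Fin n → k))}
    (hX : IsProjectiveVariety X) {m : ℕ} (hm : projDim X = (m : ℤ) - 1) :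
    IsIrreducibleOfDim (affineCone X) m := by
  obtain ⟨d, hd, h⟩ := exists_projDim hX.2.2
  obtain rfl : m = d := by omega
  exact hd

theorem eval_aeval {σ τ : Type*} (f : MvPolynomial σ k) (g : σ → MvPolynomial τ k) (z : τ → k) :
    MvPolynomial.eval z (MvPolynomial.aeval g f) =
      MvPolynomial.eval (fun i => MvPolynomial.eval z (g i)) f := by
  induction f using MvPolynomial.induction_on with
  | C a => simp
  | add p q hp hq => rw [map_add, map_add, map_add, hp, hq]
  | mul_X p i hp => rw [map_mul, map_mul, map_mul, hp, MvPolynomial.aeval_X, MvPolynomial.eval_X]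

/-- The closure tests polynomials only on the chosen representative of a point. Cones are stable
under scaling, so their ideals are stable under X ↦ cX, and every representative gives the same
answer. -/
theorem mem_zariskiClosure_cone {Y : Set (ℙ k (Fin n → k))} {v : Fin n → k} :
    v ∈ affineCone (zariskiClosure Y) ↔ ∀ f ∈ coneIdeal Y, MvPolynomial.eval v f = 0 := by
  have heval : ∀ (f : MvPolynomial (Fin n) k) (c : k) (z : Fin n → k), MvPolynomial.eval z
      (MvPolynomial.aeval (fun i => MvPolynomial.C c * MvPolynomial.X i) f) =
      MvPolynomial.eval (c • z) f := by
    intro f c z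
    rw [eval_aeval]
    congr 2
    ext i
    simp
  have hscale : ∀ f ∈ coneIdeal Y, ∀ c : k,
      MvPolynomial.aeval (fun i => MvPolynomial.C c * MvPolynomial.X i) f ∈ coneIdeal Y := by
    intro f hf c
    apply mem_vanishingIdeal_of_eval
    intro z hz
    rw [heval]
    exact eval_eq_zero_of_mem_vanishingIdeal hf (smul_mem_affineCone hz c)
  by_cases h : v = 0
  · subst h
    exact ⟨fun _ f hf => eval_eq_zero_of_mem_vanishingIdeal hf (zero_mem_affineCone Y),
      fun _ => zero_mem_affineCone _⟩
  · rw [mem_affineCone_of_ne_zero h]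
    set p := Projectivization.mk k v h
    have hp : ∃ a : kˣ, a • v = p.rep := Projectivization.exists_smul_eq_mk_rep k v h
    obtain ⟨a, ha⟩ := hp
    constructor
    · intro hmem f hf
      have h1 := hmem _ (hscale f hf (a : k)⁻¹)
      rw [heval, ← ha] at h1
      convert h1 using 2
      rw [Units.smul_def, smul_smul, inv_mul_cancel₀ a.ne_zero, one_smul]
    · intro hv f hf
      have h1 := hv _ (hscale f hf (a : k))
      rw [heval] at h1
      rw [← ha]
      exact h1

theorem coneIdeal_zariskiClosure (Y : Set (ℙ k (Fin n → k))) :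
    coneIdeal (zariskiClosure Y) = coneIdeal Y := by
  apply le_antisymm
  · intro f hf
    apply mem_vanishingIdeal_of_eval
    intro z hz
    refine eval_eq_zero_of_mem_vanishingIdeal hf (mem_zariskiClosure_cone.2 fun g hg => ?_)
    exact eval_eq_zero_of_mem_vanishingIdeal hg hz
  · intro f hf
    apply mem_vanishingIdeal_of_eval
    intro z hz
    exact mem_zariskiClosure_cone.1 hz f hf

end Cones

/-! ### Differentials of affine maps. -/

section TangentMap

variable {k : Type*} [Field k] {κ τ : Type} [Fintype κ] [Fintype τ]

/-- The derivative of `f` at `z` in the direction `w`. -/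
def dirDeriv (f : MvPolynomial κ k) (z w : κ → k) : k := ∑ i, gradient f z i * w i

theorem dirDeriv_add (f g : MvPolynomial κ k) (z w : κ → k) :
    dirDeriv (f + g) z w = dirDeriv f z w + dirDeriv g z w := by
  simp [dirDeriv, gradient, add_mul, Finset.sum_add_distrib]

theorem dirDeriv_mul (f g : MvPolynomial κ k) (z w : κ → k) :
    dirDeriv (f * g) z w =
      MvPolynomial.eval z f * dirDeriv g z w + MvPolynomial.eval z g * dirDeriv f z w := by
  simp only [dirDeriv, gradient, Derivation.leibniz, smul_eq_mul, map_add, map_mul, add_mul,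
    Finset.sum_add_distrib, Finset.mul_sum, mul_assoc]

theorem dirDeriv_C (a : k) (z w : κ → k) : dirDeriv (MvPolynomial.C a) z w = 0 := by
  simp [dirDeriv, gradient]

theorem dirDeriv_X (i : κ) (z w : κ → k) : dirDeriv (MvPolynomial.X i) z w = w i := by
  classical
  rw [dirDeriv, Finset.sum_eq_single i]
  · simp [gradient]
  · intro j _ hj
    simp [gradient, MvPolynomial.pderiv_X_of_ne hj.symm]
  · simp

theorem dirDeriv_sum {ι : Type*} (s : Finset ι) (f : ι → MvPolynomial κ k) (z w : κ → k) :
    dirDeriv (∑ x ∈ s, f x) z w = ∑ x ∈ s, dirDeriv (f x) z w := by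
  classical
  induction s using Finset.induction_on with
  | empty => simpa using dirDeriv_C 0 z w
  | insert a s ha ih => rw [Finset.sum_insert ha, Finset.sum_insert ha, dirDeriv_add, ih]

/-- The chain rule for an affine map. -/
theorem exists_affinePullback (A : (τ → k) →ₗ[k] (κ → k)) (b : κ → k) (f : MvPolynomial κ k) :
    ∃ f' : MvPolynomial τ k, (∀ z, MvPolynomial.eval z f' = MvPolynomial.eval (A z + b) f) ∧
      ∀ z w, dirDeriv f' z w = dirDeriv f (A z + b) (A w) := by
  classical
  induction f using MvPolynomial.induction_on with
  | C a => exact ⟨MvPolynomial.C a, fun z => by simp, fun z w => by rw [dirDeriv_C, dirDeriv_C]⟩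
  | add p q hp hq =>
    obtain ⟨p', hp, hp'⟩ := hp
    obtain ⟨q', hq, hq'⟩ := hq
    exact ⟨p' + q', fun z => by rw [map_add, map_add, hp, hq],
      fun z w => by rw [dirDeriv_add, dirDeriv_add, hp', hq']⟩
  | mul_X p i hp =>
    obtain ⟨p', hp, hp'⟩ := hp
    let g : MvPolynomial τ k :=
      ∑ j, MvPolynomial.C (A (Pi.single j 1) i) * MvPolynomial.X j + MvPolynomial.C (b i)
    have hA : ∀ z : τ → k, A z i = ∑ j, A (Pi.single j 1) i * z j := fun z => by
      conv_lhs => rw [pi_eq_sum_univ' z]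
      simp [mul_comm]
    have hg : ∀ z, MvPolynomial.eval z g = (A z + b) i := fun z => by
      simp [g, hA z]
    have hg' : ∀ z w, dirDeriv g z w = A w i := fun z w => by
      simp [g, dirDeriv_add, dirDeriv_sum, dirDeriv_mul, dirDeriv_C, dirDeriv_X, hA w]
    refine ⟨p' * g, fun z => ?_, fun z w => ?_⟩
    · rw [map_mul, map_mul, hp, hg, MvPolynomial.eval_X]
    · rw [dirDeriv_mul, dirDeriv_mul, hp', hp, hg', hg, dirDeriv_X, MvPolynomial.eval_X]

/-- Equations of S' pull back to equations of S, and the chain rule compares their derivatives. -/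
theorem map_mem_tangentSpace {S : Set (τ → k)} {S' : Set (κ → k)}
    (A : (τ → k) →ₗ[k] (κ → k)) (b : κ → k) (h : ∀ z ∈ S, A z + b ∈ S') {z w : τ → k}
    (hw : w ∈ tangentSpace (MvPolynomial.vanishingIdeal k S) z) :
    A w ∈ tangentSpace (MvPolynomial.vanishingIdeal k S') (A z + b) := by
  rw [mem_tangentSpace] at hw ⊢
  intro f hf
  obtain ⟨f', h1, h2⟩ := exists_affinePullback A b f
  have := hw f' (mem_vanishingIdeal_of_eval fun z hz => by
    rw [h1]; exact eval_eq_zero_of_mem_vanishingIdeal hf (h z hz))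
  exact (h2 z w).symm.trans this

end TangentMap

/-! ### Dimension of images and of sums. -/

section Dimension

variable {k : Type*} [Field k] {κ τ : Type} [Fintype κ] [Fintype τ]

/-- Surjectivity embeds the coordinate ring of S' in that of S; transcendence degrees, which equal
the Krull dimensions, then compare. -/
theorem IsIrreducibleOfDim.le_of_surjOn {S : Set (τ → k)} {S' : Set (κ → k)} {d d' : ℕ}
    (hS : IsIrreducibleOfDim S d) (hS' : IsIrreducibleOfDim S' d')
    (g : κ → MvPolynomial τ k)
    (hg : (fun z i => MvPolynomial.eval z (g i)) '' S = S') : d' ≤ d := by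
  have := hS.prime
  have := hS'.prime
  have hmem : ∀ f, f ∈ MvPolynomial.vanishingIdeal k S' ↔
      MvPolynomial.aeval g f ∈ MvPolynomial.vanishingIdeal k S := by
    intro f
    constructor
    · intro hf
      refine mem_vanishingIdeal_of_eval fun z hz => ?_
      rw [eval_aeval]
      exact eval_eq_zero_of_mem_vanishingIdeal hf (hg ▸ ⟨z, hz, rfl⟩)
    · intro hf
      refine mem_vanishingIdeal_of_eval fun y hy => ?_
      obtain ⟨z, hz, rfl⟩ := hg.ge hy
      have := eval_eq_zero_of_mem_vanishingIdeal hf hz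
      rwa [eval_aeval] at this
  have hcomap : MvPolynomial.vanishingIdeal k S' =
      (MvPolynomial.vanishingIdeal k S).comap (MvPolynomial.aeval g) := Ideal.ext hmem
  let φ : (MvPolynomial κ k ⧸ MvPolynomial.vanishingIdeal k S') →ₐ[k]
      (MvPolynomial τ k ⧸ MvPolynomial.vanishingIdeal k S) :=
    Ideal.quotientMapₐ _ (MvPolynomial.aeval g) hcomap.le
  have hφ : Function.Injective φ :=
    Ideal.quotientMap_injective' (H := hcomap.le) hcomap.ge
  obtain ⟨e, -, -, -, he, he'⟩ := exists_noether_normalization k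
    (MvPolynomial τ k ⧸ MvPolynomial.vanishingIdeal k S)
  obtain ⟨e', -, -, -, hf, hf'⟩ := exists_noether_normalization k
    (MvPolynomial κ k ⧸ MvPolynomial.vanishingIdeal k S')
  obtain rfl : d = e := by exact_mod_cast hS.dim.symm.trans he
  obtain rfl : d' = e' := by exact_mod_cast hS'.dim.symm.trans hf
  have := trdeg_le_of_injective φ hφ
  rw [he', hf'] at this
  exact_mod_cast this

theorem exists_isIrreducibleOfDim {S : Set (κ → k)} (hS : IsIrr (k := k) S) :
    ∃ d, IsIrreducibleOfDim S d := by
  have hp := isIrr_iff_isPrime_vanishingIdeal.1 hS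
  obtain ⟨d, -, -, -, hd, -⟩ :=
    exists_noether_normalization k (MvPolynomial κ k ⧸ MvPolynomial.vanishingIdeal k S)
  exact ⟨d, hp, hd⟩

theorem IsIrreducibleOfDim.isIrr {S : Set (κ → k)} {d : ℕ} (hS : IsIrreducibleOfDim S d) :
    IsIrr (k := k) S := isIrr_iff_isPrime_vanishingIdeal.2 hS.prime

theorem Generic.of_exists_eval {S : Set (κ → k)} {δ : MvPolynomial κ k}
    (hδ : δ ∉ MvPolynomial.vanishingIdeal k S) {R : (κ → k) → Prop}
    (h : ∀ z ∈ S, MvPolynomial.eval z δ ≠ 0 → R z) : Generic k S R := by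
  refine ⟨_, eval_mem_polyFun δ, ?_, h⟩
  by_contra! h0
  exact hδ (mem_vanishingIdeal_of_eval h0)

theorem IsIrreducibleOfDim.generic_smooth [CharZero k] {S : Set (κ → k)} {d : ℕ}
    (hS : IsIrreducibleOfDim S d) : Generic k S fun z =>
      Module.finrank k (tangentSpace (MvPolynomial.vanishingIdeal k S) z) = d := by
  obtain ⟨δ, hδ, h⟩ := hS.exists_smooth
  exact Generic.of_exists_eval hδ h

/-- The image is no larger in dimension than the product. At a generic point of the product, which
is smooth and has smooth coordinates, the tangent space embeds in the product of the tangent spaces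
of the factors. -/
theorem IsIrreducibleOfDim.le_mul_of_sum [CharZero k] {S : Set (κ → k)} {m : ℕ}
    (hS : IsIrreducibleOfDim S m) {ι : Type} [Fintype ι] {D : ℕ}
    (hD : IsIrreducibleOfDim ((fun z : ι → κ → k => ∑ x, z x) '' Set.univ.pi fun _ => S) D) :
    D ≤ Fintype.card ι * m := by
  classical
  let S' : Set (ι × κ → k) := (curryEquiv k ι κ).symm '' Set.univ.pi fun _ => S
  have hirr : IsIrr (k := k) S' :=
    (IsIrr.pi fun _ => hS.isIrr).image (isPolyMap_linear (curryEquiv k ι κ).symm.toLinearMap)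
  obtain ⟨d, hd⟩ := exists_isIrreducibleOfDim hirr
  have h1 : D ≤ d := by
    refine hd.le_of_surjOn hD (fun j => ∑ x : ι, MvPolynomial.X (x, j)) ?_
    rw [Set.image_image]
    refine Set.image_congr fun z _ => ?_
    ext j
    simp [curryEquiv, Function.uncurry]
  have hproj : ∀ x : ι, ∀ z ∈ S', LinearMap.funLeft k k (fun j : κ => (x, j)) z + 0 ∈ S := by
    rintro x _ ⟨z, hz, rfl⟩
    rw [add_zero]
    exact hz x trivial
  have hgen : ∀ x : ι, Generic k S' fun z => Module.finrank k (tangentSpace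
      (MvPolynomial.vanishingIdeal k S) (LinearMap.funLeft k k (fun j : κ => (x, j)) z + 0)) = m := by
    intro x
    refine Generic.comap (S' := S)
      (g := fun z => LinearMap.funLeft k k (fun j : κ => (x, j)) z + 0)
      ((isPolyMap_linear _).add (isPolyMap_const _)) (fun w hw => ?_) (hproj x)
      hS.generic_smooth
    exact ⟨_, ⟨fun _ => w, fun _ _ => hw, rfl⟩, by ext j; simp [curryEquiv, LinearMap.funLeft]⟩
  obtain ⟨z, hz, hzd, hzm⟩ := (hd.generic_smooth.and hirr
    (Generic.forall_fintype hirr hgen)).exists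
  let Φ : tangentSpace (MvPolynomial.vanishingIdeal k S') z →ₗ[k]
      (Π x : ι, tangentSpace (MvPolynomial.vanishingIdeal k S)
        (LinearMap.funLeft k k (fun j : κ => (x, j)) z + 0)) :=
    LinearMap.pi fun x => (LinearMap.funLeft k k (fun j : κ => (x, j))).restrict
      fun w hw => map_mem_tangentSpace _ 0 (hproj x) hw
  have hΦ : Function.Injective Φ := by
    intro a b hab
    ext ⟨x, j⟩
    exact congrFun (congrArg Subtype.val (congrFun hab x)) j
  have h2 := LinearMap.finrank_le_finrank_of_injective hΦ
  rw [hzd, Module.finrank_pi_fintype, Finset.sum_congr rfl fun x _ => hzm x] at h2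
  simp at h2
  omega

end Dimension

/-! ### Secant varieties and Terracini's lemma. -/

section Terracini

variable {k : Type*} [Field k] {n : ℕ}

theorem mem_affineCone_of_mem_submodule {X : Set (ℙ k (Fin n → k))} {p : ℙ k (Fin n → k)}
    (hp : p ∈ X) {v : Fin n → k} (hv : v ∈ p.submodule) : v ∈ affineCone X := by
  rw [Projectivization.submodule_eq, Submodule.mem_span_singleton] at hv
  obtain ⟨c, rfl⟩ := hv
  refine smul_mem_affineCone (fun h => ?_) c
  rwa [Projectivization.mk_rep]

/-- Scalars are absorbed into the cone, so points of the span of s points of X are sums of s cone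
vectors. -/
theorem affineCone_secant {X : Set (ℙ k (Fin n → k))} (hX : X.Nonempty) (s : ℕ) :
    affineCone {q | ∃ p : Fin s → ℙ k (Fin n → k),
      (∀ i, p i ∈ X) ∧ q.submodule ≤ ⨆ i, (p i).submodule} =
    (fun z : Fin s → Fin n → k => ∑ x, z x) '' Set.univ.pi fun _ => affineCone X := by
  classical
  obtain ⟨x₀, hx₀⟩ := hX
  ext v
  by_cases h : v = 0
  · subst h
    refine ⟨fun _ => ⟨0, fun _ _ => zero_mem_affineCone X, by simp⟩, fun _ => zero_mem_affineCone _⟩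
  rw [mem_affineCone_of_ne_zero h]
  simp only [Set.mem_ofPred_eq, Projectivization.submodule_mk, Submodule.span_singleton_le_iff_mem]
  constructor
  · rintro ⟨p, hp, hv⟩
    rw [Submodule.mem_iSup_iff_exists_finsupp] at hv
    obtain ⟨f, hf, rfl⟩ := hv
    refine ⟨f, fun i _ => mem_affineCone_of_mem_submodule (hp i) (hf i), ?_⟩
    exact (Finsupp.sum_fintype f (fun _ x => x) fun _ => rfl).symm
  · rintro ⟨z, hz, rfl⟩
    -- A zero summand determines no projective point; any point of X serves in its place.
    refine ⟨fun i => if hi : z i = 0 then x₀ else Projectivization.mk k (z i) hi, fun i => ?_, ?_⟩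
    · dsimp only
      split_ifs with hi
      · exact hx₀
      · exact hz i trivial hi
    · refine Submodule.sum_mem _ fun i _ => Submodule.mem_iSup_of_mem i ?_
      dsimp only
      split_ifs with hi
      · rw [hi]; exact Submodule.zero_mem _
      · rw [Projectivization.submodule_mk]; exact Submodule.mem_span_singleton_self _

/-- Terracini's lemma, in the form of a criterion for nondefectivity. -/
theorem isNondefective_of_finrank [CharZero k] {X : Set (ℙ k (Fin n → k))}
    (hX : IsProjectiveVariety X) {m : ℕ} (hm : projDim X = (m : ℤ) - 1) {s : ℕ}
    {p : Fin s → Fin n → k} (hp : ∀ i, p i ∈ affineCone X)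
    (hsm : ∀ i, Module.finrank k (coneTangent X (p i)) = m)
    (h : min (s * m) n ≤ Module.finrank k ↥(⨆ i, coneTangent X (p i))) :
    IsNondefective s X := by
  classical
  have hS := hX.isIrreducibleOfDim hm
  rw [funext (coneTangent_eq X)] at hsm h
  let sumMap := fun z : Fin s → Fin n → k => ∑ x, z x
  have hsum : IsPolyMap k sumMap := by
    have := isPolyMap_linear
      (∑ x, LinearMap.proj (R := k) (φ := fun _ : Fin s => Fin n → k) x)
    have heq : sumMap = ⇑(∑ x, LinearMap.proj (R := k) (φ := fun _ : Fin s => Fin n → k) x) := by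
      funext z
      simp [sumMap]
    rw [heq]
    exact this
  have hpi : IsIrr (k := k) (Set.univ.pi fun _ : Fin s => affineCone X) :=
    IsIrr.pi fun _ => hS.isIrr
  obtain ⟨D, hD⟩ := exists_isIrreducibleOfDim (hpi.image hsum)
  have hD1 : D ≤ s * m := by simpa using hS.le_mul_of_sum hD
  -- Spreads the bound from `p` to generic tuples, so that one can be chosen whose sum is a smooth
  -- point of the image.
  obtain ⟨f, hf, hf0, hfz⟩ := hS.exists_nhd ⊥ hp hsm
  have hgen1 : Generic k (Set.univ.pi fun _ : Fin s => affineCone X) fun z =>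
      Module.finrank k ↥(⨆ i, tangentSpace (MvPolynomial.vanishingIdeal k (affineCone X)) (p i)) ≤
      Module.finrank k ↥(⨆ i, tangentSpace (MvPolynomial.vanishingIdeal k (affineCone X)) (z i)) :=
    ⟨f, hf, ⟨p, fun i _ => hp i, hf0⟩, fun z hz hfz' => by
      have := (hfz z (fun i => hz i trivial) hfz').2
      rwa [bot_sup_eq, bot_sup_eq] at this⟩
  have hgen2 := hD.generic_smooth.comap hsum (S := Set.univ.pi fun _ : Fin s => affineCone X)
    (fun w hw => hw) (fun z hz => ⟨z, hz, rfl⟩)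
  obtain ⟨z, hz, hz1, hz2⟩ := (hgen1.and hpi hgen2).exists
  -- Moving a single summand is a translation of the cone into the image, so each tangent space lies
  -- in that of the image at the sum.
  have hle : (⨆ i, tangentSpace (MvPolynomial.vanishingIdeal k (affineCone X)) (z i)) ≤
      tangentSpace (MvPolynomial.vanishingIdeal k (sumMap '' Set.univ.pi fun _ => affineCone X))
        (sumMap z) := by
    refine iSup_le fun i w hw => ?_
    have hupd : ∀ y : Fin n → k, sumMap (Function.update z i y) =
        (LinearMap.id : (Fin n → k) →ₗ[k] _) y + ∑ j ∈ Finset.univ.erase i, z j := fun y => by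
      simp only [sumMap]
      rw [← Finset.add_sum_erase _ _ (Finset.mem_univ i), Function.update_self]
      congr 1
      exact Finset.sum_congr rfl fun j hj => by
        rw [Function.update_of_ne (Finset.ne_of_mem_erase hj)]
    have h1 := map_mem_tangentSpace (S' := sumMap '' Set.univ.pi fun _ => affineCone X)
      LinearMap.id (∑ j ∈ Finset.univ.erase i, z j) (fun y hy => ?_) hw
    · rwa [← hupd, Function.update_eq_self] at h1
    · rw [← hupd]
      refine ⟨_, fun j _ => ?_, rfl⟩
      by_cases hj : j = i
      · subst hj; simpa using hy
      · simpa [hj] using hz j trivial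
  have hD2 : min (s * m) n ≤ D := by
    have := Submodule.finrank_mono hle
    omega
  have hD3 : D ≤ n := by
    rw [← hz2]
    exact (Submodule.finrank_le _).trans (by simp)
  have hprime : (coneIdeal {q | ∃ p : Fin s → ℙ k (Fin n → k),
      (∀ i, p i ∈ X) ∧ q.submodule ≤ ⨆ i, (p i).submodule}).IsPrime := by
    rw [coneIdeal, affineCone_secant hX.1]
    exact hD.prime
  obtain ⟨D', hD', hdim⟩ := exists_projDim hprime
  rw [affineCone_secant hX.1] at hD'
  obtain rfl : D = D' := by exact_mod_cast hD.dim.symm.trans hD'.dim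
  have hdim' : projDim (secantVariety s X) = (D : ℤ) - 1 := by
    rw [← hdim, projDim, projDim, secantVariety, coneIdeal_zariskiClosure]
  rw [IsNondefective, secantExpDim, hdim', hm]
  have : (D : ℤ) = min ((s : ℤ) * m) n := by
    have h4 : D = min (s * m) n := by omega
    rw [h4]; push_cast; rfl
  rw [this, sub_add_cancel, min_sub_sub_right]

end Terracini

/-! ### Finite calculus of quasipolynomials. -/

section FiniteCalculus

open Polynomial

variable {ℓ : ℕ}

theorem bdiff_succ (i : ℕ) (f : ℕ → ℤ) (t : ℕ) :
    bdiff ℓ (i + 1) f t = bdiff ℓ i f t - bdiff ℓ i f (t - ℓ) := rfl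

theorem bdiff_succ' (i : ℕ) (f : ℕ → ℤ) (t : ℕ) :
    bdiff ℓ (i + 1) f t = bdiff ℓ i (bdiff ℓ 1 f) t := by
  induction i generalizing t with
  | zero => rfl
  | succ i ih => rw [bdiff_succ, ih, ih, bdiff_succ]

/-- Read off the Taylor expansion at -c. The exact new coefficient is kept so that all branches of a
quasipolynomial still share it after differencing. -/
theorem coeff_sub_comp (p : ℚ[X]) (D : ℕ) (hp : p.natDegree ≤ D + 1) (c : ℚ) :
    (p - p.comp (X - C c)).natDegree ≤ D ∧
      (p - p.comp (X - C c)).coeff D = (D + 1) * c * p.coeff (D + 1) := by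
  have ht : p.comp (X - C c) = taylor (-c) p := by
    rw [taylor_apply, C_neg, sub_eq_add_neg]
  rw [ht]
  have key : ∀ j, (hasseDeriv j p).natDegree ≤ D + 1 - j := fun j =>
    (natDegree_hasseDeriv_le p j).trans (Nat.sub_le_sub_right hp j)
  constructor
  · rw [natDegree_le_iff_coeff_eq_zero]
    intro j hj
    rw [coeff_sub, taylor_coeff]
    rcases Nat.lt_or_ge (D + 1) j with h | h
    · rw [coeff_eq_zero_of_natDegree_lt (lt_of_le_of_lt hp h),
        hasseDeriv_eq_zero_of_lt_natDegree p j (lt_of_le_of_lt hp h)]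
      simp
    · obtain rfl : j = D + 1 := by omega
      have h0 := eq_C_of_natDegree_le_zero ((key (D + 1)).trans (by omega))
      rw [h0, eval_C, hasseDeriv_coeff]
      simp
  · rw [coeff_sub, taylor_coeff,
      eval_eq_sum_range' (n := 2) (lt_of_le_of_lt (key D) (by omega))]
    simp only [Finset.sum_range_succ, Finset.sum_range_zero, hasseDeriv_coeff, zero_add]
    rw [show 1 + D = D + 1 from add_comm 1 D, Nat.choose_self,
      Nat.choose_succ_self_right]
    push_cast
    ring

/-- The `D`th difference of a quasipolynomial of degree at most `D`, all whose branches have the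
same coefficient in degree `D`, is constant. -/
theorem bdiff_eq_const_of_quasi (hℓ : 1 ≤ ℓ) (D : ℕ) (b : ℚ) (f : ℕ → ℤ) (u : ℕ)
    (p : ℕ → ℚ[X]) (hp : ∀ r < ℓ, (p r).natDegree ≤ D ∧ (p r).coeff D = b)
    (hf : ∀ t, u < t → (f t : ℚ) = (p (t % ℓ)).eval (t : ℚ)) :
    ∃ c : ℚ, ∀ t, u + D * ℓ < t → (bdiff ℓ D f t : ℚ) = c := by
  induction D generalizing b f u p with
  | zero =>
    refine ⟨b, fun t ht => ?_⟩
    obtain ⟨h1, h2⟩ := hp (t % ℓ) (Nat.mod_lt _ hℓ)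
    rw [bdiff, hf t (by omega), eq_C_of_natDegree_le_zero h1, eval_C, h2]
  | succ D ih =>
    obtain ⟨c, hc⟩ := ih ((D + 1) * ℓ * b) (bdiff ℓ 1 f) (u + ℓ)
      (fun r => p r - (p r).comp (X - C (ℓ : ℚ))) (fun r hr => by
        obtain ⟨h1, h2⟩ := coeff_sub_comp (p r) D (hp r hr).1 ℓ
        exact ⟨h1, by rw [h2, (hp r hr).2]⟩) (fun t ht => by
        have hmod : (t - ℓ) % ℓ = t % ℓ := by
          rw [← Nat.mod_eq_sub_mod (by omega)]
        rw [bdiff_succ, bdiff, bdiff, Int.cast_sub, hf t (by omega), hf (t - ℓ) (by omega), hmod,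
          Nat.cast_sub (by omega)]
        simp)
    refine ⟨c, fun t ht => ?_⟩
    rw [bdiff_succ']
    refine hc t ?_
    rw [Nat.succ_mul] at ht
    omega

theorem exists_bdiff_eq (hℓ : 1 ≤ ℓ) (D : ℕ) (b : ℚ) (f : ℕ → ℤ)
    (p : ℕ → ℚ[X]) (hp : ∀ r < ℓ, (p r).natDegree ≤ D ∧ (p r).coeff D = b)
    (hf : ∀ t, 1 ≤ t → (f t : ℚ) = (p (t % ℓ)).eval (t : ℚ)) :
    ∃ c : ℤ, ∀ t, D * ℓ < t → bdiff ℓ D f t = c := by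
  obtain ⟨c, hc⟩ := bdiff_eq_const_of_quasi hℓ D b f 0 p hp (fun t ht => hf t ht)
  refine ⟨bdiff ℓ D f (D * ℓ + 1), fun t ht => ?_⟩
  have h1 := hc t (by omega)
  have h2 := hc (D * ℓ + 1) (by omega)
  exact_mod_cast h1.trans h2.symm

theorem IsQuasipolynomialOfDegree.exists_bdiff_eq (hℓ : 1 ≤ ℓ) {D : ℕ} {f : ℕ → ℤ}
    (hf : IsQuasipolynomialOfDegree ℓ D f) : ∃ c : ℤ, ∀ t, D * ℓ < t → bdiff ℓ D f t = c := by
  obtain ⟨a, p, hp, hf⟩ := hf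
  refine BOLattice.exists_bdiff_eq hℓ D a f p (fun r hr => ?_) hf
  obtain ⟨h1, h2⟩ := hp r hr
  exact ⟨h1.le, by rw [← h2, leadingCoeff, h1]⟩

theorem IsQuasipolynomial.sub_one {f g : ℕ → ℤ} (hf : IsQuasipolynomial ℓ f)
    (hg : ∀ t, g t = f t - 1) : IsQuasipolynomial ℓ g := by
  obtain ⟨d, a, p, hp, hf⟩ := hf
  -- Subtracting 1 changes the leading coefficient only in degree 0.
  rcases Nat.eq_zero_or_pos d with rfl | hd
  · refine ⟨0, a - 1, fun r => p r - 1, fun r hr => ?_, fun t ht => ?_⟩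
    · obtain ⟨h1, h2⟩ := hp r hr
      have h3 : p r = C a := by
        rw [eq_C_of_natDegree_eq_zero h1, ← h2, leadingCoeff, h1]
      have h4 : p r - 1 = C (a - 1) := by rw [h3, C_sub, C_1]
      dsimp only
      rw [h4]
      exact ⟨natDegree_C _, leadingCoeff_C _⟩
    · rw [hg]; push_cast; rw [hf t ht]; simp
  · refine ⟨d, a, fun r => p r - 1, fun r hr => ?_, fun t ht => ?_⟩
    · obtain ⟨h1, h2⟩ := hp r hr
      have h3 : (p r - 1).natDegree = d := by
        rw [← C_1, natDegree_sub_C, h1]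
      refine ⟨h3, ?_⟩
      rw [leadingCoeff, h3, coeff_sub, coeff_one, if_neg hd.ne', sub_zero, ← h2, leadingCoeff, h1]
    · rw [hg]; push_cast; rw [hf t ht]; simp

/-- Otherwise pq outgrows r, and on the multiples of ℓ it eventually exceeds r or becomes negative,
according to the sign of its leading coefficient. -/
theorem natDegree_le_of_mul_le (p q r : ℚ[X]) (K : ℕ) (hℓ : 1 ≤ ℓ) (hq : q.natDegree = 1)
    (hr : r.natDegree ≤ K) (hK : 1 ≤ K)
    (h1 : ∀ n : ℕ, 1 ≤ n → 0 ≤ p.eval ((ℓ * n : ℕ) : ℚ) * q.eval ((ℓ * n : ℕ) : ℚ))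
    (h2 : ∀ n : ℕ, 1 ≤ n → p.eval ((ℓ * n : ℕ) : ℚ) * q.eval ((ℓ * n : ℕ) : ℚ) ≤
      r.eval ((ℓ * n : ℕ) : ℚ)) : p.natDegree + 1 ≤ K := by
  by_contra! hlt
  have hp0 : p ≠ 0 := by
    rintro rfl
    simp at hlt
    omega
  have hq0 : q ≠ 0 := by
    rintro rfl
    simp at hq
  have hdeg : (p * q).natDegree = p.natDegree + 1 := by rw [natDegree_mul hp0 hq0, hq]
  have hdeg' : r.degree < (p * q).degree := by
    rw [degree_eq_natDegree (mul_ne_zero hp0 hq0), hdeg]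
    exact degree_le_natDegree.trans_lt (by exact_mod_cast lt_of_le_of_lt hr hlt)
  have htend : Filter.Tendsto (fun n : ℕ => ((ℓ * n : ℕ) : ℚ)) Filter.atTop Filter.atTop := by
    refine Filter.tendsto_atTop_mono (f := fun n : ℕ => (n : ℚ)) (fun n => ?_)
      tendsto_natCast_atTop_atTop
    exact_mod_cast Nat.le_mul_of_pos_left n hℓ
  rcases le_or_gt 0 (p * q).leadingCoeff with h | h
  · have hsub : (p * q - r).leadingCoeff = (p * q).leadingCoeff := leadingCoeff_sub_of_degree_lt hdeg'
    have hd : 0 < (p * q - r).degree := by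
      rw [degree_sub_eq_left_of_degree_lt hdeg', ← natDegree_pos_iff_degree_pos, hdeg]
      omega
    have := ((p * q - r).tendsto_atTop_of_leadingCoeff_nonneg hd (hsub ▸ h)).comp htend
    obtain ⟨n, hn, hn'⟩ := ((this.eventually_gt_atTop 0).and (Filter.eventually_ge_atTop 1)).exists
    have := h2 n hn'
    simp only [Function.comp_apply, eval_sub, eval_mul] at hn
    linarith
  · have hd : 0 < (p * q).degree := by
      rw [← natDegree_pos_iff_degree_pos, hdeg]
      omega
    have := ((p * q).tendsto_atBot_of_leadingCoeff_nonpos hd h.le).comp htend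
    obtain ⟨n, hn, hn'⟩ := ((this.eventually_lt_atBot 0).and (Filter.eventually_ge_atTop 1)).exists
    have := h1 n hn'
    simp only [Function.comp_apply, eval_mul] at hn
    linarith

/-- From 0 ≤ s₂m ≤ N + m on multiples of ℓ, the degree of s₂ is at most K₀-1; one residue class
suffices because all branches have equal degree. The shift e covers s₁ and s₂ together. -/
theorem exists_bdiff_eq_of_ceil (hℓ : 1 ≤ ℓ) {K₀ : ℕ} (hK₀ : 1 ≤ K₀) {N m : ℕ → ℕ}
    (hN : IsQuasipolynomialOfDegree ℓ K₀ (fun t => (N t : ℤ)))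
    (hm : IsQuasipolynomialOfDegree ℓ 1 (fun t => (m t : ℤ)))
    (hmpos : ∀ t, 1 ≤ t → 1 ≤ m t) {s₂ : ℕ → ℤ}
    (hs₂ : ∀ t, s₂ t = ⌈(N t : ℚ) / (m t : ℚ)⌉) (hquasi : IsQuasipolynomial ℓ s₂) (e : ℤ) :
    ∃ c : ℤ, ∀ t, (K₀ - 1) * ℓ < t → bdiff ℓ (K₀ - 1) (fun u => s₂ u - e) t = c := by
  obtain ⟨d, a, p, hp, hf⟩ := hquasi
  obtain ⟨aN, pN, hpN, hfN⟩ := hN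
  obtain ⟨am, pm, hpm, hfm⟩ := hm
  have hd : d + 1 ≤ K₀ := by
    have h := natDegree_le_of_mul_le (p 0) (pm 0) (pN 0 + pm 0) K₀ hℓ (hpm 0 hℓ).1
      ((natDegree_add_le _ _).trans (max_le (hpN 0 hℓ).1.le ((hpm 0 hℓ).1.le.trans hK₀))) hK₀
    rw [(hp 0 hℓ).1] at h
    have hev : ∀ n : ℕ, 1 ≤ n → (p 0).eval ((ℓ * n : ℕ) : ℚ) = s₂ (ℓ * n) ∧
        (pm 0).eval ((ℓ * n : ℕ) : ℚ) = m (ℓ * n) ∧ (pN 0).eval ((ℓ * n : ℕ) : ℚ) = N (ℓ * n) ∧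
        (1 : ℚ) ≤ m (ℓ * n) := by
      intro n hn
      have h1 : 1 ≤ ℓ * n := Nat.mul_pos hℓ hn
      have h2 := hf _ h1
      have h3 := hfm _ h1
      have h4 := hfN _ h1
      rw [Nat.mul_mod_right] at h2 h3 h4
      exact ⟨h2.symm, by rw [← h3]; simp, by rw [← h4]; simp, by exact_mod_cast hmpos _ h1⟩
    refine h (fun n hn => ?_) (fun n hn => ?_)
    · obtain ⟨h1, h2, h3, h4⟩ := hev n hn
      rw [h1, h2, hs₂]
      refine mul_nonneg ?_ (by positivity)
      have : (0 : ℚ) ≤ (N (ℓ * n) : ℚ) / m (ℓ * n) := by positivity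
      exact_mod_cast Int.ceil_nonneg this
    · obtain ⟨h1, h2, h3, h4⟩ := hev n hn
      rw [eval_add, h1, h2, h3, hs₂]
      have hpos : (0 : ℚ) < m (ℓ * n) := by linarith
      have h5 := (Int.ceil_lt_add_one ((N (ℓ * n) : ℚ) / m (ℓ * n))).le
      calc _ ≤ ((N (ℓ * n) : ℚ) / m (ℓ * n) + 1) * m (ℓ * n) :=
            mul_le_mul_of_nonneg_right h5 hpos.le
        _ = _ := by field_simp
  -- The common coefficient in degree K₀-1: it is zero before the shift if the degree is smaller,
  -- and e enters only when K₀ = 1.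
  refine exists_bdiff_eq hℓ (K₀ - 1)
    ((if d = K₀ - 1 then a else 0) - if K₀ - 1 = 0 then (e : ℚ) else 0) _ (fun r => p r - C (e : ℚ))
    (fun r hr => ⟨?_, ?_⟩) (fun t ht => ?_)
  · rw [natDegree_sub_C, (hp r hr).1]; omega
  · obtain ⟨h1, h2⟩ := hp r hr
    rw [coeff_sub, coeff_C]
    congr 1
    split_ifs with h
    · rw [← h, ← h2, leadingCoeff, h1]
    · exact coeff_eq_zero_of_natDegree_lt (by omega)
  · push_cast; rw [hf t ht]; simp

/-- K(t) is the largest j ≤ K₀ with t - jℓ ≥ 1, which keeps all the differences used free of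
truncated subtraction. -/
theorem le_kay_iff (hℓ : 1 ≤ ℓ) {K₀ t : ℕ} (ht : 1 ≤ t) (j : ℕ) :
    j ≤ kay ℓ K₀ t ↔ j ≤ K₀ ∧ j * ℓ < t := by
  rw [kay, le_min_iff, and_comm]
  refine and_congr Iff.rfl ?_
  have h1 : t ⌈/⌉ ℓ ≤ j ↔ t ≤ ℓ * j := by
    rw [ceilDiv_le_iff_le_mul hℓ, mul_comm]
  have h2 : 1 ≤ t ⌈/⌉ ℓ := by
    by_contra! h
    have : t ⌈/⌉ ℓ ≤ 0 := by omega
    rw [ceilDiv_le_iff_le_mul hℓ] at this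
    omega
  rw [mul_comm j ℓ]
  omega

theorem bdiff_succ_eq_zero {D : ℕ} {f : ℕ → ℤ} {c : ℤ}
    (h : ∀ t, D * ℓ < t → bdiff ℓ D f t = c) {t : ℕ} (ht : (D + 1) * ℓ < t) :
    bdiff ℓ (D + 1) f t = 0 := by
  rw [Nat.succ_mul] at ht
  rw [bdiff_succ, h t (by omega), h (t - ℓ) (by omega), sub_self]

/-- Descend on j from K₀, where the difference is zero. For fixed j, ∇^j s(u) = ∇^j s(u-ℓ) +
∇^{j+1}s(u) reduces u until u ≤ (j+1)ℓ. -/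
theorem bdiff_nonneg (hℓ : 1 ≤ ℓ) {K₀ : ℕ} (hK₀ : 1 ≤ K₀) {s : ℕ → ℤ} {c : ℤ}
    (hs : ∀ t, (K₀ - 1) * ℓ < t → bdiff ℓ (K₀ - 1) s t = c)
    (hcount : ∀ t, 1 ≤ t → t ≤ tzero ℓ K₀ → ∀ I, 0 ≤ pointCount ℓ K₀ s t I)
    {j : ℕ} (hj : j ≤ K₀) {u : ℕ} (hu : j * ℓ < u) : 0 ≤ bdiff ℓ j s u := by
  induction hj using Nat.decreasingInduction generalizing u with
  | self =>
    obtain ⟨K, rfl⟩ : ∃ K, K₀ = K + 1 := ⟨K₀ - 1, by omega⟩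
    exact (bdiff_succ_eq_zero hs hu).ge
  | of_succ j hjK ih =>
    induction u using Nat.strong_induction_on with
    | _ u ihu =>
      rcases Nat.lt_or_ge ((j + 1) * ℓ) u with h | h
      · have h1 := ih h
        rw [Nat.succ_mul] at h
        have h2 := ihu (u - ℓ) (by omega) (by omega)
        rw [bdiff_succ] at h1
        omega
      -- In this range K(u) = j and u ≤ t₀, so ∇^j s(u) is the number of points assigned to the
      -- empty label set.
      · have h1 : kay ℓ K₀ u = j := by
          apply le_antisymm
          · by_contra! hlt
            have := ((le_kay_iff hℓ (by omega) (j + 1)).1 hlt).2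
            omega
          · exact (le_kay_iff hℓ (by omega) j).2 ⟨hjK.le, hu⟩
        have h2 : u ≤ tzero ℓ K₀ := by
          have : (j + 1) * ℓ ≤ K₀ * ℓ := Nat.mul_le_mul_right _ hjK
          rw [tzero, mul_comm ℓ K₀]
          omega
        have h3 := hcount u (by omega) h2 ∅
        rw [pointCount, h1] at h3
        simpa using h3

/-- The numerical form of dim A = dim(A + P) + dim(A ∩ P) - dim P for one further plane P; it needs
∇m to be constant. -/
theorem smallA_pred {N m : ℕ → ℕ} {s : ℕ → ℤ} {c : ℤ}
    (hm : ∀ t, ℓ < t → bdiff ℓ 1 (fun u => (m u : ℤ)) t = c) {j t : ℕ} (ht : (j + 1) * ℓ < t) :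
    smallA ℓ N m s j t = smallA ℓ N m s (j + 1) t + smallA ℓ N m s j (t - ℓ) - N (t - ℓ) := by
  rw [Nat.succ_mul] at ht
  have hc : (m (t - ℓ) : ℤ) = m t - c := by
    have := hm t (by omega)
    simp only [bdiff] at this
    omega
  have h1 := hm t (by omega)
  rcases j with _ | j
  · simp only [smallA, h1, hc, bdiff_succ]
    simp only [bdiff, Nat.add_sub_cancel]
    push_cast
    ring
  · have h2 := hm (t - ℓ) (by rw [Nat.succ_mul] at ht; omega)
    simp only [smallA, h1, h2, hc]
    simp only [Nat.add_sub_cancel]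
    rw [bdiff_succ (j + 1) (fun u => (N u : ℤ)) t, bdiff_succ (j + 1) s t,
      bdiff_succ j s (t - ℓ)]
    push_cast
    ring

/-- The excess over N(t) does not depend on t, so the bound at t₀ gives the one at every later t. -/
theorem smallA_sub_eq {K₀ : ℕ} (hK₀ : 1 ≤ K₀) {N m : ℕ → ℕ} {s : ℕ → ℤ}
    {c cN cs : ℤ}
    (hm : ∀ t, ℓ < t → bdiff ℓ 1 (fun u => (m u : ℤ)) t = c)
    (hN : ∀ t, K₀ * ℓ < t → bdiff ℓ K₀ (fun u => (N u : ℤ)) t = cN)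
    (hs : ∀ t, (K₀ - 1) * ℓ < t → bdiff ℓ (K₀ - 1) s t = cs) {t : ℕ} (ht : K₀ * ℓ < t) :
    smallA ℓ N m s K₀ t - N t = K₀ * c * cs - cN := by
  obtain ⟨K, rfl⟩ : ∃ K, K₀ = K + 1 := ⟨K₀ - 1, by omega⟩
  have h0 := bdiff_succ_eq_zero hs (t := t) ht
  simp only [Nat.add_sub_cancel] at hs h0
  have ht' := ht
  rw [Nat.succ_mul] at ht'
  rw [smallA, hN t ht, hm t (by omega), h0, Nat.add_sub_cancel, hs (t - ℓ) (by omega)]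
  ring

end FiniteCalculus

/-! ### Transport along isomorphisms of sections. -/

section Transport

variable {k : Type*} [Field k] {n n' : ℕ} {X : Set (ℙ k (Fin n → k))}
  {Q : Submodule k (Fin n → k)} {Y : Set (ℙ k (Fin n' → k))} {φ : Q ≃ₗ[k] (Fin n' → k)}

theorem CarriesSection.tangent_mem (hφ : CarriesSection X Q Y φ) (v : Q) {u : Fin n' → k}
    (hu : u ∈ coneTangent Y (φ v)) : (φ.symm u : Fin n → k) ∈ coneTangent X v := by
  rw [coneTangent_eq] at hu ⊢
  have := map_mem_tangentSpace (S' := affineCone X)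
    (Q.subtype.comp φ.symm.toLinearMap) 0 (fun z hz => ?_) hu
  · simpa using this
  · rw [add_zero]
    exact (hφ (φ.symm z)).2 (by simpa using hz)

theorem exists_linear_extension (φ : Q ≃ₗ[k] (Fin n' → k)) :
    ∃ π : (Fin n → k) →ₗ[k] (Fin n' → k), ∀ v : Q, π v = φ v := by
  obtain ⟨π, hπ⟩ := LinearMap.exists_extend φ.toLinearMap
  exact ⟨π, fun v => LinearMap.congr_fun hπ v⟩

theorem CarriesSection.finrank_tangent_planeSection_le (hφ : CarriesSection X Q Y φ) (v : Q)
    (hQ : coneTangent (planeSection X Q) v ≤ Q) :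
    Module.finrank k (coneTangent (planeSection X Q) v) ≤
      Module.finrank k (coneTangent Y (φ v)) := by
  obtain ⟨π, hπ⟩ := exists_linear_extension φ
  have hmaps : ∀ w ∈ coneTangent (planeSection X Q) v, π w ∈ coneTangent Y (φ v) := by
    intro w hw
    rw [coneTangent_eq] at hw ⊢
    have := map_mem_tangentSpace (S' := affineCone Y) π 0 (fun z hz => ?_) hw
    · rwa [add_zero, hπ] at this
    · rw [affineCone_planeSection] at hz
      rw [add_zero, hπ ⟨z, hz.2⟩]
      exact (hφ _).1 hz.1
  refine LinearMap.finrank_le_finrank_of_injective (f := π.restrict hmaps) ?_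
  intro a b hab
  have h1 : π a = π b := congrArg Subtype.val hab
  rw [hπ ⟨a, hQ a.2⟩, hπ ⟨b, hQ b.2⟩, φ.injective.eq_iff] at h1
  have h2 : (a : Fin n → k) = b := by simpa using h1
  exact Subtype.ext h2

theorem CarriesSection.isIrr (hφ : CarriesSection X Q Y φ)
    (hY : IsIrr (k := k) (affineCone Y)) : IsIrr (k := k) (affineCone X ∩ Q) := by
  have : affineCone X ∩ Q = (Q.subtype.comp φ.symm.toLinearMap) '' affineCone Y := by
    ext v
    constructor
    · rintro ⟨hv, hQ⟩
      exact ⟨φ ⟨v, hQ⟩, (hφ ⟨v, hQ⟩).1 hv, by simp⟩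
    · rintro ⟨u, hu, rfl⟩
      exact ⟨(hφ (φ.symm u)).2 (by simpa using hu), (φ.symm u).2⟩
  rw [this]
  exact hY.image (isPolyMap_linear _)

theorem CarriesSection.generic (hφ : CarriesSection X Q Y φ) {R : (Fin n' → k) → Prop}
    (h : Generic k (affineCone Y) R) :
    Generic k (affineCone X ∩ Q) fun v => ∀ hv : v ∈ Q, R (φ ⟨v, hv⟩) := by
  obtain ⟨π, hπ⟩ := exists_linear_extension φ
  have := h.comap (S := affineCone X ∩ Q) (isPolyMap_linear π) (fun u hu => ?_) (fun v hv => ?_)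
  · refine this.mono fun v _ hR hv => ?_
    rwa [hπ ⟨v, hv⟩] at hR
  · refine ⟨φ.symm u, ⟨(hφ _).2 (by simpa using hu), (φ.symm u).2⟩, ?_⟩
    rw [hπ]; simp
  · rw [hπ ⟨v, hv.2⟩]
    exact (hφ _).1 hv.1

end Transport

/-! ### Matching labels of planes under an isomorphism. -/

section Planes

variable {k : Type*} [Field k] {n n' i i' : ℕ} {J : Finset (Fin i)}
  {U : Fin i → Submodule k (Fin n → k)} {Q : Submodule k (Fin n → k)}
  {U' : Fin i' → Submodule k (Fin n' → k)} {φ : Q ≃ₗ[k] (Fin n' → k)}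
  {σ : {j : Fin i // j ∈ J} → Fin i'}

/-- The labels carried by `σ` into `I`. -/
def labelPreimage (σ : {j : Fin i // j ∈ J} → Fin i') (I : Finset (Fin i')) : Finset (Fin i) :=
  (Finset.univ.filter fun j => σ j ∈ I).map (Function.Embedding.subtype _)

theorem mem_labelPreimage {I : Finset (Fin i')} {j : Fin i} :
    j ∈ labelPreimage σ I ↔ ∃ hj : j ∈ J, σ ⟨j, hj⟩ ∈ I := by
  simp [labelPreimage]

theorem map_labelPreimage (hσ : Function.Injective σ) {I : Finset (Fin i')}
    (hI : I ⊆ Finset.univ.map ⟨σ, hσ⟩) :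
    (Finset.univ.filter fun j => σ j ∈ I).map ⟨σ, hσ⟩ = I := by
  ext a
  simp only [Finset.mem_map, Finset.mem_filter, Finset.mem_univ, true_and,
    Function.Embedding.coeFn_mk]
  constructor
  · rintro ⟨j, hj, rfl⟩; exact hj
  · intro ha
    obtain ⟨j, -, rfl⟩ := Finset.mem_map.1 (hI ha)
    exact ⟨j, ha, rfl⟩

theorem card_labelPreimage (hσ : Function.Injective σ) {I : Finset (Fin i')}
    (hI : I ⊆ Finset.univ.map ⟨σ, hσ⟩) : (labelPreimage σ I).card = I.card := by
  conv_rhs => rw [← map_labelPreimage hσ hI]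
  rw [labelPreimage, Finset.card_map, Finset.card_map]

theorem labelPreimage_injOn (hσ : Function.Injective σ) {I I' : Finset (Fin i')}
    (hI : I ⊆ Finset.univ.map ⟨σ, hσ⟩) (hI' : I' ⊆ Finset.univ.map ⟨σ, hσ⟩)
    (h : labelPreimage σ I = labelPreimage σ I') : I = I' := by
  rw [← map_labelPreimage hσ hI, ← map_labelPreimage hσ hI']
  congr 1
  exact Finset.map_injective _ h

theorem mem_plane_iff
    (hU : ∀ j, ((U j.1).comap Q.subtype).map (φ : Q →ₗ[k] (Fin n' → k)) = U' (σ j))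
    (j : {j : Fin i // j ∈ J}) (v : Q) :
    (v : Fin n → k) ∈ U j.1 ↔ φ v ∈ U' (σ j) := by
  rw [← hU j, Submodule.mem_map]
  constructor
  · intro h
    exact ⟨v, h, rfl⟩
  · rintro ⟨w, hw, hwv⟩
    obtain rfl : w = v := φ.injective hwv
    exact hw

theorem mem_iInf_labelPreimage_iff
    (hU : ∀ j, ((U j.1).comap Q.subtype).map (φ : Q →ₗ[k] (Fin n' → k)) = U' (σ j))
    (hσ : Function.Injective σ) {I : Finset (Fin i')}
    (hI : I ⊆ Finset.univ.map ⟨σ, hσ⟩) (v : Q) :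
    (v : Fin n → k) ∈ (⨅ j ∈ labelPreimage σ I, U j) ↔ φ v ∈ ⨅ j ∈ I, U' j := by
  simp only [Submodule.mem_iInf, mem_labelPreimage]
  constructor
  · intro h a ha
    obtain ⟨j, -, rfl⟩ := Finset.mem_map.1 (hI ha)
    exact (mem_plane_iff hU j v).1 (h j.1 ⟨j.2, ha⟩)
  · rintro h j ⟨hj, hjI⟩
    exact (mem_plane_iff hU ⟨j, hj⟩ v).2 (h _ hjI)

theorem symm_mem_iSup
    (hU : ∀ j, ((U j.1).comap Q.subtype).map (φ : Q →ₗ[k] (Fin n' → k)) = U' (σ j))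
    (hσ : Function.Injective σ) {J' : Finset (Fin i)} {u : Fin n' → k}
    (hu : u ∈ ⨆ j ∈ (Finset.univ.filter fun j : {j // j ∈ J} => j.1 ∈ J').map ⟨σ, hσ⟩, U' j) :
    (φ.symm u : Fin n → k) ∈ ⨆ j ∈ J', U j := by
  suffices h : (⨆ j ∈ (Finset.univ.filter fun j : {j // j ∈ J} => j.1 ∈ J').map ⟨σ, hσ⟩, U' j) ≤
      (⨆ j ∈ J', U j).comap (Q.subtype.comp φ.symm.toLinearMap) from h hu
  refine iSup₂_le fun a ha u hu => ?_
  obtain ⟨j, hj, rfl⟩ := Finset.mem_map.1 ha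
  have h1 := (mem_plane_iff hU j (φ.symm u)).2 (by simpa using hu)
  exact Submodule.mem_iSup_of_mem j.1 (Submodule.mem_iSup_of_mem (by simpa using hj) h1)

end Planes

/-! ### Dimensions in distributive lattices of subspaces. -/

section DistributiveLattice

variable {k V : Type*} [Field k] [AddCommGroup V] [Module k V]

theorem iInf_mem_latticeClosure {ι : Type*} {U : ι → Submodule k V} {S : Set (Submodule k V)}
    (hU : ∀ j, U j ∈ latticeClosure S) {I : Finset ι} (hI : I.Nonempty) :
    (⨅ j ∈ I, U j) ∈ latticeClosure S := by
  classical
  induction hI using Finset.Nonempty.cons_induction with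
  | singleton a => simpa using hU a
  | cons a s ha hs ih =>
    rw [Finset.cons_eq_insert, Finset.iInf_insert]
    exact isSublattice_latticeClosure.infClosed (hU a) ih

theorem iSup_mem_latticeClosure {ι : Type*} {U : ι → Submodule k V} {S : Set (Submodule k V)}
    (hU : ∀ j, U j ∈ latticeClosure S) {I : Finset ι} (hI : I.Nonempty) :
    (⨆ j ∈ I, U j) ∈ latticeClosure S := by
  classical
  induction hI using Finset.Nonempty.cons_induction with
  | singleton a => simpa using hU a
  | cons a s ha hs ih =>
    rw [Finset.cons_eq_insert, Finset.iSup_insert]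
    exact isSublattice_latticeClosure.supClosed (hU a) ih

theorem GeneratesDistributive.inf_iSup {ι : Type*} {U : ι → Submodule k V}
    {S : Set (Submodule k V)} (hS : GeneratesDistributive S) (hU : ∀ j, U j ∈ latticeClosure S)
    {A : Submodule k V} (hA : A ∈ latticeClosure S) (I : Finset ι) :
    A ⊓ (⨆ j ∈ I, U j) = ⨆ j ∈ I, A ⊓ U j := by
  classical
  induction I using Finset.induction_on with
  | empty => simp
  | insert a s ha ih =>
    rw [Finset.iSup_insert, Finset.iSup_insert, ← ih]
    rcases s.eq_empty_or_nonempty with rfl | hs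
    · simp
    · exact hS A hA _ (hU a) _ (iSup_mem_latticeClosure hU hs)

variable [FiniteDimensional k V] {ℓ : ℕ} {N : ℕ → ℕ} {t i : ℕ} {W : Submodule k V}
  {U : Fin i → Submodule k V}

/-- Inclusion-exclusion in a distributive lattice of subspaces. -/
theorem IsNLattice.finrank_inf_iSup (h : IsNLattice ℓ N t W U) (I J : Finset (Fin i))
    (hIJ : Disjoint I J) :
    (Module.finrank k ↥((W ⊓ ⨅ j ∈ I, U j) ⊓ ⨆ j ∈ J, U j) : ℤ) =
      N (t - I.card * ℓ) - bdiff ℓ J.card (fun u => (N u : ℤ)) (t - I.card * ℓ) := by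
  classical
  obtain ⟨hle, hdist, hdim⟩ := h
  have hmem : ∀ j, U j ∈ latticeClosure (Set.range U) :=
    fun j => subset_latticeClosure ⟨j, rfl⟩
  induction J using Finset.induction_on generalizing I with
  | empty => simp [bdiff]
  | insert r J hr ih =>
    obtain ⟨hrI, hIJ'⟩ := Finset.disjoint_insert_right.1 hIJ
    set B := W ⊓ ⨅ j ∈ I, U j with hB
    set S := ⨆ j ∈ J, U j with hS
    have hSW : S ≤ W := iSup₂_le fun j _ => hle j
    -- For empty I the space B is W, which need not belong to the generated lattice; then every
    -- intersection with B is trivial.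
    have hd : B ⊓ (U r ⊔ S) = (B ⊓ U r) ⊔ (B ⊓ S) := by
      rcases J.eq_empty_or_nonempty with rfl | hJ
      · simp [hS]
      rcases I.eq_empty_or_nonempty with rfl | hI
      · have hBW : B = W := by simp [hB]
        rw [hBW, inf_eq_right.2 (sup_le (hle r) hSW), inf_eq_right.2 (hle r),
          inf_eq_right.2 hSW]
      · have hBI : B = ⨅ j ∈ I, U j := by
          obtain ⟨a, ha⟩ := hI
          exact inf_eq_right.2 ((iInf₂_le a ha).trans (hle a))
        rw [hBI]
        exact hdist _ (iInf_mem_latticeClosure hmem hI) _ (hmem r) _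
          (iSup_mem_latticeClosure hmem hJ)
    have hBr : B ⊓ U r = W ⊓ ⨅ j ∈ insert r I, U j := by
      rw [Finset.iInf_insert, hB, inf_assoc, inf_comm (⨅ j ∈ I, U j)]
    have h1 := ih I hIJ'
    have h2 := ih (insert r I) (Finset.disjoint_insert_left.2 ⟨hr, hIJ'⟩)
    have h3 := hdim (insert r I)
    rw [← hBr] at h2 h3
    have hinf : (B ⊓ U r) ⊓ (B ⊓ S) = (B ⊓ U r) ⊓ S := by
      apply le_antisymm
      · exact le_inf inf_le_left (inf_le_right.trans inf_le_right)
      · exact le_inf inf_le_left (le_inf (inf_le_left.trans inf_le_left) inf_le_right)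
    have h4 := Submodule.finrank_sup_add_finrank_inf_eq (B ⊓ U r) (B ⊓ S)
    rw [← hd, hinf] at h4
    rw [Finset.iSup_insert, ← hS]
    rw [Finset.card_insert_of_notMem hrI] at h2 h3
    have hsub : t - (I.card + 1) * ℓ = t - I.card * ℓ - ℓ := by
      rw [Nat.succ_mul, Nat.sub_sub]
    rw [hsub] at h2 h3
    rw [Finset.card_insert_of_notMem hr, bdiff_succ]
    rw [← hB] at h1
    omega

theorem IsNLattice.finrank_iSup (h : IsNLattice ℓ N t W U) :
    (Module.finrank k ↥(⨆ j, U j) : ℤ) = N t - bdiff ℓ i (fun u => (N u : ℤ)) t := by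
  have h1 := h.finrank_inf_iSup ∅ Finset.univ (Finset.disjoint_empty_left _)
  have h2 : (W ⊓ ⨅ j ∈ (∅ : Finset (Fin i)), U j) ⊓ ⨆ j ∈ (Finset.univ : Finset (Fin i)), U j =
      ⨆ j, U j := by
    simpa using h.1
  rw [h2] at h1
  simpa using h1

theorem IsNLattice.finrank_eq (h : IsNLattice ℓ N t W U) : Module.finrank k W = N t := by
  have h1 := h.2.2 ∅
  rw [show (W ⊓ ⨅ j ∈ (∅ : Finset (Fin i)), U j) = W by simp] at h1
  simpa using h1

/-- Each plane cuts T in codimension at most c, while all of I cuts it in codimension at least |I|c.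
By the dimension formula every subset J then cuts in codimension at least |J|c. For two planes,
2(m-c) - (m-2c) = m, so T is the sum of its two traces. -/
theorem le_sup_of_finrank {T : Submodule k V} {m c : ℤ} (hT : Module.finrank k T = m)
    {P : Fin i → Submodule k V} {I : Finset (Fin i)}
    (hlow : ∀ J ⊆ I, J.Nonempty → m - J.card * c ≤ Module.finrank k ↥(T ⊓ ⨅ j ∈ J, P j))
    (hup : Module.finrank k ↥(T ⊓ ⨅ j ∈ I, P j) ≤ m - I.card * c)
    {a b : Fin i} (ha : a ∈ I) (hb : b ∈ I) (hab : a ≠ b) : T ≤ P a ⊔ P b := by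
  classical
  have key : ∀ r : ℕ, ∀ J ⊆ I, I.card - J.card = r →
      (Module.finrank k ↥(T ⊓ ⨅ j ∈ J, P j) : ℤ) ≤ m - J.card * c := by
    intro r
    induction r with
    | zero =>
      intro J hJ hr
      rw [Finset.eq_of_subset_of_card_le hJ (by omega)]
      exact hup
    | succ r ih =>
      intro J hJ hr
      obtain ⟨x, hx, hxJ⟩ := Finset.exists_of_ssubset
        (Finset.ssubset_iff_subset_ne.2 ⟨hJ, by rintro rfl; omega⟩)
      have hcard := Finset.card_insert_of_notMem hxJ
      have h1 := ih (insert x J) (Finset.insert_subset hx hJ) (by omega)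
      have h2 := hlow {x} (by simpa using hx) (by simp)
      have h3 := Submodule.finrank_sup_add_finrank_inf_eq (T ⊓ ⨅ j ∈ J, P j) (T ⊓ P x)
      have h4 : (T ⊓ ⨅ j ∈ J, P j) ⊓ (T ⊓ P x) = T ⊓ ⨅ j ∈ insert x J, P j := by
        rw [Finset.iInf_insert, inf_inf_inf_comm, inf_idem, inf_comm (⨅ j ∈ J, P j)]
      have h5 : Module.finrank k ↥((T ⊓ ⨅ j ∈ J, P j) ⊔ (T ⊓ P x)) ≤ Module.finrank k T :=
        Submodule.finrank_mono (sup_le inf_le_left inf_le_left)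
      rw [h4] at h3
      rw [hcard] at h1
      rw [Finset.iInf_singleton, Finset.card_singleton] at h2
      push_cast at h1 h2
      rw [add_mul] at h1
      omega
  have h1 := hlow {a} (by simpa using ha) (by simp)
  have h2 := hlow {b} (by simpa using hb) (by simp)
  have h3 := key _ {a, b} (by intro x; simp only [Finset.mem_insert, Finset.mem_singleton];
                              rintro (rfl | rfl) <;> assumption) rfl
  have h4 := Submodule.finrank_sup_add_finrank_inf_eq (T ⊓ P a) (T ⊓ P b)
  have h5 : (T ⊓ P a) ⊓ (T ⊓ P b) = T ⊓ ⨅ j ∈ ({a, b} : Finset (Fin i)), P j := by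
    rw [Finset.iInf_insert, Finset.iInf_singleton, inf_inf_inf_comm, inf_idem]
  rw [h5] at h4
  rw [Finset.card_pair hab] at h3
  rw [Finset.iInf_singleton, Finset.card_singleton] at h1 h2
  push_cast at h1 h2 h3
  have h6 : (T ⊓ P a) ⊔ (T ⊓ P b) = T :=
    Submodule.eq_of_le_of_finrank_le (sup_le inf_le_left inf_le_left) (by omega)
  calc T = (T ⊓ P a) ⊔ (T ⊓ P b) := h6.symm
    _ ≤ P a ⊔ P b := sup_le_sup inf_le_right inf_le_right

end DistributiveLattice

/-! ### Configurations of smooth points and their spans. -/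

section Configurations

variable {k : Type*} [Field k] {n n' : ℕ}

/-- There are smooth points of the cone over `X`, one in each plane `Q x`, such that their tangent
spaces together with `B` span a space of dimension at least `b`. -/
def HasSpanningPoints (X : Set (ℙ k (Fin n → k))) (m : ℕ) {ι : Type*}
    (Q : ι → Submodule k (Fin n → k)) (B : Submodule k (Fin n → k)) (b : ℤ) : Prop :=
  ∃ z : ι → Fin n → k, (∀ x, z x ∈ affineCone X ∩ Q x) ∧
    (∀ x, Module.finrank k (coneTangent X (z x)) = m) ∧
    b ≤ Module.finrank k ↥(B ⊔ ⨆ x, coneTangent X (z x))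

variable {X : Set (ℙ k (Fin n → k))} {m : ℕ} {ι ι' : Type*} {Q : ι → Submodule k (Fin n → k)}
  {B : Submodule k (Fin n → k)} {b : ℤ}

/-- The old points still lie in the larger planes, and additional smooth points can only enlarge the
span. -/
theorem HasSpanningPoints.mono {Q' : ι' → Submodule k (Fin n → k)} {b' : ℤ}
    (h : HasSpanningPoints X m Q B b)
    (hQ' : ∀ y, ∃ v ∈ affineCone X ∩ Q' y, Module.finrank k (coneTangent X v) = m)
    (g : ι → ι') (hg : Function.Injective g) (hQ : ∀ x, Q x ≤ Q' (g x)) (hb : b' ≤ b) :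
    HasSpanningPoints X m Q' B b' := by
  classical
  obtain ⟨z, hz, hsm, hbd⟩ := h
  choose w hw hwsm using hQ'
  let z' : ι' → Fin n → k := Function.extend g z w
  have hz'g : ∀ x, z' (g x) = z x := fun x => hg.extend_apply _ _ x
  have hz'n : ∀ y, (¬ ∃ x, g x = y) → z' y = w y := fun y hy => Function.extend_apply' _ _ _ hy
  refine ⟨z', fun y => ?_, fun y => ?_, hb.trans (hbd.trans ?_)⟩
  · by_cases hy : ∃ x, g x = y
    · obtain ⟨x, rfl⟩ := hy
      rw [hz'g]
      exact ⟨(hz x).1, hQ x (hz x).2⟩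
    · rw [hz'n y hy]; exact hw y
  · by_cases hy : ∃ x, g x = y
    · obtain ⟨x, rfl⟩ := hy
      rw [hz'g]; exact hsm x
    · rw [hz'n y hy]; exact hwsm y
  · have : (B ⊔ ⨆ x, coneTangent X (z x)) ≤ B ⊔ ⨆ y, coneTangent X (z' y) := by
      refine sup_le_sup_left (iSup_le fun x => ?_) B
      rw [← hz'g x]
      exact le_iSup (fun y => coneTangent X (z' y)) (g x)
    exact_mod_cast Submodule.finrank_mono this

/-- Semicontinuity: one smooth configuration attaining the bound makes generic ones attain it. -/
theorem HasSpanningPoints.generic [CharZero k] [Finite ι] (h : HasSpanningPoints X m Q B b)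
    (hX : IsIrreducibleOfDim (affineCone X) m) :
    Generic k (Set.univ.pi fun x => affineCone X ∩ (Q x : Set (Fin n → k))) fun z =>
      (∀ x, Module.finrank k (coneTangent X (z x)) = m) ∧
        b ≤ Module.finrank k ↥(B ⊔ ⨆ x, coneTangent X (z x)) := by
  rw [HasSpanningPoints] at h
  rw [funext (coneTangent_eq X)] at h ⊢
  obtain ⟨z, hz, hsm, hbd⟩ := h
  obtain ⟨f, hf, hf0, hfz⟩ := hX.exists_nhd B (fun x => (hz x).1) hsm
  refine ⟨f, hf, ⟨z, fun x _ => hz x, hf0⟩, fun y hy hfy => ?_⟩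
  obtain ⟨h1, h2⟩ := hfz y (fun x => (hy x trivial).1) hfy
  exact ⟨h1, hbd.trans (by exact_mod_cast h2)⟩

theorem finrank_sup_add_finrank_le {Q₀ A : Submodule k (Fin n → k)}
    (φ : Q₀ ≃ₗ[k] (Fin n' → k)) {A' : Submodule k (Fin n' → k)}
    (h : ∀ u ∈ A', (φ.symm u : Fin n → k) ∈ A) :
    Module.finrank k ↥(A ⊔ Q₀) + Module.finrank k A' ≤ Module.finrank k A + n' := by
  have h2 : A'.map (Q₀.subtype.comp φ.symm.toLinearMap) ≤ A ⊓ Q₀ := by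
    rintro _ ⟨u, hu, rfl⟩
    exact ⟨h u hu, (φ.symm u).2⟩
  have h3 : Module.finrank k A' ≤ Module.finrank k ↥(A ⊓ Q₀) := by
    refine le_trans (le_of_eq ?_) (Submodule.finrank_mono h2)
    refine (LinearEquiv.finrank_eq (Submodule.equivMapOfInjective _ ?_ A'))
    exact Q₀.injective_subtype.comp φ.symm.injective
  have h4 := Submodule.finrank_sup_add_finrank_inf_eq A Q₀
  have h5 : Module.finrank k Q₀ = n' := by rw [φ.finrank_eq]; simp
  omega

theorem finrank_add_le_of_carriesSection {Y : Set (ℙ k (Fin n' → k))}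
    {B' : Submodule k (Fin n' → k)} {b' : ℤ} {Q₀ : Submodule k (Fin n → k)}
    {φ : Q₀ ≃ₗ[k] (Fin n' → k)} (hφ : CarriesSection X Q₀ Y φ)
    (hB : ∀ u ∈ B', (φ.symm u : Fin n → k) ∈ B) {z : ι → Fin n → k} {z' : ι' → Fin n' → k}
    {g : ι' → ι} (hz : ∀ y, ∃ v : Q₀, v = z (g y) ∧ φ v = z' y)
    (hb : b ≤ Module.finrank k ↥((B ⊔ Q₀) ⊔ ⨆ x, coneTangent X (z x)))
    (hb' : b' ≤ Module.finrank k ↥(B' ⊔ ⨆ y, coneTangent Y (z' y))) :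
    b + b' - n' ≤ Module.finrank k ↥(B ⊔ ⨆ x, coneTangent X (z x)) := by
  rw [sup_right_comm] at hb
  have hmem : ∀ u ∈ B' ⊔ ⨆ y, coneTangent Y (z' y),
      (φ.symm u : Fin n → k) ∈ B ⊔ ⨆ x, coneTangent X (z x) := by
    intro u hu
    suffices hle : (B' ⊔ ⨆ y, coneTangent Y (z' y)) ≤
        (B ⊔ ⨆ x, coneTangent X (z x)).comap (Q₀.subtype.comp φ.symm.toLinearMap) from hle hu
    refine sup_le (fun u hu => Submodule.mem_sup_left (hB u hu)) (iSup_le fun y u hu => ?_)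
    refine Submodule.mem_sup_right (Submodule.mem_iSup_of_mem (g y) ?_)
    obtain ⟨v, hv, hv'⟩ := hz y
    rw [← hv'] at hu
    rw [← hv]
    exact hφ.tangent_mem v hu
  have h2 := finrank_sup_add_finrank_le φ hmem
  zify at h2
  linarith

/-- Adding up the contributions of a plane `Q₀` and of the quotient by it. -/
theorem HasSpanningPoints.glue [CharZero k] [Finite ι] [Finite ι']
    {Y : Set (ℙ k (Fin n' → k))} {m' : ℕ} {Q' : ι' → Submodule k (Fin n' → k)}
    {B' : Submodule k (Fin n' → k)} {b' : ℤ} {Q₀ : Submodule k (Fin n → k)}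
    {φ : Q₀ ≃ₗ[k] (Fin n' → k)}
    (h : HasSpanningPoints X m Q (B ⊔ Q₀) b) (h' : HasSpanningPoints Y m' Q' B' b')
    (hX : IsIrreducibleOfDim (affineCone X) m) (hY : IsIrreducibleOfDim (affineCone Y) m')
    (hφ : CarriesSection X Q₀ Y φ)
    (hirr : ∀ x, IsIrr (k := k) (affineCone X ∩ (Q x : Set (Fin n → k))))
    (g : ι' → ι) (hg : Function.Injective g) (hgQ₀ : ∀ y, Q (g y) ≤ Q₀)
    (hgQ : ∀ y, ∀ v : Q₀, (v : Fin n → k) ∈ Q (g y) ↔ φ v ∈ Q' y)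
    (hB : ∀ u ∈ B', (φ.symm u : Fin n → k) ∈ B) :
    HasSpanningPoints X m Q B (b + b' - n') := by
  classical
  obtain ⟨π, hπ⟩ := exists_linear_extension φ
  have hgen := h.generic hX
  have hgen' := h'.generic hY
  choose w hw using fun x => (hirr x).1
  have hpoly : IsPolyMap k fun (z : ι → Fin n → k) (y : ι') => π (z (g y)) :=
    isPolyMap_linear (LinearMap.pi fun y => π.comp
      (LinearMap.proj (R := k) (φ := fun _ : ι => Fin n → k) (g y)))
  have hsurj : ∀ u ∈ Set.univ.pi fun y => affineCone Y ∩ (Q' y : Set (Fin n' → k)),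
      ∃ z ∈ Set.univ.pi fun x => affineCone X ∩ (Q x : Set (Fin n → k)),
        (fun y => π (z (g y))) = u := by
    intro u hu
    refine ⟨Function.extend g (fun y => (φ.symm (u y) : Fin n → k)) w, fun x _ => ?_, ?_⟩
    · by_cases hx : ∃ y, g y = x
      · obtain ⟨y, rfl⟩ := hx
        rw [hg.extend_apply]
        refine ⟨(hφ _).2 (by simpa using (hu y trivial).1), ?_⟩
        exact (hgQ y _).2 (by simpa using (hu y trivial).2)
      · rw [Function.extend_apply' _ _ _ hx]
        exact hw x
    · funext y
      simp only [hg.extend_apply, hπ, LinearEquiv.apply_symm_apply]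
  have hmaps : ∀ z ∈ Set.univ.pi fun x => affineCone X ∩ (Q x : Set (Fin n → k)),
      (fun y => π (z (g y))) ∈
        Set.univ.pi fun y => affineCone Y ∩ (Q' y : Set (Fin n' → k)) := by
    intro z hz y _
    have h1 := hz (g y) trivial
    have h2 : π (z (g y)) = _ := hπ ⟨z (g y), hgQ₀ y h1.2⟩
    dsimp only
    rw [h2]
    exact ⟨(hφ _).1 h1.1, (hgQ y _).1 h1.2⟩
  -- Restricting a configuration to the labels `g y` maps onto configurations of Y, so the generic
  -- bound on Y pulls back. Irreducibility of the product gives one z satisfying both bounds.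
  obtain ⟨z, hz, ⟨hsm, hb⟩, -, hb'⟩ :=
    (hgen.and (IsIrr.pi hirr) (hgen'.comap hpoly hsurj hmaps)).exists
  refine ⟨z, fun x => hz x trivial, hsm, ?_⟩
  exact finrank_add_le_of_carriesSection (g := g) hφ hB (fun y =>
    ⟨⟨z (g y), hgQ₀ y (hz (g y) trivial).2⟩, rfl, (hπ _).symm⟩) hb hb'

end Configurations

/-! ### Clean sections and positivity of the cone dimension. -/

section Sections

variable {k : Type*} [Field k] {n : ℕ} {X : Set (ℙ k (Fin n → k))}

theorem IsCleanSection.generic {Q : Submodule k (Fin n → k)} (h : IsCleanSection X Q) {m : ℕ}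
    (hm : projDim X = (m : ℤ) - 1) :
    Generic k (affineCone X ∩ (Q : Set (Fin n → k))) fun v =>
      Module.finrank k (coneTangent X v) = m ∧
        coneTangent (planeSection X Q) v = coneTangent X v ⊓ Q := by
  rw [IsCleanSection, holdsGenerically_iff, affineCone_planeSection] at h
  have h1 := Generic.comap (S := affineCone X ∩ (Q : Set (Fin n → k)))
    (S' := Set.univ.pi fun _ : Unit => affineCone X ∩ (Q : Set (Fin n → k)))
    (isPolyMap_linear (LinearMap.pi fun _ : Unit => LinearMap.id))
    (fun u hu => ⟨u (), hu () trivial, rfl⟩) (fun v hv _ _ => hv) h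
  refine h1.mono fun v _ hv => ⟨?_, hv.2⟩
  have := hv.1
  rw [hm] at this
  have h2 : (Module.finrank k (coneTangent X v) : ℤ) = (m : ℤ) - 1 + 1 := this
  rw [sub_add_cancel] at h2
  exact_mod_cast h2

/-- The line z ↦ zv lies in the cone and has velocity v at z = 1. Infinitude of k ensures that no
nonzero equation vanishes on the parameter line. -/
theorem self_mem_coneTangent [Infinite k] {v : Fin n → k} (hv : v ∈ affineCone X) :
    v ∈ coneTangent X v := by
  rw [coneTangent_eq]
  have := map_mem_tangentSpace (k := k) (S := (Set.univ : Set (Unit → k))) (S' := affineCone X)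
    (z := fun _ => 1) (w := fun _ => 1) ((LinearMap.proj ()).smulRight v) 0 (fun z _ => ?_) ?_
  · simpa using this
  · simpa using smul_mem_affineCone hv (z ())
  · rw [mem_tangentSpace]
    intro f hf
    have hf0 : f = 0 := MvPolynomial.funext fun z => by
      rw [map_zero]
      exact eval_eq_zero_of_mem_vanishingIdeal hf trivial
    simp [hf0, gradient]

/-- A generic cone vector is nonzero and lies in its own tangent space, whose dimension is m. This
excludes division by zero in ⌈N/m⌉. -/
theorem IsProjectiveVariety.one_le [CharZero k] (hX : IsProjectiveVariety X) {m : ℕ}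
    (hm : projDim X = (m : ℤ) - 1) : 1 ≤ m := by
  have hirr := hX.isIrreducibleOfDim hm
  obtain ⟨p, hp⟩ := hX.1
  have hv : p.rep ∈ affineCone X := fun h => by rwa [Projectivization.mk_rep]
  obtain ⟨i, hi⟩ : ∃ i, p.rep i ≠ 0 := Function.ne_iff.1 p.rep_nonzero
  have hgen : Generic k (affineCone X) fun v => v i ≠ 0 :=
    ⟨fun v => v i, dual_mem_polyFun (LinearMap.proj (R := k) (φ := fun _ : Fin n => k) i),
      ⟨p.rep, hv, hi⟩, fun v _ h => h⟩
  obtain ⟨v, hvX, h1, h2⟩ := (hirr.generic_smooth.and hirr.isIrr hgen).exists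
  rw [← h1, ← coneTangent_eq]
  refine Submodule.one_le_finrank_iff.2 fun h => h2 ?_
  have := self_mem_coneTangent hvX
  rw [h, Submodule.mem_bot] at this
  rw [this]; rfl

end Sections

/-! ### Label sets and numbering of the points. -/

section Index

variable {ℓ K₀ : ℕ}

theorem kay_eq (hℓ : 1 ≤ ℓ) {t : ℕ} (ht : K₀ * ℓ < t) : kay ℓ K₀ t = K₀ :=
  le_antisymm (min_le_right _ _) ((le_kay_iff hℓ (by omega) _).2 ⟨le_rfl, ht⟩)

theorem card_le_and_mul_lt (hℓ : 1 ≤ ℓ) {t : ℕ} (ht : 1 ≤ t) (I : Finset (Fin (kay ℓ K₀ t))) :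
    I.card ≤ K₀ ∧ I.card * ℓ < t :=
  (le_kay_iff hℓ ht _).1 (by simpa using I.card_le_univ)

theorem lt_of_nonempty (hℓ : 1 ≤ ℓ) {t : ℕ} (ht : 1 ≤ t) {I : Finset (Fin (kay ℓ K₀ t))}
    (hI : I.Nonempty) : ℓ < t :=
  lt_of_le_of_lt (Nat.le_mul_of_pos_left ℓ hI.card_pos) (card_le_and_mul_lt hℓ ht I).2

/-- Labels of the points of the configuration attached to the planes with labels in `L`. -/
abbrev LabelIndex (ℓ K₀ : ℕ) (s : ℕ → ℤ) (t : ℕ) (L : Finset (Fin (kay ℓ K₀ t))) : Type :=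
  {x : Finset (Fin (kay ℓ K₀ t)) × ℕ //
    x.1 ⊆ L ∧ (x.2 : ℤ) < bdiff ℓ (L.card - x.1.card) s (t - x.1.card * ℓ)}

instance (s : ℕ → ℤ) (t : ℕ) (L : Finset (Fin (kay ℓ K₀ t))) :
    Finite (LabelIndex ℓ K₀ s t L) := by
  let f : LabelIndex ℓ K₀ s t L →
      Σ I : Finset (Fin (kay ℓ K₀ t)), Fin (bdiff ℓ (L.card - I.card) s (t - I.card * ℓ)).toNat :=
    fun x => ⟨x.1.1, x.1.2, by have := x.2.2; omega⟩
  refine Finite.of_injective f fun x y hxy => ?_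
  have h := congrArg (fun z => (z.1, z.2.val)) hxy
  exact Subtype.ext h

end Index

/-! ### Forgetting labels and removing planes. -/

section Family

variable {k : Type*} [Field k] [CharZero k] {ℓ K₀ : ℕ} {N m : ℕ → ℕ}
  {X : (t : ℕ) → Set (ℙ k (Fin (N t) → k))}
  {P : (t : ℕ) → Fin (kay ℓ K₀ t) → Submodule k (Fin (N t) → k)}
  {P' : (t : ℕ) → Submodule k (Fin (N t) → k)}

theorem IsFamily.isIrreducibleOfDim (hX : IsFamily N m X) {t : ℕ} (ht : 1 ≤ t) :
    IsIrreducibleOfDim (affineCone (X t)) (m t) :=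
  (hX t ht).1.isIrreducibleOfDim (hX t ht).2

theorem IsBOLattice.isIrr (hP : IsBOLattice ℓ K₀ N X P P') (hℓ : 1 ≤ ℓ) (hX : IsFamily N m X)
    {t : ℕ} (ht : 1 ≤ t) (I : Finset (Fin (kay ℓ K₀ t))) :
    IsIrr (k := k) (affineCone (X t) ∩ (↑(⨅ j ∈ I, P t j) : Set (Fin (N t) → k))) := by
  rcases I.eq_empty_or_nonempty with rfl | hI
  · simpa using (hX.isIrreducibleOfDim ht).isIrr
  · obtain ⟨φ, hφ, -⟩ := hP.iso t (lt_of_nonempty hℓ ht hI) I hI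
    have h1 := (card_le_and_mul_lt hℓ ht I).2
    exact hφ.isIrr (hX.isIrreducibleOfDim (by omega)).isIrr

theorem IsBOLattice.generic_smooth (hP : IsBOLattice ℓ K₀ N X P P') (hℓ : 1 ≤ ℓ)
    (hX : IsFamily N m X) {t : ℕ} (ht : 1 ≤ t) (I : Finset (Fin (kay ℓ K₀ t))) :
    Generic k (affineCone (X t) ∩ (↑(⨅ j ∈ I, P t j) : Set (Fin (N t) → k))) fun v =>
      Module.finrank k (coneTangent (X t) v) = m t := by
  rcases I.eq_empty_or_nonempty with rfl | hI
  · have := (hX.isIrreducibleOfDim ht).generic_smooth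
    rw [show (affineCone (X t) ∩ (↑(⨅ j ∈ (∅ : Finset _), P t j) : Set (Fin (N t) → k))) =
      affineCone (X t) by simp]
    rw [funext (coneTangent_eq (X t))]
    exact this
  · exact ((hP.clean t (lt_of_nonempty hℓ ht hI) I hI).generic (hX t ht).2).mono
      fun v _ hv => hv.1

theorem IsBOLattice.exists_smooth (hP : IsBOLattice ℓ K₀ N X P P') (hℓ : 1 ≤ ℓ)
    (hX : IsFamily N m X) {t : ℕ} (ht : 1 ≤ t) (I : Finset (Fin (kay ℓ K₀ t))) :
    ∃ v ∈ affineCone (X t) ∩ (↑(⨅ j ∈ I, P t j) : Set (Fin (N t) → k)),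
      Module.finrank k (coneTangent (X t) v) = m t :=
  (hP.generic_smooth hℓ hX ht I).exists

/-- Smooth points of the cone over `X t`, as many as prescribed by `s` on the planes with labels
in `L`, span together with the planes with labels in `J` a space of dimension at least
`b |J| t`. -/
def ConfigurationSpans (m : ℕ → ℕ) (X : (t : ℕ) → Set (ℙ k (Fin (N t) → k)))
    (P : (t : ℕ) → Fin (kay ℓ K₀ t) → Submodule k (Fin (N t) → k)) (s : ℕ → ℤ) (b : ℕ → ℕ → ℤ)
    (t : ℕ) (L J : Finset (Fin (kay ℓ K₀ t))) : Prop :=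
  HasSpanningPoints (X t) (m t) (fun x : LabelIndex ℓ K₀ s t L => ⨅ j ∈ x.1.1, P t j)
    (⨆ j ∈ J, P t j) (b J.card t)

variable {s : ℕ → ℤ} {b : ℕ → ℕ → ℤ}

/-- The points stay in place: one on P_{I∪r} is also one on P_I, and ∇^{d+1}s(u) + ∇^d s(u-ℓ) = ∇^d
s(u) is exactly the number now required there. -/
theorem ConfigurationSpans.erase_label (hP : IsBOLattice ℓ K₀ N X P P') (hℓ : 1 ≤ ℓ)
    (hX : IsFamily N m X) (hs : ∀ j ≤ K₀, ∀ u, j * ℓ < u → 0 ≤ bdiff ℓ j s u)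
    {t : ℕ} (ht : 1 ≤ t) {L J : Finset (Fin (kay ℓ K₀ t))}
    (h : ConfigurationSpans m X P s b t L J) {r : Fin (kay ℓ K₀ t)} (hr : r ∈ L) :
    ConfigurationSpans m X P s b t (L.erase r) J := by
  classical
  obtain ⟨hL₀, hLt⟩ := card_le_and_mul_lt hℓ ht L
  have hLe : (L.erase r).card + 1 = L.card := Finset.card_erase_add_one hr
  have split : ∀ I ⊆ L.erase r, bdiff ℓ ((L.erase r).card - I.card) s (t - I.card * ℓ) =
      bdiff ℓ (L.card - I.card) s (t - I.card * ℓ) +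
        bdiff ℓ (L.card - (I.card + 1)) s (t - (I.card + 1) * ℓ) ∧
      0 ≤ bdiff ℓ (L.card - I.card) s (t - I.card * ℓ) ∧
        0 ≤ bdiff ℓ (L.card - (I.card + 1)) s (t - (I.card + 1) * ℓ) := by
    intro I hI
    have hcard := Finset.card_le_card hI
    obtain ⟨d, hd⟩ := Nat.exists_eq_add_of_le hcard
    have e1 : (L.erase r).card - I.card = d := by omega
    have e2 : L.card - I.card = d + 1 := by omega
    have e3 : L.card - (I.card + 1) = d := by omega
    have e4 : t - (I.card + 1) * ℓ = t - I.card * ℓ - ℓ := by rw [Nat.succ_mul, Nat.sub_sub]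
    have e5 : L.card * ℓ = I.card * ℓ + (d * ℓ + ℓ) := by
      rw [← hLe, hd]; ring
    rw [e1, e2, e3, e4, bdiff_succ]
    refine ⟨by ring, ?_, hs d (by omega) _ (by omega)⟩
    rw [← bdiff_succ]
    exact hs _ (by omega) _ (by rw [Nat.succ_mul]; omega)
  -- Labels containing r lose it, and their points are numbered after those already on the smaller
  -- label set.
  refine h.mono (fun y => hP.exists_smooth hℓ hX ht _)
    (fun x => if hx : r ∈ x.1.1 then ⟨(x.1.1.erase r, x.1.2 +
        (bdiff ℓ (L.card - (x.1.1.erase r).card) s (t - (x.1.1.erase r).card * ℓ)).toNat),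
          Finset.erase_subset_erase r x.2.1, ?_⟩
      else ⟨x.1, fun a ha => Finset.mem_erase.2 ⟨fun e => hx (e ▸ ha), x.2.1 ha⟩, ?_⟩)
    (fun x y hxy => ?_) (fun x => ?_) le_rfl
  · obtain ⟨h1, h2, h3⟩ := split _ (Finset.erase_subset_erase r x.2.1)
    have h4 := x.2.2
    rw [← Finset.card_erase_add_one hx] at h4
    dsimp only
    rw [h1]
    push_cast
    omega
  · obtain ⟨h1, h2, h3⟩ := split x.1.1
      fun a ha => Finset.mem_erase.2 ⟨fun e => hx (e ▸ ha), x.2.1 ha⟩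
    have h4 := x.2.2
    omega
  · have key : ∀ x y : LabelIndex ℓ K₀ s t L, r ∈ x.1.1 → r ∉ y.1.1 → x.1.1.erase r = y.1.1 →
        x.1.2 + (bdiff ℓ (L.card - (x.1.1.erase r).card) s
          (t - (x.1.1.erase r).card * ℓ)).toNat = y.1.2 → False := by
      intro x y hx hy h1 h2
      have h3 := y.2.2
      rw [← h1, ← h2] at h3
      push_cast at h3
      omega
    apply Subtype.ext
    dsimp only at hxy
    split_ifs at hxy with hx hy hy
    · have h1 := congrArg Subtype.val hxy
      obtain ⟨h2, h3⟩ := Prod.ext_iff.1 h1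
      dsimp only at h2 h3
      rw [h2, Nat.add_right_cancel_iff] at h3
      refine Prod.ext ?_ h3
      rw [← Finset.insert_erase hx, ← Finset.insert_erase hy, h2]
    · obtain ⟨h2, h3⟩ := Prod.ext_iff.1 (congrArg Subtype.val hxy)
      exact (key x y hx hy h2 h3).elim
    · obtain ⟨h2, h3⟩ := Prod.ext_iff.1 (congrArg Subtype.val hxy)
      exact (key y x hy hx h2.symm h3.symm).elim
    · simpa using hxy
  · split_ifs with hx
    · exact biInf_mono fun j hj => Finset.mem_of_mem_erase hj
    · exact le_rfl

/-- Points whose label contains i lie on P_i and form a configuration on X(t-ℓ). Gluing it to the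
span modulo P_i gives the bound without P_i. -/
theorem ConfigurationSpans.of_insert_plane (hP : IsBOLattice ℓ K₀ N X P P') (hℓ : 1 ≤ ℓ)
    (hX : IsFamily N m X)
    (hb : ∀ j t, j + 1 ≤ K₀ → (j + 1) * ℓ < t →
      b j t ≤ b (j + 1) t + b j (t - ℓ) - N (t - ℓ))
    {t : ℕ} (ht : 1 ≤ t) {J : Finset (Fin (kay ℓ K₀ t))} {i : Fin (kay ℓ K₀ t)} (hi : i ∉ J)
    (h : ConfigurationSpans m X P s b t Finset.univ (insert i J))
    (h' : ∀ L' J', ConfigurationSpans m X P s b (t - ℓ) L' J') :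
    ConfigurationSpans m X P s b t Finset.univ J := by
  classical
  have hlt : ℓ < t := lt_of_nonempty hℓ ht (Finset.singleton_nonempty i)
  obtain ⟨φ, hφ, σ, hσ, hU⟩ := hP.iso t hlt {i} (Finset.singleton_nonempty i)
  have hbJ : b J.card t ≤ b (insert i J).card t + b J.card (t - ℓ) - N (t - ℓ) := by
    have h1 := card_le_and_mul_lt hℓ ht (insert i J)
    rw [Finset.card_insert_of_notMem hi] at h1 ⊢
    exact hb _ _ h1.1 h1.2
  have e : t - ({i} : Finset (Fin (kay ℓ K₀ t))).card * ℓ = t - ℓ := by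
    rw [Finset.card_singleton, one_mul]
  -- The ambient space depends on this number, so it is replaced by t-ℓ through a variable.
  generalize t - ({i} : Finset (Fin (kay ℓ K₀ t))).card * ℓ = u at *
  subst e
  -- Only K(t)-1 planes are inherited, possibly fewer than K(t-ℓ). This is why the induction must
  -- cover arbitrary sets of labels and planes.
  have hJ' := h' (Finset.univ.map ⟨σ, hσ⟩)
    ((Finset.univ.filter fun j : {j // j ∈ ({i} : Finset (Fin (kay ℓ K₀ t)))ᶜ} => j.1 ∈ J).map
      ⟨σ, hσ⟩)
  have hcardJ : ((Finset.univ.filter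
      fun j : {j // j ∈ ({i} : Finset (Fin (kay ℓ K₀ t)))ᶜ} => j.1 ∈ J).map ⟨σ, hσ⟩).card =
        J.card := by
    rw [Finset.card_map, ← Finset.card_map (Function.Embedding.subtype _)]
    congr 1
    ext a
    simp only [Finset.mem_map, Finset.mem_filter, Finset.mem_univ, true_and,
      Function.Embedding.subtype_apply, Subtype.exists, Finset.mem_compl, Finset.mem_singleton]
    constructor
    · rintro ⟨a, _, ha, rfl⟩; exact ha
    · intro ha; exact ⟨a, fun e => hi (e ▸ ha), ha, rfl⟩
  have hcardL : (Finset.univ.map ⟨σ, hσ⟩).card + 1 = kay ℓ K₀ t := by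
    rw [Finset.card_map, Finset.card_univ, Fintype.card_coe, Finset.card_compl,
      Finset.card_singleton, Fintype.card_fin]
    have := i.pos
    omega
  have hnot : ∀ I, i ∉ labelPreimage σ I := by
    intro I hI
    obtain ⟨h1, -⟩ := mem_labelPreimage.1 hI
    simp at h1
  unfold ConfigurationSpans at hJ'
  rw [hcardJ] at hJ'
  let g : LabelIndex ℓ K₀ s (t - ℓ) (Finset.univ.map ⟨σ, hσ⟩) →
      LabelIndex ℓ K₀ s t Finset.univ := fun y =>
    ⟨(insert i (labelPreimage σ y.1.1), y.1.2), Finset.subset_univ _, by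
      have h1 := y.2.2
      dsimp only
      have h2 : (Finset.univ : Finset (Fin (kay ℓ K₀ t))).card - (y.1.1.card + 1) =
          (Finset.univ.map ⟨σ, hσ⟩).card - y.1.1.card := by
        rw [Finset.card_univ (α := Fin (kay ℓ K₀ t)), Fintype.card_fin]
        omega
      rw [Finset.card_insert_of_notMem (hnot _), card_labelPreimage hσ y.2.1, h2, Nat.succ_mul,
        add_comm _ ℓ, ← Nat.sub_sub]
      exact h1⟩
  have hg : Function.Injective g := by
    intro y y' hyy'
    have h1 := Prod.ext_iff.1 (congrArg Subtype.val hyy')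
    refine Subtype.ext (Prod.ext (labelPreimage_injOn hσ y.2.1 y'.2.1 ?_) h1.2)
    rw [← Finset.erase_insert (hnot y.1.1), ← Finset.erase_insert (hnot y'.1.1)]
    exact congrArg (Finset.erase · i) h1.1
  have hsup : (⨆ j ∈ insert i J, P t j) =
      (⨆ j ∈ J, P t j) ⊔ ⨅ j ∈ ({i} : Finset (Fin (kay ℓ K₀ t))), P t j := by
    rw [Finset.iInf_singleton, sup_comm, ← Finset.iSup_insert]
  unfold ConfigurationSpans at h
  rw [hsup] at h
  have := HasSpanningPoints.glue h hJ' (hX.isIrreducibleOfDim ht)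
    (hX.isIrreducibleOfDim (by omega)) hφ (fun x => hP.isIrr hℓ hX ht _) g hg
    (fun y => by
      dsimp only [g]
      rw [Finset.iInf_singleton, Finset.iInf_insert]
      exact inf_le_left)
    (fun y v => by
      dsimp only [g]
      rw [← mem_iInf_labelPreimage_iff hU hσ y.2.1, Finset.iInf_insert, Submodule.mem_inf]
      refine ⟨fun hv => hv.2, fun hv => ⟨?_, hv⟩⟩
      exact (Submodule.mem_iInf _).1 ((Submodule.mem_iInf _).1 v.2 i) (Finset.mem_singleton_self i))
    (fun u hu => symm_mem_iSup hU hσ hu)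
  exact this.mono (fun y => hP.exists_smooth hℓ hX ht _) id Function.injective_id
    (fun _ => le_rfl) hbJ

end Family

/-! ### The case of all planes, and the induction on t. -/

section Base

variable {k : Type*} [Field k]

theorem CarriesSection.finrank_le {n n' : ℕ} {X : Set (ℙ k (Fin n → k))}
    {Q : Submodule k (Fin n → k)} {Y : Set (ℙ k (Fin n' → k))} {φ : Q ≃ₗ[k] (Fin n' → k)}
    (hφ : CarriesSection X Q Y φ) (v : Q) :
    Module.finrank k (coneTangent Y (φ v)) ≤ Module.finrank k ↥(coneTangent X v ⊓ Q) := by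
  have h2 : (coneTangent Y (φ v)).map (Q.subtype.comp φ.symm.toLinearMap) ≤
      coneTangent X v ⊓ Q := by
    rintro _ ⟨u, hu, rfl⟩
    exact ⟨hφ.tangent_mem v hu, (φ.symm u).2⟩
  refine le_trans (le_of_eq ?_) (Submodule.finrank_mono h2)
  refine (LinearEquiv.finrank_eq (Submodule.equivMapOfInjective _ ?_ _))
  exact Q.injective_subtype.comp φ.symm.injective

theorem apply_sub_mul_eq {ℓ : ℕ} {m : ℕ → ℕ} {c : ℤ}
    (hm : ∀ t, ℓ < t → bdiff ℓ 1 (fun u => (m u : ℤ)) t = c) {t : ℕ} (j : ℕ) (hj : j * ℓ < t) :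
    (m (t - j * ℓ) : ℤ) = m t - j * c := by
  induction j with
  | zero => simp
  | succ j ih =>
    rw [Nat.succ_mul] at hj ⊢
    have h1 := ih (by omega)
    have h2 := hm (t - j * ℓ) (by omega)
    simp only [bdiff] at h2
    rw [Nat.sub_sub] at h2
    push_cast
    rw [add_mul]
    linarith

variable [CharZero k] {ℓ K₀ : ℕ} {N m : ℕ → ℕ}
  {X : (t : ℕ) → Set (ℙ k (Fin (N t) → k))}
  {P : (t : ℕ) → Fin (kay ℓ K₀ t) → Submodule k (Fin (N t) → k)}
  {P' : (t : ℕ) → Submodule k (Fin (N t) → k)}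

/-- At a generic point of `X t` on two of the planes, the tangent space is contained in the sum of
the planes. -/
theorem IsBOLattice.generic_tangent_le (hP : IsBOLattice ℓ K₀ N X P P') (hℓ : 1 ≤ ℓ)
    (hX : IsFamily N m X) {c : ℤ} (hm : ∀ t, ℓ < t → bdiff ℓ 1 (fun u => (m u : ℤ)) t = c)
    {t : ℕ} (ht : 1 ≤ t) {I : Finset (Fin (kay ℓ K₀ t))} (hI : 1 < I.card) :
    Generic k (affineCone (X t) ∩ (↑(⨅ j ∈ I, P t j) : Set (Fin (N t) → k))) fun v =>
      coneTangent (X t) v ≤ ⨆ j, P t j := by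
  obtain ⟨a, ha, a', ha', haa'⟩ := Finset.one_lt_card.1 hI
  have hIne : I.Nonempty := ⟨a, ha⟩
  have hlt := lt_of_nonempty hℓ ht hIne
  have hIt := (card_le_and_mul_lt hℓ ht I).2
  obtain ⟨φ, hφ, -⟩ := hP.iso t hlt I hIne
  have h1 := (hP.clean t hlt I hIne).generic (hX t ht).2
  have hY := (hX.isIrreducibleOfDim (t := t - I.card * ℓ) (by omega)).generic_smooth
  rw [← funext (coneTangent_eq _)] at hY
  refine (h1.and (hP.isIrr hℓ hX ht I) (hφ.generic hY)).mono ?_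
  rintro v ⟨hvX, hvI⟩ ⟨⟨hsm, hcl⟩, hv⟩
  -- The trace of the tangent space on P_J contains a tangent space of X(t-|J|ℓ), of dimension at
  -- least m(t) - |J|c. Cleanness and smoothness of the section give the reverse bound for J = I.
  refine le_trans (le_sup_of_finrank (m := m t) (c := c) (by exact_mod_cast hsm) (P := P t)
    (I := I) (fun J hJ hJne => ?_) ?_ ha ha' haa') (sup_le (le_iSup _ _) (le_iSup _ _))
  · obtain ⟨ψ, hψ, -⟩ := hP.iso t hlt J hJne
    have hJt := (card_le_and_mul_lt hℓ ht J).2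
    have hJI : (⨅ j ∈ I, P t j) ≤ ⨅ j ∈ J, P t j := biInf_mono fun j hj => hJ hj
    have hvJ : v ∈ ⨅ j ∈ J, P t j := hJI hvI
    have h2 := hψ.finrank_le ⟨v, hvJ⟩
    have h3 := (hX.isIrreducibleOfDim (t := t - J.card * ℓ) (by omega)).le_finrank_tangentSpace
      ((hψ ⟨v, hvJ⟩).1 hvX)
    rw [← coneTangent_eq] at h3
    rw [← apply_sub_mul_eq hm _ hJt]
    exact_mod_cast h3.trans h2
  · rw [← hcl, ← apply_sub_mul_eq hm _ hIt, ← hv hvI]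
    exact_mod_cast hφ.finrank_tangent_planeSection_le ⟨v, hvI⟩ (by rw [hcl]; exact inf_le_right)

variable {s : ℕ → ℤ} {b : ℕ → ℕ → ℤ}

/-- A generic configuration has the asserted dimension and smooth points at once; the rest is
renumbering. -/
theorem ConfigurationSpans.of_statementTrue (hP : IsBOLattice ℓ K₀ N X P P') (hℓ : 1 ≤ ℓ)
    (hX : IsFamily N m X) {t : ℕ} (ht : 1 ≤ t) (h : StatementTrue m X P s (kay ℓ K₀ t) t)
    (hb : b (kay ℓ K₀ t) t ≤ min (smallA ℓ N m s (kay ℓ K₀ t) t) (N t)) :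
    ConfigurationSpans m X P s b t Finset.univ Finset.univ := by
  have h1 := h.2
  simp only [holdsGenerically_iff, affineCone_planeSection] at h1
  have hirr : ∀ x : PointIndex ℓ K₀ s t, IsIrr (k := k)
      (affineCone (X t) ∩ (↑(⨅ j ∈ x.1, P t j) : Set (Fin (N t) → k))) :=
    fun x => hP.isIrr hℓ hX ht x.1
  have h2 : ∀ x : PointIndex ℓ K₀ s t, Generic k (Set.univ.pi fun x : PointIndex ℓ K₀ s t =>
      affineCone (X t) ∩ (↑(⨅ j ∈ x.1, P t j) : Set (Fin (N t) → k))) fun z =>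
        Module.finrank k (coneTangent (X t) (z x)) = m t :=
    fun x => Generic.eval (S := fun x : PointIndex ℓ K₀ s t =>
      affineCone (X t) ∩ (↑(⨅ j ∈ x.1, P t j) : Set (Fin (N t) → k))) (fun x => (hirr x).1)
      (hP.generic_smooth hℓ hX ht x.1)
  obtain ⟨z, hz, h3, h4⟩ :=
    (h1.and (IsIrr.pi hirr) (Generic.forall_fintype (IsIrr.pi hirr) h2)).exists
  have h5 : bigA X P (kay ℓ K₀ t) t z =
      (⨆ j ∈ (Finset.univ : Finset (Fin (kay ℓ K₀ t))), P t j) ⊔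
        ⨆ x, coneTangent (X t) (z x) := by
    rw [bigA]
    congr 1
    apply le_antisymm
    · exact iSup_le fun j => le_iSup₂_of_le j.1 (Finset.mem_univ _) le_rfl
    · exact iSup₂_le fun j _ => le_iSup_of_le (ι := {j : Fin (kay ℓ K₀ t) // j.val < kay ℓ K₀ t})
        ⟨j, j.2⟩ le_rfl
  have h6 : HasSpanningPoints (X t) (m t) (fun x : PointIndex ℓ K₀ s t => ⨅ j ∈ x.1, P t j)
      (⨆ j ∈ (Finset.univ : Finset (Fin (kay ℓ K₀ t))), P t j)
      (min (smallA ℓ N m s (kay ℓ K₀ t) t) (N t)) :=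
    ⟨z, fun x => hz x trivial, h4, by rw [← h5, h3]⟩
  have hcard : (Finset.univ : Finset (Fin (kay ℓ K₀ t))).card = kay ℓ K₀ t := by simp
  refine h6.mono (fun y => hP.exists_smooth hℓ hX ht _)
    (fun x => ⟨(x.1, x.2), Finset.subset_univ _, ?_⟩) (fun x y hxy => ?_) (fun x => le_rfl) ?_
  · have h7 := x.2.2
    unfold pointCount at h7
    dsimp only
    rw [hcard]
    omega
  · have h7 := Prod.ext_iff.1 (congrArg Subtype.val hxy)
    obtain ⟨I, a⟩ := x
    obtain ⟨I', a'⟩ := y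
    obtain rfl : I = I' := h7.1
    obtain rfl : a = a' := Fin.ext h7.2
    rfl
  · rwa [hcard]

/-- Distributivity identifies P' ∩ ∑P_j with ∑(P' ∩ P_j), so ∑P_j has the same codimension ∇^{K₀}N
in the whole space as its trace has in P'. The dimension formula concludes. -/
theorem IsBOLattice.iSup_sup_eq_top (hP : IsBOLattice ℓ K₀ N X P P') (hℓ : 1 ≤ ℓ) (hK₀ : 1 ≤ K₀)
    {cN : ℤ} (hN : ∀ t, K₀ * ℓ < t → bdiff ℓ K₀ (fun u => (N u : ℤ)) t = cN)
    {t : ℕ} (ht : tzero ℓ K₀ < t) : (⨆ j, P t j) ⊔ P' t = ⊤ := by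
  have ht₀ : K₀ * ℓ < tzero ℓ K₀ := by rw [tzero, mul_comm]; omega
  have hℓK : ℓ ≤ K₀ * ℓ := Nat.le_mul_of_pos_left ℓ hK₀
  have hk : kay ℓ K₀ t = K₀ := kay_eq hℓ (by omega)
  have e1 : bdiff ℓ (kay ℓ K₀ t) (fun u => (N u : ℤ)) t = cN := by
    rw [hk]; exact hN t (by omega)
  have e2 : bdiff ℓ (kay ℓ K₀ t) (fun u => (N u : ℤ)) (tzero ℓ K₀) = cN := by
    rw [hk]; exact hN _ ht₀
  obtain ⟨hl, hd⟩ := hP.lattice' t ht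
  have h1 := (hP.lattice t (by omega)).finrank_iSup
  have h2 := hl.finrank_iSup
  have h3 := hl.finrank_eq
  have h4 := hd.inf_iSup (U := P t)
    (fun j => subset_latticeClosure (Set.mem_insert_of_mem _ ⟨j, rfl⟩))
    (subset_latticeClosure (Set.mem_insert _ _)) Finset.univ
  simp only [Finset.mem_univ, iSup_pos] at h4
  rw [← h4] at h2
  have h5 := Submodule.finrank_sup_add_finrank_inf_eq (⨆ j, P t j) (P' t)
  rw [inf_comm] at h5
  rw [e1] at h1
  rw [e2] at h2
  refine Submodule.eq_top_of_finrank_eq ?_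
  rw [Module.finrank_fin_fun]
  omega

/-- Only points on exactly one plane matter modulo ∑P_j, and their number is the same at t and t₀.
Placed in P'(t), they reproduce the configuration at t₀, while ∑P_j + P' already fills the ambient
space. -/
theorem ConfigurationSpans.of_tzero (hP : IsBOLattice ℓ K₀ N X P P') (hℓ : 1 ≤ ℓ)
    (hK₀ : 1 ≤ K₀) (hX : IsFamily N m X) {c cN cs : ℤ}
    (hm : ∀ t, ℓ < t → bdiff ℓ 1 (fun u => (m u : ℤ)) t = c)
    (hN : ∀ t, K₀ * ℓ < t → bdiff ℓ K₀ (fun u => (N u : ℤ)) t = cN)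
    (hs : ∀ t, (K₀ - 1) * ℓ < t → bdiff ℓ (K₀ - 1) s t = cs)
    (h : ConfigurationSpans m X P s b (tzero ℓ K₀) Finset.univ Finset.univ)
    {t : ℕ} (ht : tzero ℓ K₀ < t) (hb : b K₀ t ≤ N t + b K₀ (tzero ℓ K₀) - N (tzero ℓ K₀)) :
    ConfigurationSpans m X P s b t Finset.univ Finset.univ := by
  classical
  have ht₀ : K₀ * ℓ < tzero ℓ K₀ := by rw [tzero, mul_comm]; omega
  have hKℓ : K₀ * ℓ = (K₀ - 1) * ℓ + ℓ := by
    rw [← Nat.succ_mul]; congr 1; omega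
  have hk : kay ℓ K₀ t = K₀ := kay_eq hℓ (by omega)
  have hk₀ : kay ℓ K₀ (tzero ℓ K₀) = K₀ := kay_eq hℓ ht₀
  have hc : (Finset.univ : Finset (Fin (kay ℓ K₀ t))).card = K₀ := by simp [hk]
  have hc₀ : (Finset.univ : Finset (Fin (kay ℓ K₀ (tzero ℓ K₀)))).card = K₀ := by simp [hk₀]
  have hs0 : bdiff ℓ K₀ s (tzero ℓ K₀) = 0 := by
    have := bdiff_succ_eq_zero hs (t := tzero ℓ K₀) (by rw [Nat.succ_mul]; omega)
    rwa [Nat.sub_add_cancel hK₀] at this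
  have hlab : ∀ x : LabelIndex ℓ K₀ s (tzero ℓ K₀) Finset.univ,
      (x.1.2 : ℤ) < bdiff ℓ (K₀ - x.1.1.card) s (tzero ℓ K₀ - x.1.1.card * ℓ) := by
    rintro ⟨x, -, hx⟩
    rwa [hc₀] at hx
  -- the points on at least two planes do not contribute at `tzero`
  have hold : HasSpanningPoints (X (tzero ℓ K₀)) (m (tzero ℓ K₀))
      (fun y : {x : LabelIndex ℓ K₀ s (tzero ℓ K₀) Finset.univ // x.1.1.card = 1} =>
        ⨅ j ∈ y.1.1.1, P (tzero ℓ K₀) j)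
      (⨆ j ∈ (Finset.univ : Finset (Fin (kay ℓ K₀ (tzero ℓ K₀)))), P (tzero ℓ K₀) j)
      (b K₀ (tzero ℓ K₀)) := by
    unfold ConfigurationSpans at h
    rw [congrArg (b · (tzero ℓ K₀)) hc₀] at h
    have hirr := fun x : LabelIndex ℓ K₀ s (tzero ℓ K₀) Finset.univ =>
      hP.isIrr hℓ hX (show 1 ≤ tzero ℓ K₀ by omega) x.1.1
    have h1 := h.generic (hX.isIrreducibleOfDim (show 1 ≤ tzero ℓ K₀ by omega))
    have h2 := Generic.forall_fintype (IsIrr.pi hirr)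
      (R := fun x z => 1 < x.1.1.card →
        coneTangent (X (tzero ℓ K₀)) (z x) ≤ ⨆ j, P (tzero ℓ K₀) j) (fun x => by
      by_cases hx : 1 < x.1.1.card
      · refine Generic.mono (Generic.eval (i := x) (fun x => (hirr x).1)
          (hP.generic_tangent_le hℓ hX hm (by omega) hx)) fun z _ hz _ => hz
      · exact Generic.of_forall (IsIrr.pi hirr).1 fun z _ h => absurd h hx)
    obtain ⟨z, hz, ⟨hsm, hbd⟩, hle⟩ := (h1.and (IsIrr.pi hirr) h2).exists
    refine ⟨fun y => z y.1, fun y => hz y.1 trivial, fun y => hsm y.1, hbd.trans ?_⟩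
    refine Int.ofNat_le.2 (Submodule.finrank_mono (sup_le le_sup_left (iSup_le fun x => ?_)))
    rcases Nat.lt_trichotomy x.1.1.card 1 with h0 | h0 | h0
    · have h3 := hlab x
      have h4 : x.1.1.card = 0 := by omega
      rw [h4, zero_mul, Nat.sub_zero, Nat.sub_zero, hs0] at h3
      omega
    · exact le_sup_of_le_right (le_iSup (fun y : {x : LabelIndex ℓ K₀ s (tzero ℓ K₀) Finset.univ //
        x.1.1.card = 1} => coneTangent (X (tzero ℓ K₀)) (z y.1)) ⟨x, h0⟩)
    · refine le_sup_of_le_left ((hle x h0).trans (iSup_le fun j => ?_))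
      exact le_iSup₂_of_le j (Finset.mem_univ j) le_rfl
  obtain ⟨φ, hφ, σ, hσ, hU⟩ := hP.iso' t ht ∅
  have e : tzero ℓ K₀ - (∅ : Finset (Fin (kay ℓ K₀ t))).card * ℓ = tzero ℓ K₀ := by
    rw [Finset.card_empty, zero_mul, Nat.sub_zero]
  generalize tzero ℓ K₀ - (∅ : Finset (Fin (kay ℓ K₀ t))).card * ℓ = u at *
  subst e
  -- K(t) = K(t₀) = K₀, so the injection of labels is a bijection.
  have hσu : Finset.univ.map ⟨σ, hσ⟩ = Finset.univ := by
    rw [← Finset.card_eq_iff_eq_univ, Finset.card_map, Fintype.card_fin, hk₀, Finset.card_univ,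
      Fintype.card_coe, Finset.compl_empty, hc]
  have hsub : ∀ I, I ⊆ Finset.univ.map ⟨σ, hσ⟩ := fun I => hσu ▸ Finset.subset_univ I
  have hsmooth : ∀ I : Finset (Fin (kay ℓ K₀ t)),
      ∃ v ∈ affineCone (X t) ∩ (↑(P' t ⊓ ⨅ j ∈ I, P t j) : Set (Fin (N t) → k)),
        Module.finrank k (coneTangent (X t) v) = m t := by
    intro I
    obtain ⟨v, hv, h1, -⟩ := ((hP.clean' t ht I).generic (hX t (by omega)).2).exists
    exact ⟨v, hv, h1⟩
  have htop : (⨆ j ∈ (Finset.univ : Finset (Fin (kay ℓ K₀ t))), P t j) ⊔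
      (P' t ⊓ ⨅ j ∈ (∅ : Finset (Fin (kay ℓ K₀ t))), P t j) = ⊤ := by
    simpa using hP.iSup_sup_eq_top hℓ hK₀ hN ht
  have hnew : HasSpanningPoints (X t) (m t)
      (fun y : {x : LabelIndex ℓ K₀ s (tzero ℓ K₀) Finset.univ // x.1.1.card = 1} =>
        P' t ⊓ ⨅ j ∈ labelPreimage σ y.1.1.1, P t j)
      ((⨆ j ∈ (Finset.univ : Finset (Fin (kay ℓ K₀ t))), P t j) ⊔
        (P' t ⊓ ⨅ j ∈ (∅ : Finset (Fin (kay ℓ K₀ t))), P t j)) (N t) := by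
    -- Any smooth points serve, since the planes together with P' already span everything.
    choose z hz hzsm using hsmooth
    refine ⟨fun y => z _, fun y => hz _, fun y => hzsm _, ?_⟩
    rw [htop, top_sup_eq, finrank_top, Module.finrank_fin_fun]
  have hglue := HasSpanningPoints.glue hnew hold (hX.isIrreducibleOfDim (by omega))
    (hX.isIrreducibleOfDim (by omega)) hφ (fun y => by
      obtain ⟨ψ, hψ, -⟩ := hP.iso' t ht (labelPreimage σ y.1.1.1)
      have h1 := (card_le_and_mul_lt hℓ (by omega) (labelPreimage σ y.1.1.1)).1
      have h2 := Nat.mul_le_mul_right ℓ h1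
      exact hψ.isIrr (hX.isIrreducibleOfDim (by omega)).isIrr)
    id Function.injective_id
    (fun y => by simp)
    (fun y v => by
      rw [id, ← mem_iInf_labelPreimage_iff hU hσ (hsub _), Submodule.mem_inf]
      exact ⟨fun hv => hv.2, fun hv => ⟨v.2.1, hv⟩⟩)
    (fun u hu => symm_mem_iSup hU hσ (J' := Finset.univ) (by
      simpa only [Finset.mem_univ, Finset.filter_true, hσu] using hu))
  unfold ConfigurationSpans
  rw [congrArg (b · t) hc]
  -- The points not on exactly one plane are filled in by arbitrary smooth points.
  refine hglue.mono (fun y => hP.exists_smooth hℓ hX (by omega) _)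
    (fun y => ⟨(labelPreimage σ y.1.1.1, y.1.1.2), Finset.subset_univ _, ?_⟩)
    (fun y y' hyy' => ?_) (fun y => inf_le_right) hb
  · have h1 := hlab y.1
    rw [y.2, one_mul, hs _ (by omega)] at h1
    dsimp only
    rw [hc, card_labelPreimage hσ (hsub _), y.2, one_mul, hs _ (by omega)]
    exact h1
  · have h1 := Prod.ext_iff.1 (congrArg Subtype.val hyy')
    exact Subtype.ext (Subtype.ext (Prod.ext (labelPreimage_injOn hσ (hsub _) (hsub _) h1.1) h1.2))

/-- Strong induction on t: establish the full configuration, then remove planes using the result at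
t-ℓ, then forget labels. The bound b is left abstract so as to serve both a_i and N. -/
theorem configurationSpans (hP : IsBOLattice ℓ K₀ N X P P') (hℓ : 1 ≤ ℓ)
    (hK₀ : 1 ≤ K₀) (hX : IsFamily N m X) {c cN cs : ℤ}
    (hm : ∀ t, ℓ < t → bdiff ℓ 1 (fun u => (m u : ℤ)) t = c)
    (hN : ∀ t, K₀ * ℓ < t → bdiff ℓ K₀ (fun u => (N u : ℤ)) t = cN)
    (hs : ∀ t, (K₀ - 1) * ℓ < t → bdiff ℓ (K₀ - 1) s t = cs)
    (hst : ∀ t, 1 ≤ t → t ≤ tzero ℓ K₀ → StatementTrue m X P s (kay ℓ K₀ t) t)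
    (hbase : ∀ t, 1 ≤ t → t ≤ tzero ℓ K₀ →
      b (kay ℓ K₀ t) t ≤ min (smallA ℓ N m s (kay ℓ K₀ t) t) (N t))
    (hb : ∀ j t, j + 1 ≤ K₀ → (j + 1) * ℓ < t →
      b j t ≤ b (j + 1) t + b j (t - ℓ) - N (t - ℓ))
    (hb₀ : ∀ t, tzero ℓ K₀ < t → b K₀ t ≤ N t + b K₀ (tzero ℓ K₀) - N (tzero ℓ K₀))
    (t : ℕ) (ht : 1 ≤ t) (L J : Finset (Fin (kay ℓ K₀ t))) :
    ConfigurationSpans m X P s b t L J := by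
  classical
  have hnn : ∀ j ≤ K₀, ∀ u, j * ℓ < u → 0 ≤ bdiff ℓ j s u := fun j hj u hu =>
    bdiff_nonneg hℓ hK₀ hs (fun t h1 h2 => (hst t h1 h2).1) hj hu
  have h₀ : 1 ≤ tzero ℓ K₀ := by rw [tzero]; omega
  induction t using Nat.strong_induction_on with
  | _ t ih =>
    have huniv : ConfigurationSpans m X P s b t Finset.univ Finset.univ := by
      rcases le_or_gt t (tzero ℓ K₀) with h | h
      · exact .of_statementTrue hP hℓ hX ht (hst t ht h) (hbase t ht h)
      · exact .of_tzero hP hℓ hK₀ hX hm hN hs (.of_statementTrue hP hℓ hX h₀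
          (hst _ h₀ le_rfl) (hbase _ h₀ le_rfl)) h (hb₀ t h)
    have hplane : ∀ D : Finset (Fin (kay ℓ K₀ t)),
        ConfigurationSpans m X P s b t Finset.univ (Finset.univ \ D) := by
      intro D
      induction D using Finset.induction_on with
      | empty => rwa [Finset.sdiff_empty]
      | insert i D hi hD =>
        have hlt : ℓ < t := lt_of_nonempty hℓ ht (Finset.singleton_nonempty i)
        refine .of_insert_plane hP hℓ hX hb ht (i := i) (by simp) ?_
          (fun L' J' => ih (t - ℓ) (by omega) (by omega) L' J')
        convert hD using 1
        ext a
        by_cases ha : a = i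
        · simp [ha, hi]
        · simp [ha]
    have hlabel : ∀ D : Finset (Fin (kay ℓ K₀ t)),
        ConfigurationSpans m X P s b t (Finset.univ \ D) J := by
      intro D
      induction D using Finset.induction_on with
      | empty =>
        rw [Finset.sdiff_empty]
        simpa using hplane (Finset.univ \ J)
      | insert i D hi hD =>
        have := hD.erase_label hP hℓ hX hnn ht (r := i) (by simp [hi])
        rwa [← Finset.sdiff_insert] at this
    simpa using hlabel (Finset.univ \ L)

end Base

/-! ### From configurations to secant varieties. -/

section Conclusion

variable {k : Type*} [Field k] [CharZero k] {ℓ K₀ : ℕ} {N m : ℕ → ℕ}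
  {X : (t : ℕ) → Set (ℙ k (Fin (N t) → k))}
  {P : (t : ℕ) → Fin (kay ℓ K₀ t) → Submodule k (Fin (N t) → k)}
  {P' : (t : ℕ) → Submodule k (Fin (N t) → k)} {s : ℕ → ℤ} {b : ℕ → ℕ → ℤ}

theorem ConfigurationSpans.hasSpanningPoints (hP : IsBOLattice ℓ K₀ N X P P') (hℓ : 1 ≤ ℓ)
    (hX : IsFamily N m X) {t : ℕ} (ht : 1 ≤ t) (h : ConfigurationSpans m X P s b t ∅ ∅)
    {r : ℕ} (hr : s t ≤ r) :
    HasSpanningPoints (X t) (m t) (fun _ : Fin r => ⊤) ⊥ (b 0 t) := by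
  unfold ConfigurationSpans at h
  rw [show (⨆ j ∈ (∅ : Finset (Fin (kay ℓ K₀ t))), P t j) = ⊥ by simp] at h
  have hlab : ∀ x : LabelIndex ℓ K₀ s t ∅, x.1.1 = ∅ ∧ (x.1.2 : ℤ) < s t := by
    rintro ⟨⟨I, a⟩, hI, ha⟩
    obtain rfl : I = ∅ := Finset.subset_empty.1 hI
    simpa [bdiff] using ha
  have hsm := hP.exists_smooth hℓ hX ht ∅
  refine h.mono (fun _ => ?_) (fun x => ⟨x.1.2, by have := (hlab x).2; omega⟩)
    (fun x y hxy => ?_) (fun x => le_top) le_rfl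
  · obtain ⟨v, hv, h1⟩ := hsm
    exact ⟨v, ⟨hv.1, trivial⟩, h1⟩
  · refine Subtype.ext (Prod.ext ?_ (Fin.mk.inj hxy))
    rw [(hlab x).1, (hlab y).1]

/-- Dropping one subspace lowers the dimension of the sum by at most m, so independence passes to
fewer points. -/
theorem mul_le_finrank_iSup_castLE {V : Type*} [AddCommGroup V] [Module k V]
    [FiniteDimensional k V] {m r S : ℕ} {T : Fin S → Submodule k V}
    (hT : ∀ i, Module.finrank k (T i) = m) (h : S * m ≤ Module.finrank k ↥(⨆ i, T i))
    (hr : r ≤ S) : r * m ≤ Module.finrank k ↥(⨆ i : Fin r, T (i.castLE hr)) := by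
  induction S with
  | zero =>
    obtain rfl : r = 0 := by omega
    simp
  | succ S ih =>
    rcases Nat.lt_or_eq_of_le hr with h1 | rfl
    · refine ih (T := fun i => T i.castSucc) (fun i => hT _) ?_ (by omega)
      have h2 : (⨆ i, T i) ≤ (⨆ i : Fin S, T i.castSucc) ⊔ T (Fin.last S) := by
        refine iSup_le fun i => ?_
        induction i using Fin.lastCases with
        | last => exact le_sup_right
        | cast i => exact le_sup_of_le_left (le_iSup (fun i : Fin S => T i.castSucc) i)
      have h3 := Submodule.finrank_mono h2
      have h4 := Submodule.finrank_add_le_finrank_add_finrank (⨆ i : Fin S, T i.castSucc)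
        (T (Fin.last S))
      rw [hT] at h4
      rw [Nat.succ_mul] at h
      omega
    · exact h

theorem HasSpanningPoints.isNondefective {n : ℕ} {X : Set (ℙ k (Fin n → k))} {m : ℕ}
    (hX : IsProjectiveVariety X) (hm : projDim X = (m : ℤ) - 1) {S r : ℕ}
    (h : HasSpanningPoints X m (fun _ : Fin S => ⊤) ⊥ (S * m : ℕ)) (hr : r ≤ S) :
    IsNondefective r X := by
  obtain ⟨z, hz, hsm, hb⟩ := h
  rw [bot_sup_eq] at hb
  refine isNondefective_of_finrank hX hm (p := fun i => z (i.castLE hr)) (fun i => (hz _).1)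
    (fun i => hsm _) ((min_le_left _ _).trans ?_)
  exact mul_le_finrank_iSup_castLE hsm (by exact_mod_cast hb) hr

theorem HasSpanningPoints.isNondefective_of_fill {n : ℕ} {X : Set (ℙ k (Fin n → k))} {m : ℕ}
    (hX : IsProjectiveVariety X) (hm : projDim X = (m : ℤ) - 1) {r : ℕ}
    (h : HasSpanningPoints X m (fun _ : Fin r => ⊤) ⊥ n) : IsNondefective r X := by
  obtain ⟨z, hz, hsm, hb⟩ := h
  rw [bot_sup_eq] at hb
  exact isNondefective_of_finrank hX hm (fun i => (hz i).1) hsm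
    ((min_le_right _ _).trans (by exact_mod_cast hb))

end Conclusion

end BOLattice

end

theorem mainTheorem6 {k : Type*} [Field k] [IsAlgClosed k] [CharZero k]
    (ℓ K₀ : ℕ) (hℓ : 1 ≤ ℓ) (hK₀ : 1 ≤ K₀)
    (N m : ℕ → ℕ)
    (hN : BOLattice.IsQuasipolynomialOfDegree ℓ K₀ (fun t => (N t : ℤ)))
    (hm : BOLattice.IsQuasipolynomialOfDegree ℓ 1 (fun t => (m t : ℤ)))
    (X : (t : ℕ) → Set (Projectivization k (Fin (N t) → k)))
    (hX : BOLattice.IsFamily N m X)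
    (P : (t : ℕ) → Fin (BOLattice.kay ℓ K₀ t) → Submodule k (Fin (N t) → k))
    (P' : (t : ℕ) → Submodule k (Fin (N t) → k))
    (hP : BOLattice.IsBOLattice ℓ K₀ N X P P')
    (s₁ s₂ : ℕ → ℤ)
    (hs₂ : ∀ t, s₂ t = ⌈(N t : ℚ) / (m t : ℚ)⌉)
    (hs₁ : ∀ t, s₁ t = s₂ t - 1)
    (hquasi : BOLattice.IsQuasipolynomial ℓ s₂) :
    BOLattice.IsQuasipolynomial ℓ s₁ ∧
    ((∀ t, 1 ≤ t → t ≤ BOLattice.tzero ℓ K₀ →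
        BOLattice.StatementTrue m X P s₁ (BOLattice.kay ℓ K₀ t) t ∧
        BOLattice.Subabundant ℓ N m s₁ (BOLattice.kay ℓ K₀ t) t) →
      (∀ t, 1 ≤ t → t ≤ BOLattice.tzero ℓ K₀ →
        BOLattice.StatementTrue m X P s₂ (BOLattice.kay ℓ K₀ t) t ∧
        BOLattice.Superabundant ℓ N m s₂ (BOLattice.kay ℓ K₀ t) t) →
      ∀ s t : ℕ, 1 ≤ s → 1 ≤ t → BOLattice.IsNondefective s (X t)) := by
  refine ⟨hquasi.sub_one hs₁, fun h₁ h₂ s t hs ht => ?_⟩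
  obtain ⟨c, hc⟩ := hm.exists_bdiff_eq hℓ
  obtain ⟨cN, hcN⟩ := hN.exists_bdiff_eq hℓ
  have hc' : ∀ t, ℓ < t → BOLattice.bdiff ℓ 1 (fun u => (m u : ℤ)) t = c := fun t ht =>
    hc t (by rwa [one_mul])
  have hmpos : ∀ t, 1 ≤ t → 1 ≤ m t := fun t ht => (hX t ht).1.one_le (hX t ht).2
  -- Shift 1 gives s₁ and shift 0 gives s₂.
  obtain ⟨c₁, hc₁⟩ := BOLattice.exists_bdiff_eq_of_ceil hℓ hK₀ hN hm hmpos hs₂ hquasi 1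
  obtain ⟨c₂, hc₂⟩ := BOLattice.exists_bdiff_eq_of_ceil hℓ hK₀ hN hm hmpos hs₂ hquasi 0
  rw [← funext hs₁] at hc₁
  simp only [sub_zero] at hc₂
  have ht₀ : K₀ * ℓ < BOLattice.tzero ℓ K₀ := by rw [BOLattice.tzero, mul_comm]; omega
  rcases le_or_gt (s : ℤ) (s₁ t) with hst | hst
  -- Subabundance makes a_i the expected dimension for t ≤ t₀, and both recursive inequalities for b
  -- hold with equality.
  · have hspan := BOLattice.configurationSpans (b := BOLattice.smallA ℓ N m s₁) hP hℓ hK₀ hX hc'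
      hcN hc₁ (fun t h h' => (h₁ t h h').1)
      (fun t h h' => le_min le_rfl (h₁ t h h').2)
      (fun j t _ h => (BOLattice.smallA_pred hc' h).le)
      (fun t h => by
        have e1 := BOLattice.smallA_sub_eq hK₀ hc' hcN hc₁ ht₀
        have e2 := BOLattice.smallA_sub_eq hK₀ hc' hcN hc₁ (ht₀.trans h)
        linarith) t ht ∅ ∅
    have hpts := hspan.hasSpanningPoints hP hℓ hX ht (Int.self_le_toNat (s₁ t))
    refine BOLattice.HasSpanningPoints.isNondefective (hX t ht).1 (hX t ht).2
      (S := (s₁ t).toNat) ?_ (by omega)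
    -- a₀(t) = s₁(t) m(t), with s₁(t) ≥ 1 because s ≥ 1.
    convert hpts using 1
    have : ((s₁ t).toNat : ℤ) = s₁ t := Int.toNat_of_nonneg (by omega)
    simp only [BOLattice.smallA, BOLattice.bdiff]
    push_cast
    rw [this]
    ring
  -- Here s ≥ s₂(t). Superabundance makes N the expected dimension for t ≤ t₀, and the recursive
  -- inequalities for b = N are trivial.
  · have hspan := BOLattice.configurationSpans (b := fun _ t => N t) hP hℓ hK₀ hX hc'
      hcN hc₂ (fun t h h' => (h₂ t h h').1)
      (fun t h h' => le_min (h₂ t h h').2 le_rfl)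
      (fun j t _ h => by simp) (fun t h => by simp) t ht ∅ ∅
    have := hs₁ t
    exact (hspan.hasSpanningPoints hP hℓ hX ht (r := s) (by omega)).isNondefective_of_fill
      (hX t ht).1 (hX t ht).2
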